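/- Let $L=L(v)$ be one of the following operators on $[0,\pi]$. (Hill) $Ly=-y''+vy$ with a complex-valued $v\in H^{-1}_{per}$, i.e. $v=c+Q'$ with $c\in\mathbb C$, $Q\in L^2([0,\pi])$. The operator is defined by means of the quasi-derivative: $y\in H^1$, $y'-Qy$ absolutely continuous, $Ly=-(y'-Qy)'-Qy'+cy\in L^2$, with the periodic ($+$) or antiperiodic ($-$) conditions $y(\pi)=\pm y(0)$, $(y'-Qy)(\pi)=\pm (y'-Qy)(0)$. Set $\lambda_n^0=n^2$, $r_n=n/4$ for $n\in\mathbb N$, $n\ge 1$. (Dirac) $Ly=i\begin{pmatrix}1&0\\0&-1\end{pmatrix}y'+\begin{pmatrix}0&P\\Q&0\end{pmatrix}y$ with $P,Q\in L^2([0,\pi])$ complex-valued and the conditions $y(\pi)=\pm y(0)$. Set $\lambda_n^0=n$, $r_n=1/2$ for $n\in\mathbb Z$. For $|n|$ large, the disc $|\lambda-\lambda_n^0|<r_n$ contains exactly two periodic (if $n$ is even) or antiperiodic (if $n$ is odd) eigenvalues of $L$, counted with algebraic multiplicity. Denote them by $\lambda_n^\pm$, where $\lambda_n^+$ is the one with the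 larger real part, or with the larger imaginary part if the real parts are equal, and put $z_n^\pm=\lambda_n^\pm-\lambda_n^0$, $z_n^*=\frac12(z_n^++z_n^-)$, $\gamma_n=\lambda_n^+-\lambda_n^-$. Let $\begin{pmatrix}\alpha_n(z)&\beta_n^-(z)\\ \beta_n^+(z)&\alpha_n(z)\end{pmatrix}$ be the matrix, in the basis $e^1_n,e^2_n$, of $S_n(z)=\sum_{k\ge 0}P_n(VD_n(z))^kVP_n$, where $V$ is multiplication by $v$, written in the Fourier basis, $P_n$ is the projection onto the span of $e_n^1,e_n^2$, and $D_n(z)$ is the reduced resolvent of the free operator at $\lambda_n^0+z$: in the Hill case $e^1_n=e^{-inx}$, $e^2_n=e^{inx}$, $\langle Ve^{ijx},e^{ikx}\rangle=V(k-j)$, where $V(0)=c$ and $V(m)=\frac{im}{\pi}\int_0^\pi Q(x)e^{-imx}dx$ for even $m\neq 0$, and $D_n(z)e^{ijx}=(n^2-j^2+z)^{-1}e^{ijx}$ for $j\in n+2\mathbb Z$, $j\neq\pm n$, $D_n(z)e^{\pm inx}=0$; in the Dirac case $e^1_k=(e^{-ikx},0)^T$, $e^2_k=(0,e^{ikx})^T$,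 $\langle Ve^2_j,e^1_k\rangle=p(-k-j)$, $\langle Ve^1_j,e^2_k\rangle=q(k+j)$, the other entries being $0$, where $p(m),q(m)$ are the coefficients of $e^{imx}$, $m\in 2\mathbb Z$, in the Fourier series of $P,Q$ on $[0,\pi]$, and $D_n(z)e^{i}_j=(n-j+z)^{-1}e^{i}_j$ for $i=1,2$, $j\in n+2\mathbb Z$, $j\ne n$, $D_n(z)e^{i}_n=0$. (All these series converge for $|n|$ large and $|z|\le r_n$.) Put $D_n=\{z:\ |z-z_n^*|\le 2(|\beta_n^-(z_n^*)|+|\beta_n^+(z_n^*)|)\}$. Let $\Delta$ be an infinite set of indices $n$ ($n\in\mathbb N$ in the Hill case, $n\in\mathbb Z$ in the Dirac case), all even or all odd, and let $\eta_n>0$, $\eta_n\to0$ ($n\in\Delta$), be such that, for $n\in\Delta$ with $|n|$ large, $\beta_n^-(z_n^*)\ne0$, $\beta_n^+(z_n^*)\neq 0$ and $$\beta_n^\pm(z)=\beta_n^\pm(z_n^*)\,(1+O(\eta_n)),\qquad z\in D_n,$$ with the $O$-constant independent of $n$ and $z$. Then, for all $n\in\Delta$ with $|n|$ large enough, $\lambda_n^-$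 and $\lambda_n^+$ are the only eigenvalues (periodic for even $n$, antiperiodic for odd $n$) in the disc $|\lambda-\lambda_n^0|<r_n$, and there are analytic branches $\sqrt{\beta_n^\pm(z)}$ of $[\beta_n^\pm(z)]^{1/2}$, defined in a neighbourhood of $D_n$, such that $z_n^+$ is the only root in $D_n$ of $$z-\alpha_n(z)=\sqrt{\beta_n^-(z)}\sqrt{\beta_n^+(z)}$$ and $z_n^-$ is the only root in $D_n$ of $$z-\alpha_n(z)=-\sqrt{\beta_n^-(z)}\sqrt{\beta_n^+(z)}.$$ Moreover, with these branches, $\gamma_n\sim 2\sqrt{\beta_n^-(z_n^*)}\sqrt{\beta_n^+(z_n^*)}$, $n\in\Delta$, that is, the ratio of the two sides tends to $1$ as $|n|\to\infty$, $n\in\Delta$. -/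

import Mathlib

open MeasureTheory Filter Topology

noncomputable section

namespace SpectralGap

/-! ### Periodic and antiperiodic Hill and Dirac operators on `[0, π]` -/

/-- Lebesgue measure on the interval `[0, π]`. -/
def intervalMeasure : Measure ℝ := volume.restrict (Set.Icc 0 Real.pi)

/-- `y` is absolutely continuous on `[0, π]` with derivative `g ∈ L¹(0, π)`. -/
def HasL1Deriv (y g : ℝ → ℂ) : Prop :=
  IntervalIntegrable g volume 0 Real.pi ∧
    ∀ x ∈ Set.Icc 0 Real.pi, y x = y 0 + ∫ t in (0 : ℝ)..x, g t

/-- The graph of the Hill operator `L y = -y'' + v y` with the singular potential `v = c + Q'`,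
`Q ∈ L²`, and the boundary conditions of sign `σ` (`σ = 1` periodic, `σ = -1` antiperiodic),
defined through the quasi-derivative `u = y' - Q y`:
`y ∈ H¹`, `u` is absolutely continuous, `L y = -u' - Q y' + c y ∈ L²`,
`y(π) = σ y(0)` and `u(π) = σ u(0)`.
`HillGraph c Q σ y f` says that `y` is in the domain and `L y = f`. -/
def HillGraph (c : ℂ) (Q : ℝ → ℂ) (σ : ℂ) (y f : ℝ → ℂ) : Prop :=
  ∃ y' u u' : ℝ → ℂ,
    HasL1Deriv y y' ∧ MemLp y' 2 intervalMeasure ∧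
    (∀ᵐ x ∂intervalMeasure, u x = y' x - Q x * y x) ∧ HasL1Deriv u u' ∧
    (∀ᵐ x ∂intervalMeasure, f x = -u' x - Q x * y' x + c * y x) ∧ MemLp f 2 intervalMeasure ∧
    y Real.pi = σ * y 0 ∧ u Real.pi = σ * u 0

/-- `lam` is an eigenvalue of the Hill operator with boundary conditions of sign `σ`. -/
def IsHillEigenvalue (c : ℂ) (Q : ℝ → ℂ) (σ lam : ℂ) : Prop :=
  ∃ y : ℝ → ℂ, (∃ x ∈ Set.Icc 0 Real.pi, y x ≠ 0) ∧ HillGraph c Q σ y (fun x => lam * y x)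

/-- The graph of the Dirac operator `L y = i diag(1, -1) y' + (0 P; Q 0) y`, `y = (y₁, y₂)`, with
the boundary conditions `y(π) = σ y(0)`.
`DiracGraph P Q σ y₁ y₂ f₁ f₂` says that `y` is in the domain and `L y = (f₁, f₂)`. -/
def DiracGraph (P Q : ℝ → ℂ) (σ : ℂ) (y₁ y₂ f₁ f₂ : ℝ → ℂ) : Prop :=
  ∃ g₁ g₂ : ℝ → ℂ,
    HasL1Deriv y₁ g₁ ∧ HasL1Deriv y₂ g₂ ∧
    (∀ᵐ x ∂intervalMeasure, f₁ x = Complex.I * g₁ x + P x * y₂ x) ∧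
    (∀ᵐ x ∂intervalMeasure, f₂ x = -Complex.I * g₂ x + Q x * y₁ x) ∧
    MemLp f₁ 2 intervalMeasure ∧ MemLp f₂ 2 intervalMeasure ∧
    y₁ Real.pi = σ * y₁ 0 ∧ y₂ Real.pi = σ * y₂ 0

/-- `lam` is an eigenvalue of the Dirac operator with boundary conditions of sign `σ`. -/
def IsDiracEigenvalue (P Q : ℝ → ℂ) (σ lam : ℂ) : Prop :=
  ∃ y₁ y₂ : ℝ → ℂ, (∃ x ∈ Set.Icc 0 Real.pi, y₁ x ≠ 0 ∨ y₂ x ≠ 0) ∧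
    DiracGraph P Q σ y₁ y₂ (fun x => lam * y₁ x) (fun x => lam * y₂ x)

/-! ### The functionals `α_n` and `β_n^±` -/

/-- The coefficient of `e^{imx}` (`m` even) in the Fourier series of `f` on `[0, π]`. -/
def fourierCoeffPi (f : ℝ → ℂ) (m : ℤ) : ℂ :=
  (Real.pi : ℂ)⁻¹ * ∫ x in (0 : ℝ)..Real.pi, f x * Complex.exp (-(Complex.I * m * x))

/-- The Fourier coefficients of the distribution `v = c + Q'`. -/
def hillCoeff (c : ℂ) (Q : ℝ → ℂ) (m : ℤ) : ℂ :=
  if m = 0 then c else Complex.I * m * fourierCoeffPi Q m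

/-- `iterEntry V d b k a` is the entry `⟨(V d)^k V e_b, e_a⟩`, where `V` is an infinite matrix and
`d` a diagonal one; that is
`∑_{j₁, …, j_k} V(a, j₁) d(j₁) V(j₁, j₂) d(j₂) ⋯ d(j_k) V(j_k, b)`. -/
def iterEntry {ι : Type} (V : ι → ι → ℂ) (d : ι → ℂ) (b : ι) : ℕ → ι → ℂ
  | 0, a => V a b
  | k + 1, a => ∑' j, V a j * d j * iterEntry V d b k j

/-- The entry `S(a, b) = ∑_{k ≥ 0} ⟨(V d)^k V e_b, e_a⟩`. -/
def reducedEntry {ι : Type} (V : ι → ι → ℂ) (d : ι → ℂ) (a b : ι) : ℂ :=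
  ∑' k, iterEntry V d b k a

/-- The matrix of multiplication by `v = c + Q'` in the basis `e^{ikx}`. -/
def hillMatrix (c : ℂ) (Q : ℝ → ℂ) (k j : ℤ) : ℂ := hillCoeff c Q (k - j)

/-- The reduced resolvent of `-d²/dx²` at `n² + z`: the value `1 / (n² - j² + z)` at the indices
`j ∈ n + 2ℤ`, `j ≠ ±n`. -/
def hillDiag (n : ℤ) (z : ℂ) (j : ℤ) : ℂ :=
  if Even (j - n) ∧ j ≠ n ∧ j ≠ -n then ((n : ℂ) ^ 2 - (j : ℂ) ^ 2 + z)⁻¹ else 0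

/-- The matrix of `v = (0 P; Q 0)` in the basis `(false, k) ↦ e¹_k = (e^{-ikx}, 0)`,
`(true, k) ↦ e²_k = (0, e^{ikx})`. -/
def diracMatrix (P Q : ℝ → ℂ) : Bool × ℤ → Bool × ℤ → ℂ
  | (false, k), (true, j) => fourierCoeffPi P (-k - j)
  | (true, k), (false, j) => fourierCoeffPi Q (k + j)
  | (false, _), (false, _) => 0
  | (true, _), (true, _) => 0

/-- The reduced resolvent of the free Dirac operator at `n + z`: the value `1 / (n - j + z)` at the
indices `j ∈ n + 2ℤ`, `j ≠ n`. -/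
def diracDiag (n : ℤ) (z : ℂ) (a : Bool × ℤ) : ℂ :=
  if Even (a.2 - n) ∧ a.2 ≠ n then ((n : ℂ) - (a.2 : ℂ) + z)⁻¹ else 0

/-! ### Hill and Dirac potentials together -/

/-- A potential: `hill c Q` is the Hill potential `v = c + Q'`, `dirac P Q` the Dirac potential
`v = (0 P; Q 0)`. -/
inductive Potential : Type
  | hill (c : ℂ) (Q : ℝ → ℂ)
  | dirac (P Q : ℝ → ℂ)

namespace Potential

/-- `v ∈ H^{-1}_per`, that is `v = c + Q'` with `Q ∈ L²`, in the Hill case;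
`P, Q ∈ L²` in the Dirac case. -/
def Admissible : Potential → Prop
  | hill _ Q => MemLp Q 2 intervalMeasure
  | dirac P Q => MemLp P 2 intervalMeasure ∧ MemLp Q 2 intervalMeasure

/-- The indices of the spectral gaps: `ℕ` in the Hill case, `ℤ` in the Dirac case. -/
def indices : Potential → Set ℤ
  | hill _ _ => {n | 0 < n}
  | dirac _ _ => Set.univ

/-- `λ_n^0`: `n²` in the Hill case, `n` in the Dirac case. -/
def lam0 : Potential → ℤ → ℂ
  | hill _ _, n => (n : ℂ) ^ 2
  | dirac _ _, n => n

/-- The radius of the disc about `λ_n^0`: `n / 4` in the Hill case, `1 / 2` in the Dirac case. -/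
def radius : Potential → ℤ → ℝ
  | hill _ _, n => (n : ℝ) / 4
  | dirac _ _, _ => 1 / 2

/-- `lam` is an eigenvalue of `L` with boundary conditions of sign `σ`. -/
def IsEigenvalue : Potential → ℂ → ℂ → Prop
  | hill c Q, σ, lam => IsHillEigenvalue c Q σ lam
  | dirac P Q, σ, lam => IsDiracEigenvalue P Q σ lam

/-- The periodic (`n` even) or antiperiodic (`n` odd) eigenvalues close to `λ_n^0`. -/
def eigenvaluesNear (v : Potential) (n : ℤ) : Set ℂ :=
  {lam | v.IsEigenvalue ((-1 : ℂ) ^ n) lam ∧ ‖lam - v.lam0 n‖ < v.radius n}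

/-- `α_n(z)`: the diagonal entry of the reduced matrix. -/
def alpha : Potential → ℤ → ℂ → ℂ
  | hill c Q, n, z => reducedEntry (hillMatrix c Q) (hillDiag n z) (-n) (-n)
  | dirac P Q, n, z => reducedEntry (diracMatrix P Q) (diracDiag n z) (false, n) (false, n)

/-- `β_n^-(z)`: the upper right entry of the reduced matrix. -/
def betaMinus : Potential → ℤ → ℂ → ℂ
  | hill c Q, n, z => reducedEntry (hillMatrix c Q) (hillDiag n z) (-n) n
  | dirac P Q, n, z => reducedEntry (diracMatrix P Q) (diracDiag n z) (false, n) (true, n)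

/-- `β_n^+(z)`: the lower left entry of the reduced matrix. -/
def betaPlus : Potential → ℤ → ℂ → ℂ
  | hill c Q, n, z => reducedEntry (hillMatrix c Q) (hillDiag n z) n (-n)
  | dirac P Q, n, z => reducedEntry (diracMatrix P Q) (diracDiag n z) (true, n) (false, n)

end Potential

/-- Comparison by real part, then by imaginary part. -/
def LexLE (a b : ℂ) : Prop := a.re < b.re ∨ (a.re = b.re ∧ a.im ≤ b.im)

open Classical in
/-- The lexicographically largest element of a set of complex numbers (`0` if there is none). -/
def lexMax (S : Set ℂ) : ℂ :=
  if h : ∃ a ∈ S, ∀ b ∈ S, LexLE b a then h.choose else 0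

open Classical in
/-- The lexicographically smallest element of a set of complex numbers (`0` if there is none). -/
def lexMin (S : Set ℂ) : ℂ :=
  if h : ∃ a ∈ S, ∀ b ∈ S, LexLE a b then h.choose else 0

namespace Potential

/-- `λ_n^+`: of the eigenvalues close to `λ_n^0`, the one with the larger real part, or with the
larger imaginary part if the real parts are equal. There being two of them with multiplicity,
`λ_n^+ = λ_n^-` exactly when there is a double one. -/
def lamPlus (v : Potential) (n : ℤ) : ℂ := lexMax (v.eigenvaluesNear n)

/-- `λ_n^-`: the other one of the two eigenvalues close to `λ_n^0`. -/
def lamMinus (v : Potential) (n : ℤ) : ℂ := lexMin (v.eigenvaluesNear n)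

/-- `z_n^+ = λ_n^+ - λ_n^0`. -/
def zPlus (v : Potential) (n : ℤ) : ℂ := v.lamPlus n - v.lam0 n

/-- `z_n^- = λ_n^- - λ_n^0`. -/
def zMinus (v : Potential) (n : ℤ) : ℂ := v.lamMinus n - v.lam0 n

/-- `z_n^* = (z_n^+ + z_n^-) / 2`. -/
def zStar (v : Potential) (n : ℤ) : ℂ := (v.zPlus n + v.zMinus n) / 2

/-- The spectral gap `γ_n = λ_n^+ - λ_n^-`. -/
def gap (v : Potential) (n : ℤ) : ℂ := v.lamPlus n - v.lamMinus n

/-- The closed disc `D_n` with centre `z_n^*` and radius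
`ρ_n = 2 (|β_n^-(z_n^*)| + |β_n^+(z_n^*)|)`. -/
def disc (v : Potential) (n : ℤ) : Set ℂ :=
  Metric.closedBall (v.zStar n)
    (2 * (‖v.betaMinus n (v.zStar n)‖ + ‖v.betaPlus n (v.zStar n)‖))

end Potential

end SpectralGap

end

/-!
In the Fourier basis, `L y = (λ_n^0 + z) y` is an infinite linear system. The matrix `V` need not be
bounded on `ℓ²`, but if `D j ≥ |D_n(z)_jj|` for `|z| < r_n`, then the matrix with the entries
`D_i^{1/2} V_ij D_j^{1/2}` is Hilbert–Schmidt, and its norm tends to `0` as `|n| → ∞`. Hence the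
coordinates off `e_n^1, e_n^2` are given by a Neumann series, and what remains is the
two-dimensional system with matrix `z - S_n(z)`. As a reflection of the indices exchanges the two
diagonal entries of `S_n`, this system is singular if and only if
`(z - α_n(z))² = β_n^-(z) β_n^+(z)`.

The functions `α_n`, `β_n^±` are analytic and `o(r_n)` in the disc `|z| < r_n`. Comparison with `z²`
shows that the equation has at least one and at most two roots there; these are `z_n^±`. If `β_n^±`
hardly vary on `D_n`, then neither do the branches of their square roots, so that both maps
`α_n ± √β_n^- √β_n^+` are contractions near `z_n^*` and have fixed points in `D_n`. The two fixed
points differ because `√β_n^- √β_n^+` has no zero in `D_n`, hence they are `z_n^±` up to the choice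
of one sign. Subtracting the two fixed point equations gives
`γ_n (1 + o(1)) = 2 √β_n^-(z_n^*) √β_n^+(z_n^*) (1 + o(1))`.
-/

namespace SpectralGap

/-! ### Analytic perturbations of `z²` -/

section CauchyEstimate

variable {E : Type*} [NormedAddCommGroup E] [NormedSpace ℂ E] {f : ℂ → E} {c : ℂ} {R R' M : ℝ}

theorem norm_deriv_le_of_norm_le_on_ball (hR : R' < R) (hf : DifferentiableOn ℂ f (Metric.ball c R))
    (hM : ∀ z ∈ Metric.ball c R, ‖f z‖ ≤ M) {x : ℂ} (hx : x ∈ Metric.ball c R') :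
    ‖deriv f x‖ ≤ M / (R - R') := by
  have hsub : Metric.closedBall x (R - R') ⊆ Metric.ball c R := by
    intro y hy
    rw [Metric.mem_closedBall] at hy
    rw [Metric.mem_ball] at *
    linarith [dist_triangle y x c]
  exact Complex.norm_deriv_le_of_forall_mem_sphere_norm_le (by linarith)
    ((hf.mono hsub).diffContOnCl_ball subset_rfl)
    fun z hz => hM z (hsub (Metric.sphere_subset_closedBall hz))

theorem norm_sub_le_of_norm_le_on_ball (hR : R' < R) (hf : DifferentiableOn ℂ f (Metric.ball c R))
    (hM : ∀ z ∈ Metric.ball c R, ‖f z‖ ≤ M) {x y : ℂ} (hx : x ∈ Metric.ball c R')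
    (hy : y ∈ Metric.ball c R') : ‖f y - f x‖ ≤ M / (R - R') * ‖y - x‖ :=
  Convex.norm_image_sub_le_of_norm_deriv_le (s := Metric.ball c R')
    (fun _ hw => hf.differentiableAt
      (Metric.isOpen_ball.mem_nhds (Metric.ball_subset_ball hR.le hw)))
    (fun _ hw => norm_deriv_le_of_norm_le_on_ball hR hf hM hw) (convex_ball _ _) hx hy

theorem norm_dslope_le_of_norm_le_on_ball (hR : R' < R)
    (hf : DifferentiableOn ℂ f (Metric.ball c R)) (hM : ∀ z ∈ Metric.ball c R, ‖f z‖ ≤ M)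
    {x y : ℂ} (hx : x ∈ Metric.ball c R') (hy : y ∈ Metric.ball c R') :
    ‖dslope f x y‖ ≤ M / (R - R') := by
  rcases eq_or_ne y x with rfl | hyx
  · rw [dslope_same]
    exact norm_deriv_le_of_norm_le_on_ball hR hf hM hy
  · rw [dslope_of_ne _ hyx, slope_def_module, norm_smul, norm_inv,
      inv_mul_le_iff₀ (norm_pos_iff.2 (sub_ne_zero.2 hyx)), mul_comm]
    exact norm_sub_le_of_norm_le_on_ball hR hf hM hx hy

end CauchyEstimate

section NearSquare

variable {F : ℂ → ℂ} {r M : ℝ}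

theorem norm_lt_of_zero_of_near_sq (hr : 0 < r)
    (hM : ∀ z ∈ Metric.ball (0 : ℂ) r, ‖F z - z ^ 2‖ ≤ M) (hMr : 16 * M < r ^ 2) {z : ℂ}
    (hz : z ∈ Metric.ball (0 : ℂ) r) (hFz : F z = 0) : ‖z‖ < r / 4 := by
  have hsq : ‖z‖ ^ 2 ≤ M := by simpa [hFz] using hM z hz
  exact lt_of_pow_lt_pow_left₀ 2 (by positivity) (by nlinarith)

/-- Otherwise `1 / F` would violate the maximum principle on `|z| ≤ r / 2`. -/
theorem exists_zero_of_near_sq (hr : 0 < r) (hF : DifferentiableOn ℂ F (Metric.ball 0 r))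
    (hM : ∀ z ∈ Metric.ball (0 : ℂ) r, ‖F z - z ^ 2‖ ≤ M) (hMr : 16 * M < r ^ 2) :
    ∃ z ∈ Metric.ball (0 : ℂ) r, F z = 0 := by
  by_contra! hF0
  have hsub : Metric.closedBall (0 : ℂ) (r / 2) ⊆ Metric.ball 0 r :=
    Metric.closedBall_subset_ball (by linarith)
  have h0r : (0 : ℂ) ∈ Metric.ball (0 : ℂ) r := Metric.mem_ball_self hr
  have hinv : DiffContOnCl ℂ (fun z => (F z)⁻¹) (Metric.ball 0 (r / 2)) :=
    ((hF.inv hF0).mono hsub).diffContOnCl_ball subset_rfl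
  have hboundary : ∀ z ∈ frontier (Metric.ball (0 : ℂ) (r / 2)), ‖(F z)⁻¹‖ ≤ (r ^ 2 / 8)⁻¹ := by
    intro z hz
    rw [frontier_ball _ (by linarith)] at hz
    have hzn : ‖z‖ = r / 2 := mem_sphere_zero_iff_norm.1 hz
    rw [norm_inv]
    refine inv_anti₀ (by positivity) ?_
    have h1 := hM z (hsub (Metric.sphere_subset_closedBall hz))
    have h2 := norm_sub_norm_le (z ^ 2) (F z)
    rw [norm_sub_rev, norm_pow, hzn] at h2
    linarith [sq_pos_of_pos hr]
  have hcenter := Complex.norm_le_of_forall_mem_frontier_norm_le Metric.isBounded_ball hinv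
    hboundary (subset_closure (Metric.mem_ball_self (by linarith : (0 : ℝ) < r / 2)))
  rw [norm_inv, inv_le_inv₀ (norm_pos_iff.2 (hF0 0 h0r)) (by positivity)] at hcenter
  have hF00 : ‖F 0‖ ≤ M := by simpa using hM 0 h0r
  linarith [norm_nonneg (F 0)]

/-- The divided difference at the zero `a` of the perturbation `F - z²` equals `-(z + a)` at every
other zero `z`, and it is a contraction. -/
theorem eq_of_zeros_of_near_sq (hr : 0 < r) (hF : DifferentiableOn ℂ F (Metric.ball 0 r))
    (hM : ∀ z ∈ Metric.ball (0 : ℂ) r, ‖F z - z ^ 2‖ ≤ M) (hMr : 16 * M < r ^ 2) {a b c : ℂ}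
    (ha : a ∈ Metric.ball (0 : ℂ) r) (hb : b ∈ Metric.ball (0 : ℂ) r)
    (hc : c ∈ Metric.ball (0 : ℂ) r) (hFa : F a = 0) (hFb : F b = 0) (hFc : F c = 0)
    (hba : b ≠ a) (hca : c ≠ a) : b = c := by
  set δ : ℂ → ℂ := fun z => F z - z ^ 2
  have hδ : DifferentiableOn ℂ δ (Metric.ball 0 r) := hF.sub (differentiableOn_pow 2)
  have hzero : ∀ z ∈ Metric.ball (0 : ℂ) r, F z = 0 → z ∈ Metric.ball (0 : ℂ) (r / 4) :=
    fun z hz h => mem_ball_zero_iff.2 (norm_lt_of_zero_of_near_sq hr hM hMr hz h)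
  have ha2 : a ∈ Metric.ball (0 : ℂ) (r / 2) :=
    Metric.ball_subset_ball (by linarith) (hzero a ha hFa)
  have hslope : DifferentiableOn ℂ (dslope δ a) (Metric.ball 0 (r / 2)) :=
    (Complex.differentiableOn_dslope (Metric.isOpen_ball.mem_nhds ha2)).2
      (hδ.mono (Metric.ball_subset_ball (by linarith)))
  have hcontr := norm_sub_le_of_norm_le_on_ball (by linarith : r / 4 < r / 2) hslope
    (fun z hz => norm_dslope_le_of_norm_le_on_ball (by linarith : r / 2 < r) hδ hM ha2 hz)
    (hzero b hb hFb) (hzero c hc hFc)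
  have hval : ∀ z, z ≠ a → F z = 0 → dslope δ a z = -(z + a) := by
    intro z hza hFz
    rw [dslope_of_ne _ hza, slope_def_field, div_eq_iff (sub_ne_zero.2 hza)]
    simp only [δ, hFa, hFz]
    ring
  rw [hval b hba hFb, hval c hca hFc, show -(c + a) - -(b + a) = -(c - b) by ring, norm_neg,
    show M / (r - r / 2) / (r / 2 - r / 4) = 8 * M / r ^ 2 by field_simp; ring] at hcontr
  have hlt : 8 * M / r ^ 2 < 1 := by
    rw [div_lt_one (by positivity)]
    linarith [(norm_nonneg _).trans (hM a ha)]
  by_contra hbc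
  exact absurd hcontr (not_le.2
    (mul_lt_of_lt_one_left (norm_pos_iff.2 (sub_ne_zero.2 (Ne.symm hbc))) hlt))

end NearSquare

/-! ### The equation `(z - α(z))² = β₁(z) β₂(z)` -/

/-- `f` is analytic on the disc `|z| < r` and bounded there by `ε r`, so that its Lipschitz constant
on a smaller disc is of the order of `ε`. -/
structure IsSmallOn (r ε : ℝ) (f : ℂ → ℂ) : Prop where
  differentiableOn : DifferentiableOn ℂ f (Metric.ball 0 r)
  norm_le : ∀ z ∈ Metric.ball (0 : ℂ) r, ‖f z‖ ≤ ε * r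

theorem IsSmallOn.norm_sub_le {r ε : ℝ} {f : ℂ → ℂ} (hf : IsSmallOn r ε f) (hr : 0 < r) {x y : ℂ}
    (hx : x ∈ Metric.ball (0 : ℂ) (r / 2)) (hy : y ∈ Metric.ball (0 : ℂ) (r / 2)) :
    ‖f y - f x‖ ≤ 2 * ε * ‖y - x‖ := by
  have := norm_sub_le_of_norm_le_on_ball (by linarith : r / 2 < r) hf.differentiableOn hf.norm_le
    hx hy
  rwa [show ε * r / (r - r / 2) = 2 * ε by field_simp; ring] at this

/-- The entries of the matrix `(α β₁; β₂ α)` are small analytic functions on the disc `|z| < r`; the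
equation `(z - α)² = β₁ β₂` says that `z` is an eigenvalue of the matrix at `z`. -/
structure SmallEntries (r ε : ℝ) (α β₁ β₂ : ℂ → ℂ) : Prop where
  pos : 0 < r
  alpha : IsSmallOn r ε α
  beta_one : IsSmallOn r ε β₁
  beta_two : IsSmallOn r ε β₂

theorem norm_add_div_two_lt {a b : ℂ} {R : ℝ} (ha : ‖a‖ < R) (hb : ‖b‖ < R) :
    ‖(a + b) / 2‖ < R := by
  rw [norm_div, div_lt_iff₀ (by simp), Complex.norm_ofNat]
  linarith [norm_add_le a b]

theorem norm_le_add_div_two_of_sq_eq_mul {w a b : ℂ} (h : w ^ 2 = a * b) :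
    ‖w‖ ≤ (‖a‖ + ‖b‖) / 2 := by
  have hsq : ‖w‖ ^ 2 = ‖a‖ * ‖b‖ := by rw [← norm_pow, h, norm_mul]
  refine (abs_le_of_sq_le_sq' ?_ (by positivity)).2
  rw [hsq]
  linarith [sq_nonneg (‖a‖ - ‖b‖)]

namespace SmallEntries

variable {r ε : ℝ} {α β₁ β₂ : ℂ → ℂ}

theorem eps_nonneg (h : SmallEntries r ε α β₁ β₂) : 0 ≤ ε :=
  nonneg_of_mul_nonneg_left
    ((norm_nonneg _).trans (h.alpha.norm_le 0 (Metric.mem_ball_self h.pos))) h.pos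

theorem differentiableOn_det (h : SmallEntries r ε α β₁ β₂) :
    DifferentiableOn ℂ (fun z => (z - α z) ^ 2 - β₁ z * β₂ z) (Metric.ball 0 r) :=
  ((differentiableOn_id.sub h.alpha.differentiableOn).pow 2).sub
    (h.beta_one.differentiableOn.mul h.beta_two.differentiableOn)

theorem norm_det_sub_sq_le (h : SmallEntries r ε α β₁ β₂) {z : ℂ}
    (hz : z ∈ Metric.ball (0 : ℂ) r) :
    ‖(z - α z) ^ 2 - β₁ z * β₂ z - z ^ 2‖ ≤ (2 * ε + 2 * ε ^ 2) * r ^ 2 := by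
  have hz' : ‖z‖ ≤ r := (mem_ball_zero_iff.1 hz).le
  have hr := h.pos.le
  have hεr : 0 ≤ ε * r := mul_nonneg h.eps_nonneg hr
  calc ‖(z - α z) ^ 2 - β₁ z * β₂ z - z ^ 2‖
      = ‖α z ^ 2 - 2 * z * α z - β₁ z * β₂ z‖ := by ring_nf
    _ ≤ ‖α z ^ 2‖ + ‖2 * z * α z‖ + ‖β₁ z * β₂ z‖ :=
      (norm_sub_le _ _).trans (add_le_add_left (norm_sub_le _ _) _)
    _ = ‖α z‖ ^ 2 + 2 * ‖z‖ * ‖α z‖ + ‖β₁ z‖ * ‖β₂ z‖ := by simp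
    _ ≤ (ε * r) ^ 2 + 2 * r * (ε * r) + ε * r * (ε * r) := by
      gcongr
      exacts [h.alpha.norm_le z hz, h.alpha.norm_le z hz, h.beta_one.norm_le z hz,
        h.beta_two.norm_le z hz]
    _ = (2 * ε + 2 * ε ^ 2) * r ^ 2 := by ring

theorem det_bound_lt (h : SmallEntries r ε α β₁ β₂) (hε : ε ≤ 1 / 100) :
    16 * ((2 * ε + 2 * ε ^ 2) * r ^ 2) < r ^ 2 := by
  have : 16 * (2 * ε + 2 * ε ^ 2) < 1 := by nlinarith [h.eps_nonneg]
  nlinarith [sq_pos_of_pos h.pos]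

theorem exists_root (h : SmallEntries r ε α β₁ β₂) (hε : ε ≤ 1 / 100) :
    ∃ z ∈ Metric.ball (0 : ℂ) r, (z - α z) ^ 2 = β₁ z * β₂ z := by
  obtain ⟨z, hz, hroot⟩ := exists_zero_of_near_sq h.pos h.differentiableOn_det
    (fun _ => h.norm_det_sub_sq_le) (h.det_bound_lt hε)
  exact ⟨z, hz, sub_eq_zero.1 hroot⟩

theorem root_eq_of_three (h : SmallEntries r ε α β₁ β₂) (hε : ε ≤ 1 / 100) {a b c : ℂ}
    (ha : a ∈ Metric.ball (0 : ℂ) r) (hb : b ∈ Metric.ball (0 : ℂ) r)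
    (hc : c ∈ Metric.ball (0 : ℂ) r) (hra : (a - α a) ^ 2 = β₁ a * β₂ a)
    (hrb : (b - α b) ^ 2 = β₁ b * β₂ b) (hrc : (c - α c) ^ 2 = β₁ c * β₂ c)
    (hba : b ≠ a) (hca : c ≠ a) : b = c :=
  eq_of_zeros_of_near_sq h.pos h.differentiableOn_det (fun _ => h.norm_det_sub_sq_le)
    (h.det_bound_lt hε) ha hb hc (sub_eq_zero.2 hra) (sub_eq_zero.2 hrb) (sub_eq_zero.2 hrc)
    hba hca

theorem norm_root_lt (h : SmallEntries r ε α β₁ β₂) (hε : ε ≤ 1 / 100) {z : ℂ}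
    (hz : z ∈ Metric.ball (0 : ℂ) r) (hroot : (z - α z) ^ 2 = β₁ z * β₂ z) : ‖z‖ < r / 4 :=
  norm_lt_of_zero_of_near_sq h.pos (fun _ => h.norm_det_sub_sq_le)
    (h.det_bound_lt hε) hz (sub_eq_zero.2 hroot)

/-- By AM-GM a root satisfies `|z - α| ≤ (|β₁| + |β₂|) / 2`. -/
theorem norm_root_sub_root_le (h : SmallEntries r ε α β₁ β₂) {zp zm z₀ : ℂ}
    (hp : ‖zp‖ < r / 2) (hm : ‖zm‖ < r / 2) (hz₀ : z₀ = (zp + zm) / 2)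
    (hrp : (zp - α zp) ^ 2 = β₁ zp * β₂ zp) (hrm : (zm - α zm) ^ 2 = β₁ zm * β₂ zm) :
    (1 - 4 * ε) * ‖zp - zm‖ ≤ ‖β₁ z₀‖ + ‖β₂ z₀‖ := by
  have hmid : z₀ ∈ Metric.ball (0 : ℂ) (r / 2) :=
    mem_ball_zero_iff.2 (hz₀ ▸ norm_add_div_two_lt hp hm)
  have hroot : ∀ z, ‖z‖ < r / 2 → ‖z - z₀‖ = ‖zp - zm‖ / 2 → (z - α z) ^ 2 = β₁ z * β₂ z →
      ‖z - α z‖ ≤ (‖β₁ z₀‖ + ‖β₂ z₀‖ + 2 * ε * ‖zp - zm‖) / 2 := by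
    intro z hz hdist hroot
    have h1 := h.beta_one.norm_sub_le h.pos hmid (mem_ball_zero_iff.2 hz)
    have h2 := h.beta_two.norm_sub_le h.pos hmid (mem_ball_zero_iff.2 hz)
    rw [hdist] at h1 h2
    linarith [norm_le_add_div_two_of_sq_eq_mul hroot, norm_sub_norm_le (β₁ z) (β₁ z₀),
      norm_sub_norm_le (β₂ z) (β₂ z₀)]
  have hp' := hroot zp hp (by rw [hz₀, show zp - (zp + zm) / 2 = (zp - zm) / 2 by ring]; simp) hrp
  have hm' := hroot zm hm (by rw [hz₀, show zm - (zp + zm) / 2 = -((zp - zm) / 2) by ring]; simp)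
    hrm
  have hα := h.alpha.norm_sub_le h.pos (mem_ball_zero_iff.2 hm) (mem_ball_zero_iff.2 hp)
  have htri : ‖zp - zm‖ ≤ ‖zp - α zp‖ + ‖zm - α zm‖ + ‖α zp - α zm‖ :=
    calc ‖zp - zm‖ = ‖(zp - α zp) - (zm - α zm) + (α zp - α zm)‖ := by ring_nf
      _ ≤ _ := (norm_add_le _ _).trans (add_le_add_left (norm_sub_le _ _) _)
  linarith

end SmallEntries

/-! ### Branches of the square roots and the two roots -/

theorem norm_cpow_inv_two_sub_one_le (w : ℂ) : ‖w ^ (2⁻¹ : ℂ) - 1‖ ≤ ‖w - 1‖ := by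
  have hfactor : w - 1 = (w ^ (2⁻¹ : ℂ) - 1) * (w ^ (2⁻¹ : ℂ) + 1) := by
    linear_combination -Complex.cpow_ofNat_inv_pow w 2
  have hre : 0 ≤ (w ^ (2⁻¹ : ℂ)).re := by
    rw [Complex.cpow_inv_two_re]
    exact Real.sqrt_nonneg _
  have hone : 1 ≤ ‖w ^ (2⁻¹ : ℂ) + 1‖ := by
    refine le_trans ?_ (Complex.re_le_norm _)
    simpa using hre
  rw [hfactor, norm_mul]
  exact le_mul_of_one_le_right (norm_nonneg _) hone

theorem isOpen_inter_norm_sub_lt {β : ℂ → ℂ} {B : Set ℂ} (hB : IsOpen B)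
    (hβ : ContinuousOn β B) (w : ℂ) (ρ : ℝ) : IsOpen (B ∩ {z | ‖β z - w‖ < ρ}) :=
  ((hβ.sub continuousOn_const).norm).isOpen_inter_preimage hB isOpen_Iio

/-- The branch is `√β(z₀) · √(β(z) / β(z₀))` with the principal square roots. -/
theorem exists_sqrt_branch {β : ℂ → ℂ} {B D : Set ℂ} {z₀ : ℂ} {κ : ℝ} (hB : IsOpen B)
    (hβ : DifferentiableOn ℂ β B) (hDB : D ⊆ B) (h0 : β z₀ ≠ 0) (hκ : κ < 1)
    (hD : ∀ z ∈ D, ‖β z - β z₀‖ ≤ κ * ‖β z₀‖) :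
    ∃ (s : ℂ → ℂ) (U : Set ℂ), IsOpen U ∧ D ⊆ U ∧ AnalyticOnNhd ℂ s U ∧ (∀ z, s z ^ 2 = β z) ∧
      ∀ z ∈ D, ‖s z - s z₀‖ ≤ κ * ‖s z₀‖ := by
  have hpos : 0 < ‖β z₀‖ := norm_pos_iff.2 h0
  have hquot (z : ℂ) : ‖β z / β z₀ - 1‖ = ‖β z - β z₀‖ / ‖β z₀‖ := by
    rw [div_sub_one h0, norm_div]
  refine ⟨fun z => β z₀ ^ (2⁻¹ : ℂ) * (β z / β z₀) ^ (2⁻¹ : ℂ),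
    B ∩ {z | ‖β z - β z₀‖ < ‖β z₀‖}, isOpen_inter_norm_sub_lt hB hβ.continuousOn _ _,
    fun z hz => ⟨hDB hz, (hD z hz).trans_lt (mul_lt_of_lt_one_left hpos hκ)⟩, ?_, ?_, ?_⟩
  · intro z hz
    have hslit : β z / β z₀ ∈ Complex.slitPlane := by
      simpa using Complex.mem_slitPlane_of_norm_lt_one (z := β z / β z₀ - 1)
        (by rw [hquot, div_lt_one hpos]; exact hz.2)
    exact analyticAt_const.mul
      (((hβ.analyticOnNhd hB z hz.1).div analyticAt_const h0).cpow analyticAt_const hslit)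
  · intro z
    rw [mul_pow, Complex.cpow_ofNat_inv_pow, Complex.cpow_ofNat_inv_pow, mul_div_cancel₀ _ h0]
  · intro z hz
    have hle : ‖(β z / β z₀) ^ (2⁻¹ : ℂ) - 1‖ ≤ κ :=
      (norm_cpow_inv_two_sub_one_le _).trans
        (by rw [hquot, div_le_iff₀ hpos]; exact hD z hz)
    beta_reduce
    rw [div_self h0, Complex.one_cpow, mul_one, ← mul_sub_one, norm_mul, mul_comm]
    gcongr

theorem norm_mul_sub_mul_le {a b a₀ b₀ : ℂ} {κ : ℝ} (hκ : κ ≤ 1)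
    (ha : ‖a - a₀‖ ≤ κ * ‖a₀‖) (hb : ‖b - b₀‖ ≤ κ * ‖b₀‖) :
    ‖a * b - a₀ * b₀‖ ≤ 3 * κ * ‖a₀ * b₀‖ :=
  calc ‖a * b - a₀ * b₀‖
      = ‖(a - a₀) * (b - b₀) + a₀ * (b - b₀) + (a - a₀) * b₀‖ := by ring_nf
    _ ≤ ‖a - a₀‖ * ‖b - b₀‖ + ‖a₀‖ * ‖b - b₀‖ + ‖a - a₀‖ * ‖b₀‖ := by
      simpa only [norm_mul] using
        norm_add₃_le (a := (a - a₀) * (b - b₀)) (b := a₀ * (b - b₀)) (c := (a - a₀) * b₀)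
    _ ≤ (1 * ‖a₀‖) * (κ * ‖b₀‖) + ‖a₀‖ * (κ * ‖b₀‖) + (κ * ‖a₀‖) * ‖b₀‖ := by
      gcongr
      exact ha.trans (by gcongr)
    _ = 3 * κ * ‖a₀ * b₀‖ := by rw [norm_mul]; ring

theorem exists_fixedPoint_mem_closedBall {X : Type*} [MetricSpace X] [CompleteSpace X] {F : X → X}
    {x₀ : X} {R : ℝ} {c : NNReal} (hc : c < 1) (hR : 0 ≤ R)
    (hF : LipschitzOnWith c F (Metric.closedBall x₀ R)) (hx₀ : dist (F x₀) x₀ ≤ (1 - c) * R) :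
    ∃ x ∈ Metric.closedBall x₀ R, F x = x := by
  have hmem : x₀ ∈ Metric.closedBall x₀ R := Metric.mem_closedBall_self hR
  have hmaps : Set.MapsTo F (Metric.closedBall x₀ R) (Metric.closedBall x₀ R) := by
    intro x hx
    have hlip : dist (F x) (F x₀) ≤ c * R :=
      (hF.dist_le_mul x hx x₀ hmem).trans (by gcongr; exact hx)
    rw [Metric.mem_closedBall]
    linarith [dist_triangle (F x) (F x₀) x₀]
  obtain ⟨x, hx, hfix, -⟩ := ContractingWith.exists_fixedPoint'
    Metric.isClosed_closedBall.isComplete hmaps ⟨hc, hF.mapsToRestrict hmaps⟩ hmem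
    (edist_ne_top _ _)
  exact ⟨x, hx, hfix⟩

/-- The map `α + s` is a contraction of the disc `|z - z₀| ≤ 5 ρ / 8`. -/
theorem exists_root_sub_eq {α s : ℂ → ℂ} {z₀ : ℂ} {ρ : ℝ} (hρ : 0 < ρ)
    (hα : ∀ x ∈ Metric.closedBall z₀ ρ, ∀ y ∈ Metric.closedBall z₀ ρ,
      ‖α y - α x‖ ≤ 1 / 50 * ‖y - x‖)
    (hs : DifferentiableOn ℂ s (Metric.closedBall z₀ ρ))
    (hs₀ : ∀ z ∈ Metric.closedBall z₀ ρ, ‖s z - s z₀‖ ≤ 3 / 100 * ‖s z₀‖)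
    (hsρ : ‖s z₀‖ ≤ ρ / 4) (hz₀ : ‖z₀ - α z₀‖ ≤ 27 / 100 * ρ) :
    ∃ w ∈ Metric.closedBall z₀ ρ, w - α w = s w := by
  have hsub : Metric.closedBall z₀ (5 * ρ / 8) ⊆ Metric.closedBall z₀ ρ :=
    Metric.closedBall_subset_closedBall (by linarith)
  have hball : Metric.closedBall z₀ (5 * ρ / 8) ⊆ Metric.ball z₀ (3 * ρ / 4) :=
    Metric.closedBall_subset_ball (by linarith)
  have hsLip : ∀ x ∈ Metric.closedBall z₀ (5 * ρ / 8), ∀ y ∈ Metric.closedBall z₀ (5 * ρ / 8),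
      ‖s y - s x‖ ≤ 3 / 100 * ‖y - x‖ := by
    intro x hx y hy
    have hCauchy := norm_sub_le_of_norm_le_on_ball (by linarith : 3 * ρ / 4 < ρ)
      ((hs.mono Metric.ball_subset_closedBall).sub_const (s z₀))
      (fun z hz => hs₀ z (Metric.ball_subset_closedBall hz)) (hball hx) (hball hy)
    rw [sub_sub_sub_cancel_right] at hCauchy
    refine hCauchy.trans (mul_le_mul_of_nonneg_right ?_ (norm_nonneg _))
    rw [div_le_iff₀ (by linarith)]
    linarith
  have hLip : LipschitzOnWith (1 / 20 : NNReal) (fun z => α z + s z)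
      (Metric.closedBall z₀ (5 * ρ / 8)) := by
    refine LipschitzOnWith.of_dist_le_mul fun x hx y hy => ?_
    rw [dist_eq_norm, dist_eq_norm, show ((1 / 20 : NNReal) : ℝ) = 1 / 20 by norm_num,
      add_sub_add_comm]
    linarith [norm_add_le (α x - α y) (s x - s y), hα y (hsub hy) x (hsub hx), hsLip y hy x hx]
  obtain ⟨w, hw, hfix⟩ := exists_fixedPoint_mem_closedBall
    (by rw [div_lt_one (by norm_num)]; norm_num) (by positivity) hLip (by
      rw [dist_eq_norm, show α z₀ + s z₀ - z₀ = s z₀ - (z₀ - α z₀) by ring]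
      norm_num
      linarith [norm_sub_le (s z₀) (z₀ - α z₀)])
  exact ⟨w, hsub hw, by linear_combination -hfix⟩

/-- Since `s` has no zero on `D`, the equations `z - α = s` and `z - α = -s` have no common root, so
each of them has exactly one of the roots `zp`, `zm`. -/
theorem exists_sign_of_roots {α s : ℂ → ℂ} {D : Set ℂ} {zp zm : ℂ} (hs : ∀ z ∈ D, s z ≠ 0)
    (hroots : ∀ z ∈ D, (z - α z) ^ 2 = s z ^ 2 → z = zm ∨ z = zp)
    (hpos : ∃ w ∈ D, w - α w = s w) (hneg : ∃ w ∈ D, w - α w = -s w) :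
    ∃ σ : ℂ, σ ^ 2 = 1 ∧ (∀ z, (z ∈ D ∧ z - α z = σ * s z) ↔ z = zp) ∧
      ∀ z, (z ∈ D ∧ z - α z = -(σ * s z)) ↔ z = zm := by
  obtain ⟨w₁, hw₁, h₁⟩ := hpos
  obtain ⟨w₂, hw₂, h₂⟩ := hneg
  have hdisj : ∀ z ∈ D, z - α z = s z → z - α z ≠ -s z :=
    fun z hz h h' => hs z hz (self_eq_neg.1 (h.symm.trans h'))
  have hne : w₁ ≠ w₂ := fun h => hdisj w₁ hw₁ h₁ (h ▸ h₂)
  have hr₁ := hroots w₁ hw₁ (by rw [h₁])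
  have hr₂ := hroots w₂ hw₂ (by rw [h₂, neg_sq])
  have hpair : ∀ z ∈ D, (z - α z) ^ 2 = s z ^ 2 → z = w₁ ∨ z = w₂ := by grind
  have key₁ : ∀ z, (z ∈ D ∧ z - α z = s z) ↔ z = w₁ := by grind
  have key₂ : ∀ z, (z ∈ D ∧ z - α z = -s z) ↔ z = w₂ := by grind
  rcases hr₁ with rfl | rfl
  · obtain rfl := hr₂.resolve_left hne.symm
    exact ⟨-1, by norm_num, by simpa using key₂, by simpa using key₁⟩
  · obtain rfl := hr₂.resolve_right hne.symm
    exact ⟨1, by norm_num, by simpa using key₁, by simpa using key₂⟩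

/-- The two roots `zp`, `zm` of `(z - α)² = β₁ β₂` in `D` are separated by analytic square roots
`s₁`, `s₂` of `β₁`, `β₂`: the first one solves `z - α = s₁ s₂`, the second one `z - α = -s₁ s₂`. -/
structure IsSeparatedBy (α β₁ β₂ : ℂ → ℂ) (D : Set ℂ) (zp zm : ℂ) (s₁ s₂ : ℂ → ℂ) : Prop where
  exists_analytic : ∃ U : Set ℂ, IsOpen U ∧ D ⊆ U ∧ AnalyticOnNhd ℂ s₁ U ∧ AnalyticOnNhd ℂ s₂ U ∧
    (∀ z ∈ U, s₁ z ^ 2 = β₁ z) ∧ ∀ z ∈ U, s₂ z ^ 2 = β₂ z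
  root_plus : ∀ z, (z ∈ D ∧ z - α z = s₁ z * s₂ z) ↔ z = zp
  root_minus : ∀ z, (z ∈ D ∧ z - α z = -(s₁ z * s₂ z)) ↔ z = zm

namespace SmallEntries

variable {r ε : ℝ} {α β₁ β₂ : ℂ → ℂ} {zp zm z₀ : ℂ}

theorem norm_midpoint_sub_alpha_le (h : SmallEntries r ε α β₁ β₂) (hp : ‖zp‖ < r / 2)
    (hm : ‖zm‖ < r / 2) (hz₀ : z₀ = (zp + zm) / 2) :
    ‖z₀ - α z₀‖ ≤ (‖zp - α zp‖ + ‖zm - α zm‖) / 2 + ε * ‖zp - zm‖ := by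
  have hmid : z₀ ∈ Metric.ball (0 : ℂ) (r / 2) :=
    mem_ball_zero_iff.2 (hz₀ ▸ norm_add_div_two_lt hp hm)
  have hαp := h.alpha.norm_sub_le h.pos hmid (mem_ball_zero_iff.2 hp)
  have hαm := h.alpha.norm_sub_le h.pos hmid (mem_ball_zero_iff.2 hm)
  rw [hz₀, show zp - (zp + zm) / 2 = (zp - zm) / 2 by ring, ← hz₀, norm_div,
    Complex.norm_ofNat] at hαp
  rw [hz₀, show zm - (zp + zm) / 2 = -((zp - zm) / 2) by ring, ← hz₀, norm_neg, norm_div,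
    Complex.norm_ofNat] at hαm
  have hsplit : 2 * (z₀ - α z₀) =
      ((zp - α zp) + (zm - α zm)) + ((α zp - α z₀) + (α zm - α z₀)) := by
    rw [hz₀]
    ring
  have htwo : ‖2 * (z₀ - α z₀)‖ = 2 * ‖z₀ - α z₀‖ := by simp
  rw [hsplit] at htwo
  linarith [norm_add_le ((zp - α zp) + (zm - α zm)) ((α zp - α z₀) + (α zm - α z₀)),
    norm_add_le (zp - α zp) (zm - α zm), norm_add_le (α zp - α z₀) (α zm - α z₀)]

/-- Subtracting the equations of the two roots leaves `2 s(z₀)` up to the oscillations of `α` and of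
`s`. -/
theorem norm_gap_div_sub_one_le (h : SmallEntries r ε α β₁ β₂) (hε : ε ≤ 1 / 100) {s : ℂ → ℂ}
    {κ : ℝ} (hκ : κ ≤ 1 / 100) (hp : ‖zp‖ < r / 2) (hm : ‖zm‖ < r / 2) (hs₀ : s z₀ ≠ 0)
    (hrp : zp - α zp = s zp) (hrm : zm - α zm = -s zm)
    (hsp : ‖s zp - s z₀‖ ≤ 3 * κ * ‖s z₀‖) (hsm : ‖s zm - s z₀‖ ≤ 3 * κ * ‖s z₀‖) :
    ‖(zp - zm) / (2 * s z₀) - 1‖ ≤ 3 * (ε + κ) := by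
  have hε0 := h.eps_nonneg
  have hs₀pos : 0 < ‖s z₀‖ := norm_pos_iff.2 hs₀
  have hnorm : ‖2 * s z₀‖ = 2 * ‖s z₀‖ := by simp
  have hdiff : ‖zp - zm - 2 * s z₀‖ ≤ 2 * ε * ‖zp - zm‖ + 6 * κ * ‖s z₀‖ :=
    calc ‖zp - zm - 2 * s z₀‖
        = ‖(α zp - α zm) + (s zp - s z₀) + (s zm - s z₀)‖ := by
          congr 1; linear_combination hrp - hrm
      _ ≤ ‖α zp - α zm‖ + ‖s zp - s z₀‖ + ‖s zm - s z₀‖ := norm_add₃_le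
      _ ≤ _ := by
          linarith [h.alpha.norm_sub_le h.pos (mem_ball_zero_iff.2 hm) (mem_ball_zero_iff.2 hp)]
  have hgap : ‖zp - zm‖ ≤ 3 * ‖s z₀‖ := by
    have htri := norm_sub_norm_le (zp - zm) (2 * s z₀)
    nlinarith [norm_nonneg (zp - zm)]
  rw [div_sub_one (mul_ne_zero two_ne_zero hs₀), norm_div, hnorm, div_le_iff₀ (by positivity)]
  nlinarith [mul_le_mul_of_nonneg_left hgap hε0]

theorem closedBall_subset (h : SmallEntries r ε α β₁ β₂) (hε : ε ≤ 1 / 100) (hz₀ : ‖z₀‖ < r / 4) :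
    Metric.closedBall z₀ (2 * (‖β₁ z₀‖ + ‖β₂ z₀‖)) ⊆ Metric.ball (0 : ℂ) (r / 2) := by
  intro z hz
  have hr := h.pos
  have hz₀r : z₀ ∈ Metric.ball (0 : ℂ) r := mem_ball_zero_iff.2 (by linarith)
  have hεr : ε * r ≤ r / 100 := by nlinarith
  rw [mem_closedBall_iff_norm] at hz
  rw [mem_ball_zero_iff]
  linarith [norm_sub_norm_le z z₀, h.beta_one.norm_le z₀ hz₀r, h.beta_two.norm_le z₀ hz₀r]

theorem norm_sub_midpoint {zp zm z₀ : ℂ} (hz₀ : z₀ = (zp + zm) / 2) :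
    ‖zp - z₀‖ = ‖zp - zm‖ / 2 ∧ ‖zm - z₀‖ = ‖zp - zm‖ / 2 := by
  rw [hz₀, show zp - (zp + zm) / 2 = (zp - zm) / 2 by ring,
    show zm - (zp + zm) / 2 = -((zp - zm) / 2) by ring, norm_neg, norm_div, Complex.norm_ofNat]
  exact ⟨rfl, rfl⟩

/-- The roots lie in the disc of radius `ρ = 2 (|β₁(z₀)| + |β₂(z₀)|)` about their midpoint, where
`|z - α| = |s|` is at most about `ρ / 4`. -/
theorem norm_midpoint_sub_alpha_le_radius (h : SmallEntries r ε α β₁ β₂) (hε : ε ≤ 1 / 100)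
    (hz₀ : z₀ = (zp + zm) / 2) (hp : ‖zp‖ < r / 2) (hm : ‖zm‖ < r / 2)
    (hrp : (zp - α zp) ^ 2 = β₁ zp * β₂ zp) (hrm : (zm - α zm) ^ 2 = β₁ zm * β₂ zm) {s : ℂ → ℂ}
    (hsq : ∀ z, s z ^ 2 = β₁ z * β₂ z)
    (hs : ∀ z ∈ Metric.closedBall z₀ (2 * (‖β₁ z₀‖ + ‖β₂ z₀‖)),
      ‖s z - s z₀‖ ≤ 3 / 100 * ‖s z₀‖) :
    ‖z₀ - α z₀‖ ≤ 27 / 100 * (2 * (‖β₁ z₀‖ + ‖β₂ z₀‖)) := by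
  set ρ := 2 * (‖β₁ z₀‖ + ‖β₂ z₀‖)
  have hs₀ρ : ‖s z₀‖ ≤ ρ / 4 := by linarith [norm_le_add_div_two_of_sq_eq_mul (hsq z₀)]
  have hgap : ‖zp - zm‖ ≤ 53 / 100 * ρ := by
    nlinarith [h.norm_root_sub_root_le hp hm hz₀ hrp hrm, norm_nonneg (zp - zm)]
  have hroot_le : ∀ z, ‖z - z₀‖ = ‖zp - zm‖ / 2 → (z - α z) ^ 2 = β₁ z * β₂ z →
      ‖z - α z‖ ≤ 103 / 100 * ‖s z₀‖ := by
    intro z hz hroot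
    have hzD : z ∈ Metric.closedBall z₀ ρ := by
      rw [mem_closedBall_iff_norm, hz]
      linarith [norm_nonneg (zp - zm)]
    have hnorm : ‖z - α z‖ = ‖s z‖ := by
      rw [← sq_eq_sq₀ (norm_nonneg _) (norm_nonneg _), ← norm_pow, ← norm_pow, hroot, hsq]
    linarith [norm_sub_norm_le (s z) (s z₀), hs z hzD]
  nlinarith [h.norm_midpoint_sub_alpha_le hp hm hz₀, norm_nonneg (zp - zm),
    hroot_le zp (norm_sub_midpoint hz₀).1 hrp, hroot_le zm (norm_sub_midpoint hz₀).2 hrm]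

theorem exists_sign (h : SmallEntries r ε α β₁ β₂) (hε : ε ≤ 1 / 100) (hz₀ : z₀ = (zp + zm) / 2)
    (hp : ‖zp‖ < r / 2) (hm : ‖zm‖ < r / 2)
    (hroots : ∀ z ∈ Metric.ball (0 : ℂ) r, (z - α z) ^ 2 = β₁ z * β₂ z ↔ z = zm ∨ z = zp)
    (hne : β₁ z₀ ≠ 0) {D : Set ℂ} (hD : D = Metric.closedBall z₀ (2 * (‖β₁ z₀‖ + ‖β₂ z₀‖)))
    (hDr : D ⊆ Metric.ball 0 (r / 2)) {s : ℂ → ℂ} (hsD : DifferentiableOn ℂ s D)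
    (hsq : ∀ z, s z ^ 2 = β₁ z * β₂ z) (hs₀ : s z₀ ≠ 0)
    (hs : ∀ z ∈ D, ‖s z - s z₀‖ ≤ 3 / 100 * ‖s z₀‖) :
    ∃ σ : ℂ, σ ^ 2 = 1 ∧ (∀ z, (z ∈ D ∧ z - α z = σ * s z) ↔ z = zp) ∧
      ∀ z, (z ∈ D ∧ z - α z = -(σ * s z)) ↔ z = zm := by
  have hr := h.pos
  have hball : Metric.ball (0 : ℂ) (r / 2) ⊆ Metric.ball 0 r :=
    Metric.ball_subset_ball (by linarith)
  have hrp := (hroots zp (hball (mem_ball_zero_iff.2 hp))).2 (Or.inr rfl)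
  have hrm := (hroots zm (hball (mem_ball_zero_iff.2 hm))).2 (Or.inl rfl)
  have hmid := h.norm_midpoint_sub_alpha_le_radius hε hz₀ hp hm hrp hrm hsq (hD ▸ hs)
  have hs₀_le := norm_le_add_div_two_of_sq_eq_mul (hsq z₀)
  have hs_ne : ∀ z ∈ D, s z ≠ 0 := by
    intro z hz h0
    have := hs z hz
    rw [h0, zero_sub, norm_neg] at this
    linarith [norm_pos_iff.2 hs₀]
  have hα : ∀ x ∈ D, ∀ y ∈ D, ‖α y - α x‖ ≤ 1 / 50 * ‖y - x‖ := fun x hx y hy =>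
    (h.alpha.norm_sub_le hr (hDr hx) (hDr hy)).trans (by gcongr; linarith)
  have hroots_D : ∀ z ∈ D, (z - α z) ^ 2 = s z ^ 2 → z = zm ∨ z = zp := fun z hz hzs =>
    (hroots z (hball (hDr hz))).1 (hzs.trans (hsq z))
  subst hD
  refine exists_sign_of_roots hs_ne hroots_D
    (exists_root_sub_eq (by positivity) hα hsD hs (by linarith) hmid)
    (exists_root_sub_eq (s := -s) (by positivity) hα hsD.neg (fun z hz => ?_) ?_ hmid)
  · rw [Pi.neg_apply, Pi.neg_apply, neg_sub_neg, norm_neg, norm_sub_rev]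
    exact hs z hz
  · rw [Pi.neg_apply, norm_neg]
    linarith

theorem exists_isSeparatedBy (h : SmallEntries r ε α β₁ β₂) (hε : ε ≤ 1 / 100) {κ : ℝ}
    (hκ : κ ≤ 1 / 100) (hz₀ : z₀ = (zp + zm) / 2) (hp : zp ∈ Metric.ball (0 : ℂ) r)
    (hm : zm ∈ Metric.ball (0 : ℂ) r)
    (hroots : ∀ z ∈ Metric.ball (0 : ℂ) r, (z - α z) ^ 2 = β₁ z * β₂ z ↔ z = zm ∨ z = zp)
    (hne₁ : β₁ z₀ ≠ 0) (hne₂ : β₂ z₀ ≠ 0) {D : Set ℂ}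
    (hD : D = Metric.closedBall z₀ (2 * (‖β₁ z₀‖ + ‖β₂ z₀‖)))
    (hc₁ : ∀ z ∈ D, ‖β₁ z - β₁ z₀‖ ≤ κ * ‖β₁ z₀‖) (hc₂ : ∀ z ∈ D, ‖β₂ z - β₂ z₀‖ ≤ κ * ‖β₂ z₀‖) :
    ∃ s₁ s₂ : ℂ → ℂ, IsSeparatedBy α β₁ β₂ D zp zm s₁ s₂ ∧
      ∀ z ∈ D, ‖s₁ z * s₂ z - s₁ z₀ * s₂ z₀‖ ≤ 3 * κ * ‖s₁ z₀ * s₂ z₀‖ := by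
  have hr := h.pos
  have hp4 := h.norm_root_lt hε hp ((hroots zp hp).2 (Or.inr rfl))
  have hm4 := h.norm_root_lt hε hm ((hroots zm hm).2 (Or.inl rfl))
  have hDr : D ⊆ Metric.ball 0 (r / 2) :=
    hD ▸ h.closedBall_subset hε (hz₀ ▸ norm_add_div_two_lt hp4 hm4)
  have hDr' : D ⊆ Metric.ball 0 r := hDr.trans (Metric.ball_subset_ball (by linarith))
  obtain ⟨s₁, U₁, hU₁, hDU₁, hs₁, hsq₁, hvar₁⟩ := exists_sqrt_branch Metric.isOpen_ball
    h.beta_one.differentiableOn hDr' hne₁ (by linarith) hc₁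
  obtain ⟨s₂, U₂, hU₂, hDU₂, hs₂, hsq₂, hvar₂⟩ := exists_sqrt_branch Metric.isOpen_ball
    h.beta_two.differentiableOn hDr' hne₂ (by linarith) hc₂
  have hsq : ∀ z, (s₁ z * s₂ z) ^ 2 = β₁ z * β₂ z := fun z => by rw [mul_pow, hsq₁, hsq₂]
  have hvar : ∀ z ∈ D, ‖s₁ z * s₂ z - s₁ z₀ * s₂ z₀‖ ≤ 3 * κ * ‖s₁ z₀ * s₂ z₀‖ := fun z hz =>
    norm_mul_sub_mul_le (by linarith) (hvar₁ z hz) (hvar₂ z hz)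
  have hs₀ : s₁ z₀ * s₂ z₀ ≠ 0 := fun h0 => mul_ne_zero hne₁ hne₂ (by rw [← hsq, h0]; norm_num)
  obtain ⟨σ, hσ, hplus, hminus⟩ := h.exists_sign (s := fun z => s₁ z * s₂ z) hε hz₀
    (by linarith) (by linarith) hroots hne₁ hD hDr
    ((hs₁.mono hDU₁).differentiableOn.mul (hs₂.mono hDU₂).differentiableOn) hsq
    hs₀ (fun z hz => (hvar z hz).trans (by gcongr; linarith))
  have hσ_norm : ‖σ‖ = 1 := by
    rw [← sq_eq_sq₀ (norm_nonneg _) zero_le_one, ← norm_pow, hσ, norm_one, one_pow]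
  refine ⟨fun z => σ * s₁ z, s₂, ⟨⟨U₁ ∩ U₂, hU₁.inter hU₂, Set.subset_inter hDU₁ hDU₂,
    (analyticOnNhd_const.mul hs₁).mono Set.inter_subset_left, hs₂.mono Set.inter_subset_right,
    fun z _ => by rw [mul_pow, hσ, one_mul, hsq₁], fun z _ => hsq₂ z⟩,
    fun z => by simpa only [mul_assoc] using hplus z,
    fun z => by simpa only [mul_assoc] using hminus z⟩, fun z hz => ?_⟩
  rw [mul_assoc, mul_assoc, ← mul_sub, norm_mul, norm_mul, hσ_norm, one_mul, one_mul]
  exact hvar z hz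

end SmallEntries

/-! ### Infinite matrices in weighted Hilbert–Schmidt norms -/

section Weighted

variable {ι : Type*} {D : ι → ℝ} {d f g : ι → ℂ}

/-- `f` belongs to the `ℓ²` space with weight `D`. -/
def WSummable (D : ι → ℝ) (f : ι → ℂ) : Prop := Summable fun i => D i * ‖f i‖ ^ 2

/-- The squared norm of `f` in the `ℓ²` space with weight `D`. -/
noncomputable def energy (D : ι → ℝ) (f : ι → ℂ) : ℝ := ∑' i, D i * ‖f i‖ ^ 2

theorem energy_nonneg (hD : ∀ j, 0 ≤ D j) (f : ι → ℂ) : 0 ≤ energy D f :=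
  tsum_nonneg fun i => mul_nonneg (hD i) (sq_nonneg _)

theorem norm_sqrt_energy (D : ι → ℝ) (f : ι → ℂ) : ‖(√(energy D f) : ℂ)‖ = √(energy D f) := by
  rw [Complex.norm_real, Real.norm_of_nonneg (Real.sqrt_nonneg _)]

theorem summable_mul_and_tsum_mul_le_sqrt {x y : ι → ℝ} (hx0 : ∀ i, 0 ≤ x i) (hy0 : ∀ i, 0 ≤ y i)
    (hx : Summable fun i => x i ^ 2) (hy : Summable fun i => y i ^ 2) :
    (Summable fun i => x i * y i) ∧
      ∑' i, x i * y i ≤ √(∑' i, x i ^ 2) * √(∑' i, y i ^ 2) := by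
  have hx' : Summable fun i => x i ^ (2 : ℝ) := by simpa using hx
  have hy' : Summable fun i => y i ^ (2 : ℝ) := by simpa using hy
  have hHolder :=
    Real.inner_le_Lp_mul_Lq_tsum_of_nonneg Real.HolderConjugate.two_two hx0 hy0 hx' hy'
  exact ⟨Real.summable_mul_of_Lp_Lq_of_nonneg Real.HolderConjugate.two_two hx0 hy0 hx' hy',
    by simpa [Real.sqrt_eq_rpow] using hHolder⟩

namespace WSummable

theorem summable_mul_and_tsum_mul_le (hD : ∀ j, 0 ≤ D j) (hf : WSummable D f)
    (hg : WSummable D g) :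
    (Summable fun i => D i * (‖f i‖ * ‖g i‖)) ∧
      ∑' i, D i * (‖f i‖ * ‖g i‖) ≤ √(energy D f) * √(energy D g) := by
  have hsq (f : ι → ℂ) (i : ι) : (√(D i) * ‖f i‖) ^ 2 = D i * ‖f i‖ ^ 2 := by
    rw [mul_pow, Real.sq_sqrt (hD i)]
  have hmul (i : ι) : (√(D i) * ‖f i‖) * (√(D i) * ‖g i‖) = D i * (‖f i‖ * ‖g i‖) := by
    rw [mul_mul_mul_comm, Real.mul_self_sqrt (hD i)]
  have key := summable_mul_and_tsum_mul_le_sqrt (x := fun i => √(D i) * ‖f i‖)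
    (y := fun i => √(D i) * ‖g i‖) (fun i => by positivity) (fun i => by positivity)
    (hf.congr fun i => (hsq f i).symm) (hg.congr fun i => (hsq g i).symm)
  simpa only [hmul, hsq] using! key

theorem summable_mul (hD : ∀ j, 0 ≤ D j) (hf : WSummable D f) (hg : WSummable D g) :
    Summable fun i => D i * (‖f i‖ * ‖g i‖) :=
  (hf.summable_mul_and_tsum_mul_le hD hg).1

theorem norm_mul_mul_le (hd : ∀ j, ‖d j‖ ≤ D j) (f g : ι → ℂ) (i : ι) :
    ‖f i * d i * g i‖ ≤ D i * (‖f i‖ * ‖g i‖) := by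
  rw [norm_mul, norm_mul, mul_comm ‖f i‖, mul_assoc]
  exact mul_le_mul_of_nonneg_right (hd i) (by positivity)

theorem summable_norm (hd : ∀ j, ‖d j‖ ≤ D j) (hf : WSummable D f) (hg : WSummable D g) :
    Summable fun i => ‖f i * d i * g i‖ :=
  Summable.of_nonneg_of_le (fun _ => norm_nonneg _) (norm_mul_mul_le hd f g)
    (hf.summable_mul (fun j => (norm_nonneg _).trans (hd j)) hg)

theorem summable_mul_mul (hd : ∀ j, ‖d j‖ ≤ D j) (hf : WSummable D f) (hg : WSummable D g) :
    Summable fun i => f i * d i * g i :=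
  (hf.summable_norm hd hg).of_norm

theorem tsum_norm_le (hd : ∀ j, ‖d j‖ ≤ D j) (hf : WSummable D f) (hg : WSummable D g) :
    ∑' i, ‖f i * d i * g i‖ ≤ √(energy D f) * √(energy D g) :=
  have hD := fun j => (norm_nonneg _).trans (hd j)
  ((hf.summable_norm hd hg).tsum_le_tsum (norm_mul_mul_le hd f g) (hf.summable_mul hD hg)).trans
    (hf.summable_mul_and_tsum_mul_le hD hg).2

theorem norm_tsum_le (hd : ∀ j, ‖d j‖ ≤ D j) (hf : WSummable D f) (hg : WSummable D g) :
    ‖∑' i, f i * d i * g i‖ ≤ √(energy D f) * √(energy D g) :=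
  (norm_tsum_le_tsum_norm (hf.summable_norm hd hg)).trans (hf.tsum_norm_le hd hg)

theorem of_norm_le (hD : ∀ j, 0 ≤ D j) (hg : WSummable D g)
    (h : ∀ j, D j ≠ 0 → ‖f j‖ ≤ ‖g j‖) : WSummable D f := by
  refine Summable.of_nonneg_of_le (fun i => mul_nonneg (hD i) (sq_nonneg _)) (fun i => ?_) hg
  rcases eq_or_ne (D i) 0 with h0 | h0
  · simp [h0]
  · exact mul_le_mul_of_nonneg_left (by gcongr; exact h i h0) (hD i)

theorem add (hD : ∀ j, 0 ≤ D j) (hf : WSummable D f) (hg : WSummable D g) :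
    WSummable D (fun i => f i + g i) := by
  refine Summable.of_nonneg_of_le (fun i => mul_nonneg (hD i) (sq_nonneg _)) (fun i => ?_)
    ((Summable.add hf hg).mul_left 2)
  have hsq : ‖f i + g i‖ ^ 2 ≤ 2 * (‖f i‖ ^ 2 + ‖g i‖ ^ 2) :=
    (pow_le_pow_left₀ (norm_nonneg _) (norm_add_le _ _) 2).trans (add_sq_le (a := ‖f i‖))
  linarith [mul_le_mul_of_nonneg_left hsq (hD i)]

theorem const_mul (hf : WSummable D f) (c : ℂ) : WSummable D (fun i => c * f i) := by
  refine (Summable.mul_left (‖c‖ ^ 2) hf).congr fun i => ?_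
  rw [norm_mul]
  ring

theorem sub (hD : ∀ j, 0 ≤ D j) (hf : WSummable D f) (hg : WSummable D g) :
    WSummable D (fun i => f i - g i) := by
  simpa only [neg_one_mul, ← sub_eq_add_neg] using hf.add hD (hg.const_mul (-1))

end WSummable

end Weighted

section Matrix

variable {ι : Type} {V : ι → ι → ℂ} {D : ι → ℝ} {θ : ℝ} {d : ι → ℂ} {a b : ι}

/-- The matrix `√D V √D` has Hilbert–Schmidt norm at most `θ < 1`, so that the Neumann series of
`(1 - V d)⁻¹` converges as soon as `|d| ≤ D`. Rows at indices of weight zero are unrestricted. -/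
structure IsHSContraction (V : ι → ι → ℂ) (D : ι → ℝ) (θ : ℝ) : Prop where
  weight_nonneg : ∀ j, 0 ≤ D j
  theta_nonneg : 0 ≤ θ
  theta_lt_one : θ < 1
  row : ∀ j, D j ≠ 0 → WSummable D (V j)
  summable : Summable fun j => D j * energy D (V j)
  tsum_le : ∑' j, D j * energy D (V j) ≤ θ ^ 2

namespace IsHSContraction

theorem of_prod (hD : ∀ j, 0 ≤ D j) (hθ : 0 ≤ θ) (hθ1 : θ < 1)
    (hs : Summable fun p : ι × ι => D p.1 * (D p.2 * ‖V p.1 p.2‖ ^ 2))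
    (hle : ∑' p : ι × ι, D p.1 * (D p.2 * ‖V p.1 p.2‖ ^ 2) ≤ θ ^ 2) : IsHSContraction V D θ where
  weight_nonneg := hD
  theta_nonneg := hθ
  theta_lt_one := hθ1
  row j hj := (summable_mul_left_iff hj).1 (hs.prod_factor j)
  summable := hs.prod.congr fun j => by rw [energy, ← tsum_mul_left]
  tsum_le := by
    rw [hs.tsum_prod] at hle
    simpa only [energy, ← tsum_mul_left] using hle

theorem wsummable_sqrt_energy (h : IsHSContraction V D θ) :
    WSummable D (fun j => (√(energy D (V j)) : ℂ)) := by
  refine h.summable.congr fun j => ?_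
  rw [norm_sqrt_energy, Real.sq_sqrt (energy_nonneg h.weight_nonneg _)]

theorem norm_apply_sq_le (h : IsHSContraction V D θ) (hd : ∀ j, ‖d j‖ ≤ D j) {f : ι → ℂ}
    (hf : WSummable D f) (a : ι) :
    D a * ‖∑' j, V a j * d j * f j‖ ^ 2 ≤ D a * energy D (V a) * energy D f := by
  rcases eq_or_ne (D a) 0 with h0 | h0
  · simp [h0]
  · rw [mul_assoc]
    refine mul_le_mul_of_nonneg_left ?_ (h.weight_nonneg a)
    calc ‖∑' j, V a j * d j * f j‖ ^ 2 ≤ (√(energy D (V a)) * √(energy D f)) ^ 2 := by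
          gcongr
          exact (h.row a h0).norm_tsum_le hd hf
      _ = energy D (V a) * energy D f := by
          rw [mul_pow, Real.sq_sqrt (energy_nonneg h.weight_nonneg _),
            Real.sq_sqrt (energy_nonneg h.weight_nonneg _)]

theorem wsummable_apply (h : IsHSContraction V D θ) (hd : ∀ j, ‖d j‖ ≤ D j) {f : ι → ℂ}
    (hf : WSummable D f) : WSummable D (fun a => ∑' j, V a j * d j * f j) :=
  Summable.of_nonneg_of_le (fun i => mul_nonneg (h.weight_nonneg i) (sq_nonneg _))
    (h.norm_apply_sq_le hd hf) (h.summable.mul_right _)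

theorem energy_apply_le (h : IsHSContraction V D θ) (hd : ∀ j, ‖d j‖ ≤ D j) {f : ι → ℂ}
    (hf : WSummable D f) :
    energy D (fun a => ∑' j, V a j * d j * f j) ≤ θ ^ 2 * energy D f := by
  refine (Summable.tsum_le_tsum (h.norm_apply_sq_le hd hf) (h.wsummable_apply hd hf)
    (h.summable.mul_right _)).trans ?_
  rw [tsum_mul_right]
  exact mul_le_mul_of_nonneg_right h.tsum_le (energy_nonneg h.weight_nonneg _)

theorem wsummable_iterEntry (h : IsHSContraction V D θ) (hd : ∀ j, ‖d j‖ ≤ D j)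
    (hb : WSummable D fun j => V j b) : ∀ k, WSummable D (iterEntry V d b k)
  | 0 => hb
  | k + 1 => h.wsummable_apply hd (h.wsummable_iterEntry hd hb k)

theorem sqrt_energy_iterEntry_le (h : IsHSContraction V D θ) (hd : ∀ j, ‖d j‖ ≤ D j)
    (hb : WSummable D fun j => V j b) (k : ℕ) :
    √(energy D (iterEntry V d b k)) ≤ θ ^ k * √(energy D fun j => V j b) := by
  induction k with
  | zero => simp [iterEntry]
  | succ k ih =>
    calc √(energy D (iterEntry V d b (k + 1)))
        ≤ √(θ ^ 2 * energy D (iterEntry V d b k)) :=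
          Real.sqrt_le_sqrt (h.energy_apply_le hd (h.wsummable_iterEntry hd hb k))
      _ = θ * √(energy D (iterEntry V d b k)) := by
          rw [Real.sqrt_mul (sq_nonneg _), Real.sqrt_sq h.theta_nonneg]
      _ ≤ θ * (θ ^ k * √(energy D fun j => V j b)) :=
          mul_le_mul_of_nonneg_left ih h.theta_nonneg
      _ = θ ^ (k + 1) * √(energy D fun j => V j b) := by ring

theorem tsum_norm_iterEntry_le (h : IsHSContraction V D θ) (hd : ∀ j, ‖d j‖ ≤ D j)
    (hb : WSummable D fun j => V j b) (ha : WSummable D (V a)) (k : ℕ) :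
    ∑' j, ‖V a j * d j * iterEntry V d b k j‖ ≤
      √(energy D (V a)) * √(energy D fun j => V j b) * θ ^ k :=
  calc _ ≤ √(energy D (V a)) * √(energy D (iterEntry V d b k)) :=
        ha.tsum_norm_le hd (h.wsummable_iterEntry hd hb k)
    _ ≤ √(energy D (V a)) * (θ ^ k * √(energy D fun j => V j b)) := by
        gcongr
        exact h.sqrt_energy_iterEntry_le hd hb k
    _ = _ := by ring

theorem norm_iterEntry_succ_le (h : IsHSContraction V D θ) (hd : ∀ j, ‖d j‖ ≤ D j)
    (hb : WSummable D fun j => V j b) (ha : WSummable D (V a)) (k : ℕ) :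
    ‖iterEntry V d b (k + 1) a‖ ≤ √(energy D (V a)) * √(energy D fun j => V j b) * θ ^ k :=
  (norm_tsum_le_tsum_norm (ha.summable_norm hd (h.wsummable_iterEntry hd hb k))).trans
    (h.tsum_norm_iterEntry_le hd hb ha k)

theorem summable_geometric (h : IsHSContraction V D θ) (C : ℝ) :
    Summable fun k : ℕ => C * θ ^ k :=
  (summable_geometric_of_lt_one h.theta_nonneg h.theta_lt_one).mul_left _

theorem reducedEntry_eq_add_tsum_succ (h : IsHSContraction V D θ) (hd : ∀ j, ‖d j‖ ≤ D j)
    (hb : WSummable D fun j => V j b) (ha : WSummable D (V a)) :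
    reducedEntry V d a b = V a b + ∑' k, iterEntry V d b (k + 1) a :=
  Summable.tsum_eq_zero_add ((summable_nat_add_iff 1).1
    (Summable.of_norm_bounded (h.summable_geometric _) (h.norm_iterEntry_succ_le hd hb ha)))

theorem norm_reducedEntry_sub_le (h : IsHSContraction V D θ) (hd : ∀ j, ‖d j‖ ≤ D j)
    (hb : WSummable D fun j => V j b) (ha : WSummable D (V a)) :
    ‖reducedEntry V d a b - V a b‖ ≤
      √(energy D (V a)) * √(energy D fun j => V j b) * (1 - θ)⁻¹ := by
  rw [h.reducedEntry_eq_add_tsum_succ hd hb ha, add_sub_cancel_left]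
  refine (tsum_of_norm_bounded (h.summable_geometric _).hasSum
    (h.norm_iterEntry_succ_le hd hb ha)).trans ?_
  rw [tsum_mul_left, tsum_geometric_of_lt_one h.theta_nonneg h.theta_lt_one]

theorem wsummable_reducedEntry (h : IsHSContraction V D θ) (hd : ∀ j, ‖d j‖ ≤ D j)
    (hb : WSummable D fun j => V j b) : WSummable D (fun j => reducedEntry V d j b) := by
  have hθ : 0 ≤ (1 - θ)⁻¹ := inv_nonneg.2 (by linarith [h.theta_lt_one])
  have hsub : WSummable D fun j => reducedEntry V d j b - V j b := by
    refine WSummable.of_norm_le h.weight_nonneg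
      (h.wsummable_sqrt_energy.const_mul ((√(energy D fun j => V j b) * (1 - θ)⁻¹ : ℝ) : ℂ))
      fun j hj => (h.norm_reducedEntry_sub_le hd hb (h.row j hj)).trans_eq ?_
    rw [norm_mul, norm_sqrt_energy, Complex.norm_real, Real.norm_of_nonneg (by positivity)]
    ring
  simpa only [sub_add_cancel] using hsub.add h.weight_nonneg hb

theorem reducedEntry_eq_add_apply (h : IsHSContraction V D θ) (hd : ∀ j, ‖d j‖ ≤ D j)
    (hb : WSummable D fun j => V j b) (ha : WSummable D (V a)) :
    reducedEntry V d a b = V a b + ∑' j, V a j * d j * reducedEntry V d j b := by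
  have hprod : Summable (Function.uncurry fun (k : ℕ) j => V a j * d j * iterEntry V d b k j) :=
    Summable.of_norm ((summable_prod_of_nonneg fun _ => norm_nonneg _).2
      ⟨fun k => ha.summable_norm hd (h.wsummable_iterEntry hd hb k),
        Summable.of_nonneg_of_le (fun k => tsum_nonneg fun _ => norm_nonneg _)
          (h.tsum_norm_iterEntry_le hd hb ha) (h.summable_geometric _)⟩)
  calc reducedEntry V d a b = V a b + ∑' k, ∑' j, V a j * d j * iterEntry V d b k j :=
        h.reducedEntry_eq_add_tsum_succ hd hb ha
    _ = V a b + ∑' j, ∑' k, V a j * d j * iterEntry V d b k j := by rw [← hprod.tsum_comm]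
    _ = V a b + ∑' j, V a j * d j * reducedEntry V d j b := by
        simp only [tsum_mul_left, reducedEntry]

theorem eq_zero_of_eq_apply (h : IsHSContraction V D θ) (hd : ∀ j, ‖d j‖ ≤ D j) {H : ι → ℂ}
    (hH : WSummable D H) (heq : ∀ a, D a ≠ 0 → H a = ∑' j, V a j * d j * H j) {a : ι}
    (ha : D a ≠ 0) : H a = 0 := by
  have henergy : energy D H ≤ θ ^ 2 * energy D H := by
    refine le_of_eq_of_le (tsum_congr fun a => ?_) (h.energy_apply_le hd hH)
    rcases eq_or_ne (D a) 0 with h0 | h0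
    · simp [h0]
    · beta_reduce
      rw [← heq a h0]
  have hθ : θ ^ 2 < 1 := pow_lt_one₀ h.theta_nonneg h.theta_lt_one two_ne_zero
  have hzero : energy D H = 0 := by nlinarith [energy_nonneg h.weight_nonneg H]
  have hterm : D a * ‖H a‖ ^ 2 ≤ 0 := hzero ▸ hH.le_tsum a fun j _ =>
    mul_nonneg (h.weight_nonneg j) (sq_nonneg _)
  have hpos : 0 < D a := (h.weight_nonneg a).lt_of_ne' ha
  simpa using le_antisymm (nonpos_of_mul_nonpos_right hterm hpos) (sq_nonneg _)

theorem tsum_mul_apply_comm (h : IsHSContraction V D θ) (hd : ∀ j, ‖d j‖ ≤ D j) {f g : ι → ℂ}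
    (hf : WSummable D f) (hg : WSummable D g) :
    ∑' i, f i * d i * ∑' j, V i j * d j * g j = ∑' j, (∑' i, f i * d i * V i j) * (d j * g j) := by
  have hd0 : ∀ j, D j = 0 → d j = 0 := fun j hj => norm_le_zero_iff.1 (hj ▸ hd j)
  have hrow : ∀ i, Summable fun j => ‖f i * d i * (V i j * d j * g j)‖ := by
    intro i
    rcases eq_or_ne (D i) 0 with h0 | h0
    · simp [hd0 i h0, summable_zero]
    · simpa only [norm_mul (f i * d i)] using ((h.row i h0).summable_norm hd hg).mul_left _
  have hrow_le : ∀ i, ∑' j, ‖f i * d i * (V i j * d j * g j)‖ ≤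
      D i * (‖f i‖ * ‖(√(energy D (V i)) : ℂ)‖) * √(energy D g) := by
    intro i
    rcases eq_or_ne (D i) 0 with h0 | h0
    · simp [hd0 i h0, h0]
    · simp only [norm_mul (f i * d i)]
      rw [tsum_mul_left, norm_mul, norm_sqrt_energy]
      calc ‖f i‖ * ‖d i‖ * ∑' j, ‖V i j * d j * g j‖
          ≤ ‖f i‖ * D i * (√(energy D (V i)) * √(energy D g)) := by
            have := h.weight_nonneg i
            gcongr
            exacts [hd i, (h.row i h0).tsum_norm_le hd hg]
        _ = _ := by ring
  have hprod : Summable (Function.uncurry fun i j => f i * d i * (V i j * d j * g j)) :=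
    Summable.of_norm ((summable_prod_of_nonneg fun _ => norm_nonneg _).2 ⟨hrow,
      Summable.of_nonneg_of_le (fun i => tsum_nonneg fun _ => norm_nonneg _) hrow_le
        ((hf.summable_mul h.weight_nonneg h.wsummable_sqrt_energy).mul_right _)⟩)
  calc _ = ∑' i, ∑' j, f i * d i * (V i j * d j * g j) := by simp only [tsum_mul_left]
    _ = ∑' j, ∑' i, f i * d i * (V i j * d j * g j) := hprod.tsum_comm.symm
    _ = _ := by simp only [mul_assoc, ← tsum_mul_right]

/-- Both sides are evaluated in `∑ T d V d S` with `T` a column of the transposed and `S` a column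
of the original `S`-matrix, using `S = V + V d S` for each of them. -/
theorem reducedEntry_symm (h : IsHSContraction V D θ) (hd : ∀ j, ‖d j‖ ≤ D j) (τ : ι ≃ ι)
    (hV : ∀ i j, V (τ i) (τ j) = V j i) (hDτ : ∀ j, D (τ j) = D j) (hdτ : ∀ j, d (τ j) = d j)
    (ha : WSummable D (V a)) (hb : WSummable D fun j => V j b)
    (ha' : WSummable D fun j => V j (τ a)) (hb' : WSummable D (V (τ b))) :
    reducedEntry V d (τ b) (τ a) = reducedEntry V d a b := by
  set T : ι → ℂ := fun i => reducedEntry V d (τ i) (τ a)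
  set S : ι → ℂ := fun i => reducedEntry V d i b
  have hd0 : ∀ j, D j = 0 → d j = 0 := fun j hj => norm_le_zero_iff.1 (hj ▸ hd j)
  have hT : WSummable D T :=
    ((τ.summable_iff (f := fun i => D i * ‖reducedEntry V d i (τ a)‖ ^ 2)).2
      (h.wsummable_reducedEntry hd ha')).congr fun i => by simp [T, hDτ]
  have hS : WSummable D S := h.wsummable_reducedEntry hd hb
  have hTeq : ∀ j, WSummable D (V (τ j)) → T j = V a j + ∑' i, T i * d i * V i j := by
    intro j hj
    simp only [T]
    rw [h.reducedEntry_eq_add_apply hd ha' hj, hV, ← τ.tsum_eq]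
    simp only [hV, hdτ]
    exact congrArg _ (tsum_congr fun i => by ring)
  have hleft : ∑' i, T i * d i * ∑' j, V i j * d j * S j =
      ∑' i, (T i * d i * S i - T i * d i * V i b) := tsum_congr fun i => by
    rcases eq_or_ne (D i) 0 with h0 | h0
    · simp [hd0 i h0]
    · rw [show S i = _ from h.reducedEntry_eq_add_apply hd hb (h.row i h0)]
      ring
  have hright : ∑' j, (∑' i, T i * d i * V i j) * (d j * S j) =
      ∑' j, (T j * d j * S j - V a j * d j * S j) := tsum_congr fun j => by
    rcases eq_or_ne (D j) 0 with h0 | h0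
    · simp [hd0 j h0]
    · rw [hTeq j (h.row _ (by rwa [hDτ]))]
      ring
  have hcomm := h.tsum_mul_apply_comm hd hT hS
  rw [hleft, hright, (hT.summable_mul_mul hd hS).tsum_sub (hT.summable_mul_mul hd hb),
    (hT.summable_mul_mul hd hS).tsum_sub (ha.summable_mul_mul hd hS)] at hcomm
  change T b = _
  rw [hTeq b hb', h.reducedEntry_eq_add_apply hd hb ha]
  linear_combination -hcomm

theorem exists_majorant_iterEntry (h : IsHSContraction V D θ) (hb : WSummable D fun j => V j b)
    (k : ℕ) : ∃ M : ι → ℂ, WSummable D M ∧ ∀ d : ι → ℂ, (∀ j, ‖d j‖ ≤ D j) →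
      ∀ j, D j ≠ 0 → ‖iterEntry V d b k j‖ ≤ ‖M j‖ := by
  rcases k with _ | k
  · exact ⟨_, hb, fun _ _ _ _ => le_rfl⟩
  · refine ⟨_, h.wsummable_sqrt_energy.const_mul ((√(energy D fun j => V j b) * θ ^ k : ℝ) : ℂ),
      fun d hd j hj => (h.norm_iterEntry_succ_le hd hb (h.row j hj) k).trans_eq ?_⟩
    have := h.theta_nonneg
    rw [norm_mul, norm_sqrt_energy, Complex.norm_real, Real.norm_of_nonneg (by positivity)]
    ring

theorem differentiableOn_iterEntry (h : IsHSContraction V D θ) {s : Set ℂ} (hs : IsOpen s)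
    {d : ℂ → ι → ℂ} (hd : ∀ z ∈ s, ∀ j, ‖d z j‖ ≤ D j)
    (hdiff : ∀ j, DifferentiableOn ℂ (fun z => d z j) s)
    (hb : WSummable D fun j => V j b) (k : ℕ) (ha : WSummable D (V a)) :
    DifferentiableOn ℂ (fun z => iterEntry V (d z) b k a) s := by
  induction k generalizing a with
  | zero => exact differentiableOn_const _
  | succ k ih =>
    have hd0 : ∀ j, D j = 0 → ∀ z ∈ s, d z j = 0 := fun j h0 z hz =>
      norm_le_zero_iff.1 (h0 ▸ hd z hz j)
    obtain ⟨M, hM, hle⟩ := h.exists_majorant_iterEntry hb k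
    refine Complex.differentiableOn_tsum_of_summable_norm
      (ha.summable_mul h.weight_nonneg hM) (fun j => ?_) hs fun j z hz => ?_
    · rcases eq_or_ne (D j) 0 with h0 | h0
      · exact (differentiableOn_const (0 : ℂ)).congr fun z hz => by simp [hd0 j h0 z hz]
      · exact ((differentiableOn_const _).mul (hdiff j)).mul (ih (h.row j h0))
    · rcases eq_or_ne (D j) 0 with h0 | h0
      · simp [hd0 j h0 z hz, h0]
      · refine (WSummable.norm_mul_mul_le (hd z hz) (V a) _ j).trans ?_
        have := h.weight_nonneg j
        gcongr
        exact hle _ (hd z hz) j h0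

theorem differentiableOn_reducedEntry (h : IsHSContraction V D θ) {s : Set ℂ} (hs : IsOpen s)
    {d : ℂ → ι → ℂ} (hd : ∀ z ∈ s, ∀ j, ‖d z j‖ ≤ D j)
    (hdiff : ∀ j, DifferentiableOn ℂ (fun z => d z j) s)
    (hb : WSummable D fun j => V j b) (ha : WSummable D (V a)) :
    DifferentiableOn ℂ (fun z => reducedEntry V (d z) a b) s :=
  ((differentiableOn_const (V a b)).add (Complex.differentiableOn_tsum_of_summable_norm
    (h.summable_geometric _) (fun k => h.differentiableOn_iterEntry hs hd hdiff hb (k + 1) ha) hs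
    fun k z hz => h.norm_iterEntry_succ_le (hd z hz) hb ha k)).congr
      fun z hz => h.reducedEntry_eq_add_tsum_succ (hd z hz) hb ha

end IsHSContraction

end Matrix

/-! ### Reduction of an eigenvalue equation to a two-dimensional one -/

theorem exists_eigenvector_iff {s₁₁ s₁₂ s₂₁ s₂₂ z : ℂ} :
    (∃ p q : ℂ, (p ≠ 0 ∨ q ≠ 0) ∧ p * s₁₁ + q * s₁₂ = z * p ∧ p * s₂₁ + q * s₂₂ = z * q) ↔
      (z - s₁₁) * (z - s₂₂) = s₁₂ * s₂₁ := by
  have hdet := Matrix.exists_mulVec_eq_zero_iff (M := !![z - s₁₁, -s₁₂; -s₂₁, z - s₂₂])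
  rw [Matrix.det_fin_two_of, neg_mul_neg, sub_eq_zero] at hdet
  rw [← hdet]
  constructor
  · rintro ⟨p, q, hpq, h₁, h₂⟩
    refine ⟨![p, q], by simpa [or_iff_not_imp_left] using hpq, ?_⟩
    ext i
    fin_cases i
    · simpa using by linear_combination -h₁
    · simpa using by linear_combination -h₂
  · rintro ⟨v, hv, hzero⟩
    have h₁ := congrFun hzero 0
    have h₂ := congrFun hzero 1
    simp only [Matrix.mulVec_apply_eq_sum, Fin.sum_univ_two, Matrix.of_apply, Matrix.cons_val_zero,
      Matrix.cons_val_one, Matrix.cons_val', Matrix.cons_val_fin_one, Pi.zero_apply] at h₁ h₂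
    refine ⟨v 0, v 1, ?_, by linear_combination -h₁, by linear_combination -h₂⟩
    contrapose! hv
    ext i
    fin_cases i
    exacts [hv.1, hv.2]

section Reduction

variable {ι : Type} {V : ι → ι → ℂ} {D : ι → ℝ} {d : ι → ℂ} {a b : ι} {M : ℝ} {z : ℂ}

/-- The assumptions under which the equation `d⁻¹ Y = V Y` can be reduced to the span of `e_a, e_b`,
with a reduced matrix of size `O(M)`: the indices `a` and `b` carry no weight, and the rows and
columns of `V` at these indices have energy and entries at most `M`. -/
structure IsModelPair (V : ι → ι → ℂ) (D : ι → ℝ) (a b : ι) (M : ℝ) : Prop where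
  contraction : IsHSContraction V D (1 / 2)
  ne : a ≠ b
  weight_left : D a = 0
  weight_right : D b = 0
  row : ∀ x, x = a ∨ x = b → WSummable D (V x) ∧ energy D (V x) ≤ M
  col : ∀ x, x = a ∨ x = b → (WSummable D fun j => V j x) ∧ energy D (fun j => V j x) ≤ M
  entry : ∀ x y, (x = a ∨ x = b) → (y = a ∨ y = b) → ‖V x y‖ ≤ M

/-- `Y` solves the eigenvalue equation with `G = V Y` in the coordinates `a`, `b` and in those of
nonzero weight: `Y = d G` off `a` and `b`, where `d` is the reduced resolvent, and `G = z Y` at `a`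
and `b`. -/
structure IsSolution (V : ι → ι → ℂ) (D : ι → ℝ) (d : ι → ℂ) (a b : ι) (z : ℂ) (Y G : ι → ℂ) :
    Prop where
  wsummable : WSummable D G
  off : ∀ j, j ≠ a → j ≠ b → Y j = d j * G j
  hasSum : ∀ j, D j ≠ 0 ∨ j = a ∨ j = b → HasSum (fun i => V j i * Y i) (G j)
  left : G a = z * Y a
  right : G b = z * Y b

namespace IsModelPair

theorem norm_reducedEntry_le (h : IsModelPair V D a b M) (hd : ∀ j, ‖d j‖ ≤ D j) {x y : ι}
    (hx : x = a ∨ x = b) (hy : y = a ∨ y = b) : ‖reducedEntry V d x y‖ ≤ 3 * M := by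
  have hM : 0 ≤ M := (norm_nonneg _).trans (h.entry x y hx hy)
  have hsub : ‖reducedEntry V d x y - V x y‖ ≤ 2 * M :=
    calc ‖reducedEntry V d x y - V x y‖
        ≤ √(energy D (V x)) * √(energy D fun j => V j y) * (1 - 1 / 2)⁻¹ :=
          h.contraction.norm_reducedEntry_sub_le hd (h.col y hy).1 (h.row x hx).1
      _ ≤ √M * √M * (1 - 1 / 2)⁻¹ := by
          gcongr
          exacts [(h.row x hx).2, (h.col y hy).2]
      _ = 2 * M := by rw [Real.mul_self_sqrt hM]; ring
  linarith [norm_sub_norm_le (reducedEntry V d x y) (V x y), h.entry x y hx hy]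

theorem isSmallOn_reducedEntry (h : IsModelPair V D a b M) {r ε : ℝ} (hε : 3 * M ≤ ε * r)
    {d : ℂ → ι → ℂ} (hd : ∀ z ∈ Metric.ball (0 : ℂ) r, ∀ j, ‖d z j‖ ≤ D j)
    (hdiff : ∀ j, DifferentiableOn ℂ (fun z => d z j) (Metric.ball 0 r)) {x y : ι}
    (hx : x = a ∨ x = b) (hy : y = a ∨ y = b) :
    IsSmallOn r ε fun z => reducedEntry V (d z) x y where
  differentiableOn := h.contraction.differentiableOn_reducedEntry Metric.isOpen_ball hd hdiff
    (h.col y hy).1 (h.row x hx).1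
  norm_le z hz := (h.norm_reducedEntry_le (hd z hz) hx hy).trans hε

theorem smallEntries (h : IsModelPair V D a b M) {r ε : ℝ} (hr : 0 < r) (hε : 3 * M ≤ ε * r)
    {d : ℂ → ι → ℂ} (hd : ∀ z ∈ Metric.ball (0 : ℂ) r, ∀ j, ‖d z j‖ ≤ D j)
    (hdiff : ∀ j, DifferentiableOn ℂ (fun z => d z j) (Metric.ball 0 r)) :
    SmallEntries r ε (fun z => reducedEntry V (d z) a a) (fun z => reducedEntry V (d z) a b)
      (fun z => reducedEntry V (d z) b a) where
  pos := hr
  alpha := h.isSmallOn_reducedEntry hε hd hdiff (.inl rfl) (.inl rfl)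
  beta_one := h.isSmallOn_reducedEntry hε hd hdiff (.inl rfl) (.inr rfl)
  beta_two := h.isSmallOn_reducedEntry hε hd hdiff (.inr rfl) (.inl rfl)

theorem reducedEntry_diag_eq (h : IsModelPair V D a b M) (hd : ∀ j, ‖d j‖ ≤ D j) (τ : ι ≃ ι)
    (hV : ∀ i j, V (τ i) (τ j) = V j i) (hDτ : ∀ j, D (τ j) = D j) (hdτ : ∀ j, d (τ j) = d j)
    (hτ : τ a = b) : reducedEntry V d b b = reducedEntry V d a a := by
  have hsymm := h.contraction.reducedEntry_symm (a := a) (b := a) hd τ hV hDτ hdτ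
    (h.row a (.inl rfl)).1 (h.col a (.inl rfl)).1 (h.col _ (.inr hτ)).1 (h.row _ (.inr hτ)).1
  rwa [hτ] at hsymm

theorem wsummable_row (h : IsModelPair V D a b M) {j : ι} (hj : D j ≠ 0 ∨ j = a ∨ j = b) :
    WSummable D (V j) :=
  hj.elim (h.contraction.row j) fun hj => (h.row j hj).1

theorem wsummable_combination (h : IsModelPair V D a b M) (hd : ∀ j, ‖d j‖ ≤ D j) (p q : ℂ) :
    WSummable D fun j => p * reducedEntry V d j a + q * reducedEntry V d j b :=
  ((h.contraction.wsummable_reducedEntry hd (h.col a (.inl rfl)).1).const_mul p).add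
    h.contraction.weight_nonneg
    ((h.contraction.wsummable_reducedEntry hd (h.col b (.inr rfl)).1).const_mul q)

theorem combination_eq_add_apply (h : IsModelPair V D a b M) (hd : ∀ j, ‖d j‖ ≤ D j) (p q : ℂ)
    {j : ι} (hj : D j ≠ 0 ∨ j = a ∨ j = b) :
    p * reducedEntry V d j a + q * reducedEntry V d j b = p * V j a + q * V j b +
      ∑' i, V j i * d i * (p * reducedEntry V d i a + q * reducedEntry V d i b) := by
  have hrow := h.wsummable_row hj
  have hca := (h.col a (.inl rfl)).1
  have hcb := (h.col b (.inr rfl)).1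
  have hsa := hrow.summable_mul_mul hd (h.contraction.wsummable_reducedEntry hd hca)
  have hsb := hrow.summable_mul_mul hd (h.contraction.wsummable_reducedEntry hd hcb)
  have hsum : ∑' i, V j i * d i * (p * reducedEntry V d i a + q * reducedEntry V d i b) =
      p * ∑' i, V j i * d i * reducedEntry V d i a +
        q * ∑' i, V j i * d i * reducedEntry V d i b := by
    rw [← tsum_mul_left, ← tsum_mul_left, ← (hsa.mul_left p).tsum_add (hsb.mul_left q)]
    exact tsum_congr fun i => by ring
  rw [hsum, h.contraction.reducedEntry_eq_add_apply hd hca hrow,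
    h.contraction.reducedEntry_eq_add_apply hd hcb hrow]
  ring

theorem hasSum_of_off (h : IsModelPair V D a b M) (hd : ∀ j, ‖d j‖ ≤ D j) {Y G : ι → ℂ}
    (hG : WSummable D G) (hoff : ∀ j, j ≠ a → j ≠ b → Y j = d j * G j) {j : ι}
    (hj : D j ≠ 0 ∨ j = a ∨ j = b) :
    HasSum (fun i => V j i * Y i) (Y a * V j a + Y b * V j b + ∑' i, V j i * d i * G i) := by
  classical
  have hda : d a = 0 := norm_le_zero_iff.1 (h.weight_left ▸ hd a)
  have hdb : d b = 0 := norm_le_zero_iff.1 (h.weight_right ▸ hd b)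
  have hpair : HasSum (fun i => (if i = a then Y a * V j a else 0) +
      if i = b then Y b * V j b else 0) (Y a * V j a + Y b * V j b) :=
    (hasSum_ite_eq a _).add (hasSum_ite_eq b _)
  refine (hpair.add ((h.wsummable_row hj).summable_mul_mul hd hG).hasSum).congr_fun fun i => ?_
  rcases eq_or_ne i a with rfl | hia
  · simp [hda, h.ne, mul_comm]
  rcases eq_or_ne i b with rfl | hib
  · simp [hdb, hia, mul_comm]
  · simp [hia, hib, hoff i hia hib, mul_assoc]

end IsModelPair

namespace IsSolution

variable {Y G : ι → ℂ}

/-- The difference of the two sides is annihilated by the contraction `1 - V d`. -/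
theorem eq_combination (hs : IsSolution V D d a b z Y G) (h : IsModelPair V D a b M)
    (hd : ∀ j, ‖d j‖ ≤ D j) {j : ι} (hj : D j ≠ 0 ∨ j = a ∨ j = b) :
    G j = Y a * reducedEntry V d j a + Y b * reducedEntry V d j b := by
  set F : ι → ℂ := fun j => Y a * reducedEntry V d j a + Y b * reducedEntry V d j b
  have hF : WSummable D F := h.wsummable_combination hd (Y a) (Y b)
  have hfix : ∀ j, D j ≠ 0 ∨ j = a ∨ j = b →
      G j - F j = ∑' i, V j i * d i * (G i - F i) := by
    intro j hj
    have hrow := h.wsummable_row hj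
    have hGj := (hs.hasSum j hj).unique (h.hasSum_of_off hd hs.wsummable hs.off hj)
    have hFj : F j = _ := h.combination_eq_add_apply hd (Y a) (Y b) hj
    simp only [mul_sub]
    rw [(hrow.summable_mul_mul hd hs.wsummable).tsum_sub (hrow.summable_mul_mul hd hF), hGj, hFj]
    ring
  have hzero : ∀ i, d i * (G i - F i) = 0 := by
    intro i
    rcases eq_or_ne (D i) 0 with h0 | h0
    · have hdi : d i = 0 := norm_le_zero_iff.1 (h0 ▸ hd i)
      rw [hdi, zero_mul]
    · rw [h.contraction.eq_zero_of_eq_apply hd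
        (hs.wsummable.sub h.contraction.weight_nonneg hF) (fun j hj => hfix j (.inl hj)) h0,
        mul_zero]
  have hj0 := hfix j hj
  simp only [mul_assoc, hzero, mul_zero, tsum_zero] at hj0
  exact sub_eq_zero.1 hj0

theorem apply_ne_zero (hs : IsSolution V D d a b z Y G) (h : IsModelPair V D a b M)
    (hd : ∀ j, ‖d j‖ ≤ D j) (hY : ∃ j, Y j ≠ 0) : Y a ≠ 0 ∨ Y b ≠ 0 := by
  by_contra! hab
  obtain ⟨j, hj⟩ := hY
  have hja : j ≠ a := by rintro rfl; exact hj hab.1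
  have hjb : j ≠ b := by rintro rfl; exact hj hab.2
  rw [hs.off j hja hjb] at hj
  have hDj : D j ≠ 0 := fun h0 => left_ne_zero_of_mul hj (norm_le_zero_iff.1 (h0 ▸ hd j))
  exact right_ne_zero_of_mul hj (by simp [hs.eq_combination h hd (.inl hDj), hab])

theorem det_eq_zero (hs : IsSolution V D d a b z Y G) (h : IsModelPair V D a b M)
    (hd : ∀ j, ‖d j‖ ≤ D j) (hY : ∃ j, Y j ≠ 0) :
    (z - reducedEntry V d a a) * (z - reducedEntry V d b b) =
      reducedEntry V d a b * reducedEntry V d b a :=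
  exists_eigenvector_iff.1 ⟨Y a, Y b, hs.apply_ne_zero h hd hY,
    (hs.eq_combination h hd (.inr (.inl rfl))).symm.trans hs.left,
    (hs.eq_combination h hd (.inr (.inr rfl))).symm.trans hs.right⟩

end IsSolution

theorem IsModelPair.exists_isSolution (h : IsModelPair V D a b M) (hd : ∀ j, ‖d j‖ ≤ D j)
    (hdet : (z - reducedEntry V d a a) * (z - reducedEntry V d b b) =
      reducedEntry V d a b * reducedEntry V d b a) :
    ∃ Y G : ι → ℂ, (Y a ≠ 0 ∨ Y b ≠ 0) ∧ IsSolution V D d a b z Y G := by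
  classical
  obtain ⟨p, q, hpq, ha, hb⟩ := exists_eigenvector_iff.2 hdet
  set G : ι → ℂ := fun j => p * reducedEntry V d j a + q * reducedEntry V d j b
  set Y : ι → ℂ := fun j => if j = a then p else if j = b then q else d j * G j
  have hYa : Y a = p := if_pos rfl
  have hYb : Y b = q := by simp [Y, h.ne.symm]
  have hG : WSummable D G := h.wsummable_combination hd p q
  have hoff : ∀ j, j ≠ a → j ≠ b → Y j = d j * G j := fun j hja hjb => by simp [Y, hja, hjb]
  refine ⟨Y, G, by rwa [hYa, hYb], hG, hoff, fun j hj => ?_, by rw [hYa, ← ha], by rw [hYb, ← hb]⟩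
  have hGj : G j = _ := h.combination_eq_add_apply hd p q hj
  simpa only [hGj, hYa, hYb] using h.hasSum_of_off hd hG hoff hj

end Reduction

theorem intervalMeasure_eq_restrict_Ioc :
    intervalMeasure = volume.restrict (Set.Ioc 0 Real.pi) :=
  Measure.restrict_congr_set Ioc_ae_eq_Icc.symm

instance : IsFiniteMeasure intervalMeasure := by
  unfold intervalMeasure; infer_instance

theorem fourierCoeffPi_eq (f : ℝ → ℂ) (m : ℤ) :
    fourierCoeffPi f m =
      (Real.pi : ℂ)⁻¹ * ∫ x, f x * Complex.exp (-(Complex.I * m * x)) ∂intervalMeasure := by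
  rw [fourierCoeffPi, intervalIntegral.integral_of_le Real.pi_pos.le,
    intervalMeasure_eq_restrict_Ioc]

theorem intervalIntegrable_iff_integrable {f : ℝ → ℂ} :
    IntervalIntegrable f volume 0 Real.pi ↔ Integrable f intervalMeasure :=
  intervalIntegrable_iff_integrableOn_Icc_of_le Real.pi_pos.le

theorem norm_exp_I_mul (m : ℤ) (x : ℝ) : ‖Complex.exp (-(Complex.I * m * x))‖ = 1 := by
  rw [show -(Complex.I * m * x) = ((-(m * x) : ℝ) : ℂ) * Complex.I by push_cast; ring]
  exact Complex.norm_exp_ofReal_mul_I _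

theorem continuous_exp_I_mul (m : ℤ) :
    Continuous fun x : ℝ => Complex.exp (-(Complex.I * m * x)) := by fun_prop

theorem integrable_mul_exp {f : ℝ → ℂ} (hf : Integrable f intervalMeasure) (m : ℤ) :
    Integrable (fun x => f x * Complex.exp (-(Complex.I * m * x))) intervalMeasure :=
  hf.mul_bdd (c := 1) (continuous_exp_I_mul m).aestronglyMeasurable
    (ae_of_all _ fun x => (norm_exp_I_mul m x).le)

theorem memLp_mul_exp {f : ℝ → ℂ} (hf : MemLp f 2 intervalMeasure) (m : ℤ) :
    MemLp (fun x => f x * Complex.exp (-(Complex.I * m * x))) 2 intervalMeasure := by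
  refine MemLp.of_le hf (hf.1.mul (continuous_exp_I_mul m).aestronglyMeasurable)
    (ae_of_all _ fun x => ?_)
  rw [norm_mul, norm_exp_I_mul, mul_one]

theorem fourierCoeffPi_add {f g : ℝ → ℂ} (hf : Integrable f intervalMeasure)
    (hg : Integrable g intervalMeasure) (m : ℤ) :
    fourierCoeffPi (fun x => f x + g x) m = fourierCoeffPi f m + fourierCoeffPi g m := by
  simp only [fourierCoeffPi_eq, add_mul]
  rw [integral_add (integrable_mul_exp hf m) (integrable_mul_exp hg m), mul_add]

theorem fourierCoeffPi_const_mul (c : ℂ) (f : ℝ → ℂ) (m : ℤ) :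
    fourierCoeffPi (fun x => c * f x) m = c * fourierCoeffPi f m := by
  simp only [fourierCoeffPi_eq, mul_assoc c]
  rw [integral_const_mul]; ring

theorem fourierCoeffPi_sub {f g : ℝ → ℂ} (hf : Integrable f intervalMeasure)
    (hg : Integrable g intervalMeasure) (m : ℤ) :
    fourierCoeffPi (fun x => f x - g x) m = fourierCoeffPi f m - fourierCoeffPi g m := by
  simp only [fourierCoeffPi_eq, sub_mul]
  rw [integral_sub (integrable_mul_exp hf m) (integrable_mul_exp hg m), mul_sub]

theorem fourierCoeffPi_congr {f g : ℝ → ℂ} (h : ∀ᵐ x ∂intervalMeasure, f x = g x) (m : ℤ) :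
    fourierCoeffPi f m = fourierCoeffPi g m := by
  simp only [fourierCoeffPi_eq]
  congr 1
  exact integral_congr_ae (h.mono fun x hx => by simp only [hx])

theorem fourierCoeffPi_mul_exp (f : ℝ → ℂ) (r m : ℤ) :
    fourierCoeffPi (fun x => f x * Complex.exp (-(Complex.I * r * x))) m =
      fourierCoeffPi f (r + m) := by
  simp only [fourierCoeffPi, mul_assoc, ← Complex.exp_add]
  congr 2
  ext x
  congr 2
  push_cast; ring

theorem fourierCoeffPi_two_mul_eq_fourierCoeffOn (f : ℝ → ℂ) (k : ℤ) :
    fourierCoeffPi f (2 * k) = fourierCoeffOn Real.pi_pos f k := by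
  rw [fourierCoeffOn_eq_integral, fourierCoeffPi]
  simp only [sub_zero, one_div, smul_eq_mul, Complex.real_smul, Complex.ofReal_inv]
  congr 2
  ext x
  rw [fourier_coe_apply, mul_comm]
  congr 2
  have : (Real.pi : ℂ) ≠ 0 := by exact_mod_cast Real.pi_ne_zero
  push_cast
  field_simp
  simp

theorem fourierCoeffPi_two_mul_eq_fourierCoeff [Fact (0 < Real.pi)]
    (F : AddCircle Real.pi → ℂ) (k : ℤ) :
    fourierCoeffPi (fun x : ℝ => F x) (2 * k) = fourierCoeff F k := by
  rw [fourierCoeff_eq_intervalIntegral F k 0, fourierCoeffPi]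
  simp only [zero_add, one_div, smul_eq_mul, Complex.real_smul, Complex.ofReal_inv]
  congr 2
  ext x
  rw [fourier_coe_apply, mul_comm]
  congr 2
  have : (Real.pi : ℂ) ≠ 0 := by exact_mod_cast Real.pi_ne_zero
  push_cast
  field_simp

theorem hasSum_sq_fourierCoeffPi {f : ℝ → ℂ} (hf : MemLp f 2 intervalMeasure) (r : ℤ) :
    HasSum (fun k : ℤ => ‖fourierCoeffPi f (r + 2 * k)‖ ^ 2)
      (Real.pi⁻¹ * ∫ x, ‖f x‖ ^ 2 ∂intervalMeasure) := by
  have h := memLp_mul_exp hf r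
  rw [intervalMeasure_eq_restrict_Ioc] at h
  have := hasSum_sq_fourierCoeffOn Real.pi_pos h
  simp only [← fourierCoeffPi_two_mul_eq_fourierCoeffOn, fourierCoeffPi_mul_exp, norm_mul,
    norm_exp_I_mul, mul_one, sub_zero, smul_eq_mul] at this
  rwa [intervalIntegral.integral_of_le Real.pi_pos.le, ← intervalMeasure_eq_restrict_Ioc] at this

theorem ae_eq_zero_of_fourierCoeffPi {f : ℝ → ℂ} (hf : MemLp f 2 intervalMeasure) (r : ℤ)
    (h0 : ∀ k : ℤ, fourierCoeffPi f (r + 2 * k) = 0) : ∀ᵐ x ∂intervalMeasure, f x = 0 := by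
  have h1 := hasSum_sq_fourierCoeffPi hf r
  simp only [h0, norm_zero, ne_eq, OfNat.ofNat_ne_zero, not_false_eq_true, zero_pow] at h1
  have h2 := h1.unique hasSum_zero
  have h3 : ∫ x, ‖f x‖ ^ 2 ∂intervalMeasure = 0 := by
    simpa [Real.pi_ne_zero] using h2
  rw [integral_eq_zero_iff_of_nonneg (fun x => sq_nonneg _)
    ((memLp_two_iff_integrable_sq_norm hf.1).1 hf)] at h3
  exact h3.mono fun x hx => by simpa using hx

theorem exists_memLp_fourierCoeffPi {c : ℤ → ℂ} (hc : Summable fun k => ‖c k‖ ^ 2) (r : ℤ) :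
    ∃ f : ℝ → ℂ, MemLp f 2 intervalMeasure ∧ ∀ k, fourierCoeffPi f (r + 2 * k) = c k := by
  have : Fact (0 < Real.pi) := ⟨Real.pi_pos⟩
  have hmem : Memℓp c 2 := memℓp_gen (by simpa using hc)
  set F := (fourierBasis (T := Real.pi)).repr.symm ⟨c, hmem⟩ with hF
  have hcoef : ∀ k, fourierCoeff F k = c k := fun k => by
    rw [← fourierBasis_repr, hF, LinearIsometryEquiv.apply_symm_apply]
  have hFm : MemLp (fun x : ℝ => F (x : AddCircle Real.pi)) 2 intervalMeasure := by
    have h1 : MemLp F 2 (volume : Measure (AddCircle Real.pi)) :=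
      memLp_haarAddCircle_iff.1 (Lp.memLp F)
    have h2 := h1.comp_measurePreserving (AddCircle.measurePreserving_mk Real.pi 0)
    rw [zero_add] at h2
    rw [intervalMeasure_eq_restrict_Ioc]
    exact h2
  refine ⟨fun x => F (x : AddCircle Real.pi) * Complex.exp (-(Complex.I * ((-r : ℤ) : ℂ) * x)),
    memLp_mul_exp hFm (-r), fun k => ?_⟩
  rw [fourierCoeffPi_mul_exp, neg_add_cancel_left, fourierCoeffPi_two_mul_eq_fourierCoeff, hcoef]

theorem fourierCoeffPi_conj (f : ℝ → ℂ) (m : ℤ) :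
    (starRingEnd ℂ) (fourierCoeffPi (fun x => (starRingEnd ℂ) (f x)) m) =
      fourierCoeffPi f (-m) := by
  simp only [fourierCoeffPi_eq, map_mul, ← integral_conj, ← Complex.exp_conj, Complex.conj_conj]
  simp

theorem memLp_liftIoc [Fact (0 < Real.pi)] {f : ℝ → ℂ} (hf : MemLp f 2 intervalMeasure) :
    MemLp (AddCircle.liftIoc Real.pi 0 f) 2 (AddCircle.haarAddCircle (T := Real.pi)) := by
  rw [intervalMeasure_eq_restrict_Ioc, ← zero_add Real.pi] at hf
  exact hf.memLp_liftIoc.haarAddCircle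

theorem fourierCoeff_liftIoc [Fact (0 < Real.pi)] (f : ℝ → ℂ) (k : ℤ) :
    fourierCoeff (AddCircle.liftIoc Real.pi 0 f) k = fourierCoeffPi f (2 * k) := by
  rw [← fourierCoeffPi_two_mul_eq_fourierCoeff]
  refine fourierCoeffPi_congr ?_ _
  rw [intervalMeasure_eq_restrict_Ioc]
  filter_upwards [ae_restrict_mem measurableSet_Ioc] with x hx
  exact AddCircle.liftIoc_coe_apply (by rwa [zero_add])

theorem fourierCoeff_toLp_liftIoc [Fact (0 < Real.pi)] {f : ℝ → ℂ}
    (hf : MemLp f 2 intervalMeasure) (k : ℤ) :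
    fourierCoeff (memLp_liftIoc hf).toLp k = fourierCoeffPi f (2 * k) := by
  rw [fourierCoeff_congr_ae (memLp_liftIoc hf).coeFn_toLp, fourierCoeff_liftIoc]

theorem hasSum_mul_fourierCoeffPi_zero {f g : ℝ → ℂ} (hf : MemLp f 2 intervalMeasure)
    (hg : MemLp g 2 intervalMeasure) :
    HasSum (fun k : ℤ => fourierCoeffPi f (-(2 * k)) * fourierCoeffPi g (2 * k))
      (fourierCoeffPi (fun x => f x * g x) 0) := by
  have : Fact (0 < Real.pi) := ⟨Real.pi_pos⟩
  have hf' : MemLp (fun x => (starRingEnd ℂ) (f x)) 2 intervalMeasure := hf.star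
  set X := (memLp_liftIoc hf').toLp
  set Y := (memLp_liftIoc hg).toLp
  have hinner : inner ℂ X Y = fourierCoeffPi (fun x => f x * g x) 0 := by
    have hzero := fourierCoeff_liftIoc (fun x => f x * g x) 0
    rw [mul_zero] at hzero
    rw [← hzero, L2.inner_def, fourierCoeff]
    refine integral_congr_ae ?_
    filter_upwards [(memLp_liftIoc hf').coeFn_toLp, (memLp_liftIoc hg).coeFn_toLp] with t h1 h2
    rw [h1, h2]
    simp [AddCircle.liftIoc, mul_comm]
  rw [← hinner]
  refine ((fourierBasis (T := Real.pi)).hasSum_inner_mul_inner X Y).congr_fun fun k => ?_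
  rw [← inner_conj_symm, ← HilbertBasis.repr_apply_apply, ← HilbertBasis.repr_apply_apply,
    fourierBasis_repr, fourierBasis_repr, fourierCoeff_toLp_liftIoc hf',
    fourierCoeff_toLp_liftIoc hg, fourierCoeffPi_conj]

theorem hasSum_mul_fourierCoeffPi {f g : ℝ → ℂ} (hf : MemLp f 2 intervalMeasure)
    (hg : MemLp g 2 intervalMeasure) (r j : ℤ) :
    HasSum (fun k : ℤ => fourierCoeffPi f (j - (r + 2 * k)) * fourierCoeffPi g (r + 2 * k))
      (fourierCoeffPi (fun x => f x * g x) j) := by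
  have := hasSum_mul_fourierCoeffPi_zero (memLp_mul_exp hf (j - r)) (memLp_mul_exp hg r)
  simp only [fourierCoeffPi_mul_exp] at this
  have e : fourierCoeffPi (fun x => f x * Complex.exp (-(Complex.I * (j - r : ℤ) * x)) *
      (g x * Complex.exp (-(Complex.I * r * x)))) 0 = fourierCoeffPi (fun x => f x * g x) j := by
    conv_rhs => rw [← add_zero j, ← fourierCoeffPi_mul_exp]
    congr 1
    ext x
    rw [mul_mul_mul_comm, ← Complex.exp_add]
    congr 2
    push_cast; ring
  rw [e] at this
  refine this.congr_fun fun k => ?_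
  congr 2; ring

/-! ### Absolutely continuous functions and their Fourier coefficients -/

theorem HasL1Deriv.continuousOn {y g : ℝ → ℂ} (h : HasL1Deriv y g) :
    ContinuousOn y (Set.Icc 0 Real.pi) := by
  have h1 : ContinuousOn (fun x => y 0 + ∫ t in (0 : ℝ)..x, g t) (Set.Icc 0 Real.pi) := by
    refine continuousOn_const.add ?_
    have := intervalIntegral.continuousOn_primitive_interval (μ := volume) (f := g)
      (a := 0) (b := Real.pi) (by
        rw [Set.uIcc_of_le Real.pi_pos.le]; exact intervalIntegrable_iff_integrable.1 h.1)
    rwa [Set.uIcc_of_le Real.pi_pos.le] at this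
  exact h1.congr h.2

theorem memLp_of_continuousOn {y : ℝ → ℂ} (h : ContinuousOn y (Set.Icc 0 Real.pi)) :
    MemLp y 2 intervalMeasure := by
  obtain ⟨C, hC⟩ := isCompact_Icc.exists_bound_of_continuousOn h
  refine MemLp.of_bound (h.aestronglyMeasurable measurableSet_Icc) C ?_
  exact (ae_restrict_mem measurableSet_Icc).mono fun x hx => hC x hx

theorem memLp_mul_of_continuousOn {y f : ℝ → ℂ} (h : ContinuousOn y (Set.Icc 0 Real.pi))
    (hf : MemLp f 2 intervalMeasure) : MemLp (fun x => f x * y x) 2 intervalMeasure := by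
  obtain ⟨C, hC⟩ := isCompact_Icc.exists_bound_of_continuousOn h
  refine MemLp.of_le_mul (c := C) hf (hf.1.mul (h.aestronglyMeasurable measurableSet_Icc)) ?_
  refine (ae_restrict_mem measurableSet_Icc).mono fun x hx => ?_
  rw [norm_mul, mul_comm]
  gcongr
  exact hC x hx

theorem eqOn_zero_of_ae_eq_zero {y : ℝ → ℂ} (h : ContinuousOn y (Set.Icc 0 Real.pi))
    (h0 : ∀ᵐ x ∂intervalMeasure, y x = 0) : ∀ x ∈ Set.Icc 0 Real.pi, y x = 0 := by
  have := Measure.eqOn_Icc_of_ae_eq volume Real.pi_pos.ne (f := y) (g := fun _ => 0) h0 h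
    continuousOn_const
  exact fun x hx => this hx

theorem absolutelyContinuousOnInterval_congr {E : Type*} [PseudoMetricSpace E] {f g : ℝ → E}
    {a b : ℝ} (hf : AbsolutelyContinuousOnInterval f a b) (hfg : Set.EqOn f g (Set.uIcc a b)) :
    AbsolutelyContinuousOnInterval g a b := by
  rw [absolutelyContinuousOnInterval_iff] at hf ⊢
  intro ε hε
  obtain ⟨δ, hδ, h⟩ := hf ε hε
  refine ⟨δ, hδ, fun I hI hlen => ?_⟩
  convert h I hI hlen using 2 with i hi
  rw [hfg (hI.1 i hi).1, hfg (hI.1 i hi).2]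

theorem absolutelyContinuousOnInterval_integral {g : ℝ → ℂ} {a b : ℝ}
    (hg : IntervalIntegrable g volume a b) :
    AbsolutelyContinuousOnInterval (fun x => ∫ t in a..x, g t) a b := by
  have hconst (c : ℂ) : AbsolutelyContinuousOnInterval (fun _ => c) a b :=
    contDiff_const.contDiffOn.absolutelyContinuousOnInterval
  have hre : IntervalIntegrable (fun t => (g t).re) volume a b := ⟨hg.1.re, hg.2.re⟩
  have him : IntervalIntegrable (fun t => (g t).im) volume a b := ⟨hg.1.im, hg.2.im⟩
  refine absolutelyContinuousOnInterval_congr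
    (((hre.absolutelyContinuousOnInterval_intervalIntegral Set.left_mem_uIcc).fun_smul
      (hconst 1)).fun_add ((him.absolutelyContinuousOnInterval_intervalIntegral
        Set.left_mem_uIcc).fun_smul (hconst Complex.I))) fun x hx => ?_
  have hgx : IntervalIntegrable g volume a x := hg.mono_set (Set.uIcc_subset_uIcc_left hx)
  have hre := intervalIntegral.intervalIntegral_re hgx
  have him := intervalIntegral.intervalIntegral_im hgx
  simp only [RCLike.re_to_complex, RCLike.im_to_complex] at hre him
  simp only [hre, him, Complex.real_smul, mul_one, Complex.re_add_im]

/-- The difference of the two sides, with `π` replaced by a variable endpoint, is absolutely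
continuous and has derivative zero almost everywhere. -/
theorem HasL1Deriv.integral_deriv_mul_add_mul_deriv {y g φ φ' : ℝ → ℂ} (h : HasL1Deriv y g)
    (hφ : ∀ x, HasDerivAt φ (φ' x) x) (hφ' : Continuous φ') :
    ∫ x in (0 : ℝ)..Real.pi, (g x * φ x + y x * φ' x) =
      y Real.pi * φ Real.pi - y 0 * φ 0 := by
  have hIcc : Set.uIcc 0 Real.pi = Set.Icc 0 Real.pi := Set.uIcc_of_le Real.pi_pos.le
  have hφc : Continuous φ := continuous_iff_continuousAt.2 fun x => (hφ x).continuousAt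
  set Z : ℝ → ℂ := fun x => y 0 + ∫ t in (0 : ℝ)..x, g t
  have hyZ : Set.EqOn y Z (Set.Icc 0 Real.pi) := h.2
  have hZ : AbsolutelyContinuousOnInterval Z 0 Real.pi :=
    (contDiff_const.contDiffOn.absolutelyContinuousOnInterval (f := fun _ => y 0)).fun_add
      (absolutelyContinuousOnInterval_integral h.1)
  have hφ1 : ContDiff ℝ 1 φ := contDiff_one_iff_deriv.2
    ⟨fun x => (hφ x).differentiableAt, by rwa [funext fun x => (hφ x).deriv]⟩
  have hφac : AbsolutelyContinuousOnInterval φ 0 Real.pi :=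
    hφ1.contDiffOn.absolutelyContinuousOnInterval
  have hφint : IntervalIntegrable (fun x => g x * φ x + Z x * φ' x) volume 0 Real.pi :=
    (h.1.mul_continuousOn hφc.continuousOn).add
      (hZ.continuousOn.mul hφ'.continuousOn).intervalIntegrable
  have hderiv : ∀ᵐ x, x ∈ Set.uIcc 0 Real.pi → HasDerivAt
      (fun x => Z x * φ x - ∫ t in (0 : ℝ)..x, (g t * φ t + Z t * φ' t)) 0 x := by
    filter_upwards [h.1.ae_hasDerivAt_integral, hφint.ae_hasDerivAt_integral] with x hg hgφ hx
    have hZx : HasDerivAt Z (g x) x := (hg hx 0 Set.left_mem_uIcc).const_add (y 0)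
    simpa using (hZx.mul (hφ x)).fun_sub (hgφ hx 0 Set.left_mem_uIcc)
  obtain ⟨C, hC⟩ := ((hZ.fun_smul hφac).fun_sub
    (absolutelyContinuousOnInterval_integral hφint)).const_of_ae_hasDerivAt_zero hderiv
  have h0 : y 0 * φ 0 = C := by simpa [Z] using hC 0 Set.left_mem_uIcc
  have hpi := hC Real.pi Set.right_mem_uIcc
  rw [smul_eq_mul, ← hyZ ⟨Real.pi_pos.le, le_rfl⟩] at hpi
  rw [h0, ← hpi, sub_sub_cancel]
  refine intervalIntegral.integral_congr fun x hx => ?_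
  simp only [hyZ (hIcc ▸ hx)]
theorem hasDerivAt_exp_I_mul (m : ℤ) (x : ℝ) :
    HasDerivAt (fun x : ℝ => Complex.exp (-(Complex.I * m * x)))
      (-(Complex.I * m) * Complex.exp (-(Complex.I * m * x))) x := by
  have h : HasDerivAt (fun x : ℝ => -(Complex.I * m * (x : ℂ))) (-(Complex.I * m * 1)) x :=
    ((Complex.ofRealCLM.hasDerivAt (x := x)).const_mul _).neg
  simpa only [mul_one, mul_comm] using h.cexp

theorem HasL1Deriv.integral_deriv_mul_exp {y g : ℝ → ℂ} (h : HasL1Deriv y g) (m : ℤ) :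
    ∫ x in (0 : ℝ)..Real.pi, g x * Complex.exp (-(Complex.I * m * x)) =
      y Real.pi * Complex.exp (-(Complex.I * m * Real.pi)) - y 0 +
        Complex.I * m * ∫ x in (0 : ℝ)..Real.pi, y x * Complex.exp (-(Complex.I * m * x)) := by
  have hy : Integrable y intervalMeasure :=
    (memLp_of_continuousOn h.continuousOn).integrable (by norm_num)
  have hgφ := intervalIntegrable_iff_integrable.2
    (integrable_mul_exp (intervalIntegrable_iff_integrable.1 h.1) m)
  have hyφ := (intervalIntegrable_iff_integrable.2 (integrable_mul_exp hy m)).const_mul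
    (-(Complex.I * m))
  have hparts := h.integral_deriv_mul_add_mul_deriv (hasDerivAt_exp_I_mul m)
    ((continuous_exp_I_mul m).const_mul _)
  simp only [mul_left_comm (y _)] at hparts
  rw [intervalIntegral.integral_add hgφ hyφ, intervalIntegral.integral_const_mul] at hparts
  simp only [Complex.ofReal_zero, mul_zero, neg_zero, Complex.exp_zero, mul_one] at hparts
  linear_combination hparts

theorem exp_neg_I_mul_pi {n j : ℤ} (hj : Even (j - n)) :
    (-1 : ℂ) ^ n * Complex.exp (-(Complex.I * j * Real.pi)) = 1 := by
  have h1 : Complex.exp (-(Complex.I * j * Real.pi)) = (-1 : ℂ) ^ (-j) := by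
    rw [← Complex.exp_pi_mul_I, ← Complex.exp_int_mul]
    congr 1; push_cast; ring
  rw [h1, ← zpow_add₀ (by norm_num)]
  rw [show n + -j = -(j - n) by ring]
  exact Even.neg_one_zpow (even_neg.2 hj)

theorem HasL1Deriv.fourierCoeffPi_deriv {y g : ℝ → ℂ} (h : HasL1Deriv y g) {n j : ℤ}
    (hj : Even (j - n)) (hbc : y Real.pi = (-1 : ℂ) ^ n * y 0) :
    fourierCoeffPi g j = Complex.I * j * fourierCoeffPi y j := by
  rw [fourierCoeffPi, fourierCoeffPi, h.integral_deriv_mul_exp, hbc]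
  linear_combination (Real.pi : ℂ)⁻¹ * y 0 * exp_neg_I_mul_pi hj

theorem exists_primitive_const {h : ℝ → ℂ} {n : ℤ} (hh : Even n → fourierCoeffPi h 0 = 0)
    (c : ℂ) :
    ∃ C : ℂ, C + ∫ t in (0 : ℝ)..Real.pi, h t = (-1 : ℂ) ^ n * C ∧ (Even n → C = c) := by
  rcases Int.even_or_odd n with hn | hn
  · refine ⟨c, ?_, fun _ => rfl⟩
    have : ∫ t in (0 : ℝ)..Real.pi, h t = 0 := by
      simpa [fourierCoeffPi, Real.pi_ne_zero] using hh hn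
    rw [this, hn.neg_one_zpow, add_zero, one_mul]
  · refine ⟨-(∫ t in (0 : ℝ)..Real.pi, h t) / 2, by rw [hn.neg_one_zpow]; ring, fun he => ?_⟩
    exact absurd he (Int.not_even_iff_odd.2 hn)

/-- The antiderivative `C + ∫₀ˣ h` satisfies the boundary condition because of the coefficient of
`h` at `0` if `n` is even, in which case `C` is the mean value of `f - ∫₀ˣ h`, and by the choice
of `C` if `n` is odd. -/
theorem exists_hasL1Deriv {f h : ℝ → ℂ} (hf : MemLp f 2 intervalMeasure)
    (hh : Integrable h intervalMeasure) {n : ℤ}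
    (hcoef : ∀ j, Even (j - n) → fourierCoeffPi h j = Complex.I * j * fourierCoeffPi f j) :
    ∃ u : ℝ → ℂ, HasL1Deriv u h ∧ (∀ᵐ x ∂intervalMeasure, u x = f x) ∧
      u Real.pi = (-1 : ℂ) ^ n * u 0 := by
  set H : ℝ → ℂ := fun x => ∫ t in (0 : ℝ)..x, h t with hH
  have hderiv (C : ℂ) : HasL1Deriv (fun x => C + H x) h :=
    ⟨intervalIntegrable_iff_integrable.2 hh, fun x _ => by simp [hH]⟩
  obtain ⟨C, hbc, hC⟩ := exists_primitive_const (h := h) (n := n)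
    (fun hn => by simpa using hcoef 0 (by simpa using hn.neg))
    (fourierCoeffPi f 0 - fourierCoeffPi H 0)
  have hbc' : (fun x => C + H x) Real.pi = (-1 : ℂ) ^ n * (fun x => C + H x) 0 := by
    simpa [hH] using hbc
  have hu := memLp_of_continuousOn (hderiv C).continuousOn
  have hu0 : Even n → fourierCoeffPi (fun x => C + H x) 0 = fourierCoeffPi f 0 := fun hn => by
    have hHi : Integrable H intervalMeasure := by
      simpa using (memLp_of_continuousOn (hderiv 0).continuousOn).integrable (by norm_num)
    have hconst : fourierCoeffPi (fun _ => C) 0 = C := by simp [fourierCoeffPi, Real.pi_ne_zero]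
    rw [fourierCoeffPi_add (integrable_const _) hHi, hconst, hC hn, sub_add_cancel]
  have hcoeff (k : ℤ) :
      fourierCoeffPi (fun x => C + H x) (n + 2 * k) = fourierCoeffPi f (n + 2 * k) := by
    have hj : Even (n + 2 * k - n) := by simp
    rcases eq_or_ne (n + 2 * k) 0 with hz | hz
    · rw [hz, hu0 (by rw [show n = -(2 * k) by omega]; simp)]
    · refine mul_left_cancel₀ (mul_ne_zero Complex.I_ne_zero (Int.cast_ne_zero.2 hz)) ?_
      exact ((hderiv C).fourierCoeffPi_deriv hj hbc').symm.trans (hcoef _ hj)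
  refine ⟨fun x => C + H x, hderiv C, ?_, hbc'⟩
  refine (ae_eq_zero_of_fourierCoeffPi (hu.sub hf) n fun k => ?_).mono fun x => sub_eq_zero.1
  have hsub := fourierCoeffPi_sub (hu.integrable (by norm_num)) (hf.integrable (by norm_num))
    (n + 2 * k)
  rw [hcoeff, sub_self] at hsub
  exact hsub

/-- `1 / |s|`, with the value `0` at `s = 0`: the decay of the resolvents of the free operators. -/
noncomputable def invAbs (s : ℤ) : ℝ := |(s : ℝ)|⁻¹

theorem invAbs_nonneg (s : ℤ) : 0 ≤ invAbs s := inv_nonneg.2 (abs_nonneg _)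

@[simp] theorem invAbs_zero : invAbs 0 = 0 := by simp [invAbs]

theorem invAbs_neg (s : ℤ) : invAbs (-s) = invAbs s := by simp [invAbs]

theorem one_le_abs_cast {s : ℤ} (hs : s ≠ 0) : (1 : ℝ) ≤ |(s : ℝ)| := by
  exact_mod_cast Int.one_le_abs hs

theorem invAbs_le_one (s : ℤ) : invAbs s ≤ 1 := by
  rcases eq_or_ne s 0 with rfl | hs
  · simp
  · exact inv_le_one_of_one_le₀ (one_le_abs_cast hs)

theorem abs_mul_invAbs_le (s : ℤ) : |(s : ℝ)| * invAbs s ≤ 1 := by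
  rcases eq_or_ne s 0 with rfl | hs
  · simp
  · rw [invAbs, mul_inv_cancel₀ (by linarith [one_le_abs_cast hs])]

theorem abs_sub_mul_invAbs_le (x y : ℤ) :
    |((x - y : ℤ) : ℝ)| * (invAbs x * invAbs y) ≤ invAbs x + invAbs y := by
  have hx := invAbs_nonneg x
  have hy := invAbs_nonneg y
  calc |((x - y : ℤ) : ℝ)| * (invAbs x * invAbs y)
      ≤ (|(x : ℝ)| + |(y : ℝ)|) * (invAbs x * invAbs y) := by
        gcongr
        push_cast
        exact abs_sub _ _
    _ = |(x : ℝ)| * invAbs x * invAbs y + |(y : ℝ)| * invAbs y * invAbs x := by ring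
    _ ≤ 1 * invAbs y + 1 * invAbs x := by
        gcongr
        exacts [abs_mul_invAbs_le x, abs_mul_invAbs_le y]
    _ = invAbs x + invAbs y := by ring

theorem tendsto_invAbs : Tendsto invAbs cofinite (𝓝 0) := by
  have h1 : Tendsto (fun s : ℤ => |(s : ℝ)|) cofinite atTop :=
    (tendsto_norm_cocompact_atTop (E := ℝ)).comp Int.tendsto_coe_cofinite
  exact tendsto_inv_atTop_zero.comp h1

theorem summable_invAbs_sq : Summable fun s : ℤ => invAbs s ^ 2 := by
  refine (Real.summable_abs_int_rpow (b := 2) (by norm_num)).congr fun s => ?_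
  rw [Real.rpow_neg (abs_nonneg _), invAbs, inv_pow]
  simp

theorem summable_invAbs_mul_sqrt : Summable fun s : ℤ => invAbs s * √(invAbs s) := by
  refine (Real.summable_abs_int_rpow (b := 3 / 2) (by norm_num)).congr fun s => ?_
  rcases eq_or_ne s 0 with rfl | hs
  · simp [Real.zero_rpow]
  · have hs0 : 0 < |(s : ℝ)| := by linarith [one_le_abs_cast hs]
    rw [invAbs, Real.sqrt_eq_rpow, ← Real.rpow_neg_one, ← Real.rpow_mul hs0.le,
      ← Real.rpow_add hs0]
    norm_num

theorem summable_invAbs_conv (p q : ℤ) :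
    Summable fun s : ℤ => invAbs (p - s) * invAbs (q + s) := by
  have h1 : Summable fun s : ℤ => invAbs (p - s) ^ 2 :=
    (Equiv.subLeft p).summable_iff (f := fun s : ℤ => invAbs s ^ 2) |>.2 summable_invAbs_sq
  have h2 : Summable fun s : ℤ => invAbs (q + s) ^ 2 :=
    (Equiv.addLeft q).summable_iff (f := fun s : ℤ => invAbs s ^ 2) |>.2 summable_invAbs_sq
  exact (summable_mul_and_tsum_mul_le_sqrt (fun s => invAbs_nonneg _) (fun s => invAbs_nonneg _)
    h1 h2).1

/-- `∑_{s + t = u} 1 / (|s| |t|)`, the convolution square of `invAbs`. -/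
noncomputable def invConv (u : ℤ) : ℝ := ∑' s : ℤ, invAbs s * invAbs (u - s)

theorem tsum_invAbs_conv (p q : ℤ) :
    ∑' s : ℤ, invAbs (p - s) * invAbs (q + s) = invConv (p + q) := by
  rw [invConv, ← (Equiv.subLeft p).tsum_eq]
  refine tsum_congr fun s => ?_
  simp only [Equiv.subLeft_apply]
  congr 2 <;> ring

theorem invConv_nonneg (u : ℤ) : 0 ≤ invConv u :=
  tsum_nonneg fun _ => mul_nonneg (invAbs_nonneg _) (invAbs_nonneg _)

theorem invAbs_mul_le_of_abs_le {s t : ℤ} (hs : s ≠ 0) (hst : s + t ≠ 0)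
    (h : |(s : ℝ)| ≤ |(t : ℝ)|) :
    invAbs s * invAbs t ≤ 2 * √(invAbs (s + t)) * (invAbs s * √(invAbs s)) := by
  have hs1 := one_le_abs_cast hs
  have : 1 ≤ |(t : ℝ)| := hs1.trans h
  have : 1 ≤ |((s + t : ℤ) : ℝ)| := one_le_abs_cast hst
  have hanti : invAbs t ≤ invAbs s := inv_anti₀ (by linarith) h
  have hadd : |((s + t : ℤ) : ℝ)| ≤ 2 * |(t : ℝ)| := by
    push_cast
    linarith [abs_add_le (s : ℝ) t]
  have hsum : invAbs t ≤ 2 ^ 2 * invAbs (s + t) := by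
    unfold invAbs
    rw [inv_le_comm₀ (by linarith) (by positivity), mul_inv, inv_inv]
    linarith
  have hsqrt : √(invAbs t) ≤ 2 * √(invAbs (s + t)) := by
    refine (Real.sqrt_le_sqrt hsum).trans_eq ?_
    rw [Real.sqrt_mul (by norm_num), Real.sqrt_sq (by norm_num)]
  have hs0 := invAbs_nonneg s
  calc invAbs s * invAbs t = invAbs s * (√(invAbs t) * √(invAbs t)) := by
        rw [Real.mul_self_sqrt (invAbs_nonneg t)]
    _ ≤ invAbs s * (2 * √(invAbs (s + t)) * √(invAbs s)) := by gcongr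
    _ = 2 * √(invAbs (s + t)) * (invAbs s * √(invAbs s)) := by ring

theorem invAbs_mul_le {u : ℤ} (hu : u ≠ 0) (s : ℤ) :
    invAbs s * invAbs (u - s) ≤
      2 * √(invAbs u) * (invAbs s * √(invAbs s) + invAbs (u - s) * √(invAbs (u - s))) := by
  have hpos (t : ℤ) : 0 ≤ 2 * √(invAbs u) * (invAbs t * √(invAbs t)) :=
    mul_nonneg (by positivity) (mul_nonneg (invAbs_nonneg t) (Real.sqrt_nonneg _))
  rw [mul_add]
  by_cases hs : s = 0
  · rw [hs, invAbs_zero, zero_mul]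
    linarith [hpos 0, hpos (u - 0)]
  by_cases ht : u - s = 0
  · rw [ht, invAbs_zero, mul_zero]
    linarith [hpos 0, hpos s]
  rcases le_total |(s : ℝ)| |((u - s : ℤ) : ℝ)| with h | h
  · have := invAbs_mul_le_of_abs_le hs (by rwa [add_sub_cancel]) h
    rw [add_sub_cancel] at this
    linarith [hpos (u - s)]
  · have := invAbs_mul_le_of_abs_le ht (by rwa [sub_add_cancel]) h
    rw [sub_add_cancel] at this
    linarith [hpos s]

theorem exists_invConv_le : ∃ C : ℝ, ∀ u : ℤ, u ≠ 0 → invConv u ≤ C * √(invAbs u) := by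
  refine ⟨4 * ∑' s : ℤ, invAbs s * √(invAbs s), fun u hu => ?_⟩
  have hs := summable_invAbs_mul_sqrt
  have hsub : Summable fun s : ℤ => invAbs (u - s) * √(invAbs (u - s)) :=
    (Equiv.subLeft u).summable_iff (f := fun s : ℤ => invAbs s * √(invAbs s)) |>.2 hs
  have htsum : ∑' s : ℤ, invAbs (u - s) * √(invAbs (u - s)) = ∑' s : ℤ, invAbs s * √(invAbs s) :=
    (Equiv.subLeft u).tsum_eq fun s => invAbs s * √(invAbs s)
  have hmajorant := (hs.add hsub).mul_left (2 * √(invAbs u))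
  calc invConv u ≤ ∑' s, 2 * √(invAbs u) *
        (invAbs s * √(invAbs s) + invAbs (u - s) * √(invAbs (u - s))) :=
        (hmajorant.of_nonneg_of_le (fun s => mul_nonneg (invAbs_nonneg _) (invAbs_nonneg _))
          (invAbs_mul_le hu)).tsum_le_tsum (invAbs_mul_le hu) hmajorant
    _ = 4 * (∑' s : ℤ, invAbs s * √(invAbs s)) * √(invAbs u) := by
        rw [tsum_mul_left, hs.tsum_add hsub, htsum]
        ring

theorem tendsto_invConv : Tendsto invConv cofinite (𝓝 0) := by
  obtain ⟨C, hC⟩ := exists_invConv_le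
  have h1 : Tendsto (fun u => C * √(invAbs u)) cofinite (𝓝 0) := by
    have := (tendsto_invAbs.sqrt).const_mul C
    simpa using this
  refine squeeze_zero' (Eventually.of_forall invConv_nonneg) ?_ h1
  filter_upwards [(Set.finite_singleton (0 : ℤ)).compl_mem_cofinite] with u hu
  exact hC u hu

theorem exists_invConv_bound : ∃ C : ℝ, ∀ u : ℤ, invConv u ≤ C := by
  obtain ⟨C, hC⟩ := exists_invConv_le
  refine ⟨max |C| (invConv 0), fun u => ?_⟩
  rcases eq_or_ne u 0 with rfl | hu
  · exact le_max_right _ _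
  · refine ((hC u hu).trans ?_).trans (le_max_left _ _)
    have h1 : √(invAbs u) ≤ 1 := Real.sqrt_le_one.2 (invAbs_le_one u)
    calc C * √(invAbs u) ≤ |C| * √(invAbs u) := by gcongr; exact le_abs_self C
      _ ≤ |C| * 1 := by gcongr
      _ = |C| := mul_one _

theorem tendsto_two_mul_add (m : ℤ) : Tendsto (fun n : ℤ => 2 * n + m) cofinite cofinite :=
  Function.Injective.tendsto_cofinite fun a b h => by simpa using h

theorem tendsto_two_mul_sub (m : ℤ) : Tendsto (fun n : ℤ => 2 * n - m) cofinite cofinite :=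
  Function.Injective.tendsto_cofinite fun a b h => by simpa using h

theorem tendsto_weighted_tsum {κ : Type*} {l : Filter ℤ} {w : κ → ℝ} (hw : Summable w)
    (hw0 : ∀ m, 0 ≤ w m) {G : ℤ → κ → ℝ} {C : ℝ} (hG0 : ∀ n m, 0 ≤ G n m)
    (hGC : ∀ n m, G n m ≤ C) (hG : ∀ m, Tendsto (fun n => G n m) l (𝓝 0)) :
    Tendsto (fun n => ∑' m, w m * G n m) l (𝓝 0) := by
  have := tendsto_tsum_of_dominated_convergence (𝓕 := l) (f := fun n m => w m * G n m)
    (g := fun _ => (0 : ℝ)) (hw.mul_right C)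
    (fun m => by simpa using (hG m).const_mul (w m))
    (Eventually.of_forall fun n m => by
      rw [Real.norm_of_nonneg (mul_nonneg (hw0 m) (hG0 n m))]
      exact mul_le_mul_of_nonneg_left (hGC n m) (hw0 m))
  simpa using this

theorem summable_weighted {κ : Type*} {w : κ → ℝ} (hw : Summable w) (hw0 : ∀ m, 0 ≤ w m)
    {G : κ → ℝ} {C : ℝ} (hG0 : ∀ m, 0 ≤ G m) (hGC : ∀ m, G m ≤ C) :
    Summable fun m => w m * G m :=
  Summable.of_nonneg_of_le (fun m => mul_nonneg (hw0 m) (hG0 m))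
    (fun m => mul_le_mul_of_nonneg_left (hGC m) (hw0 m)) (hw.mul_right C)

theorem summable_and_tsum_le_of_equiv {κ κ' ι : Type*} {F : ι × ι → ℝ} (hF : ∀ p, 0 ≤ F p)
    (e : κ × κ' ≃ ι × ι) {w : κ → ℝ} {g : κ → κ' → ℝ} (hle : ∀ m j, F (e (m, j)) ≤ w m * g m j)
    (hg : ∀ m, Summable (g m)) (hwg : Summable fun m => w m * ∑' j, g m j) :
    Summable F ∧ ∑' p, F p ≤ ∑' m, w m * ∑' j, g m j := by
  have hrow : ∀ m, Summable fun j => F (e (m, j)) := fun m =>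
    Summable.of_nonneg_of_le (fun j => hF _) (hle m) ((hg m).mul_left _)
  have hrow_le : ∀ m, ∑' j, F (e (m, j)) ≤ w m * ∑' j, g m j := fun m => by
    rw [← tsum_mul_left]
    exact (hrow m).tsum_le_tsum (hle m) ((hg m).mul_left _)
  have hs1 : Summable fun m => ∑' j, F (e (m, j)) :=
    Summable.of_nonneg_of_le (fun m => tsum_nonneg fun j => hF _) hrow_le hwg
  have hs : Summable (F ∘ e) := (summable_prod_of_nonneg fun p => hF _).2 ⟨hrow, hs1⟩
  refine ⟨e.summable_iff.1 hs, ?_⟩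
  have hprod : ∑' p, F (e p) = ∑' m, ∑' j, F (e (m, j)) := hs.tsum_prod
  rw [← e.tsum_eq, hprod]
  exact hs1.tsum_le_tsum hrow_le hwg

theorem summable_ite_even {f : ℝ → ℂ} (hf : MemLp f 2 intervalMeasure) :
    Summable fun m : ℤ => if Even m then ‖fourierCoeffPi f m‖ ^ 2 else 0 := by
  have hinj : Function.Injective fun k : ℤ => 2 * k := fun a b h => by simpa using h
  rw [← hinj.summable_iff]
  · have := (hasSum_sq_fourierCoeffPi hf 0).summable
    simp only [zero_add] at this
    exact this.congr fun k => by simp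
  · intro m hm
    rw [if_neg]
    rintro ⟨k, rfl⟩
    exact hm ⟨k, by simp; ring⟩

/-! ### The Hill matrix -/

/-- A majorant of the reduced resolvent of `-d²/dx²` at `n² + z`, `|z| < n / 4`. -/
noncomputable def hillWeight (n j : ℤ) : ℝ :=
  if Even (j - n) then 2 * (invAbs (n - j) * invAbs (n + j)) else 0

theorem hillWeight_nonneg (n j : ℤ) : 0 ≤ hillWeight n j := by
  unfold hillWeight
  split_ifs
  · exact mul_nonneg two_pos.le (mul_nonneg (invAbs_nonneg _) (invAbs_nonneg _))
  · exact le_rfl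

theorem hillWeight_le (n j : ℤ) : hillWeight n j ≤ 2 * (invAbs (n - j) * invAbs (n + j)) := by
  unfold hillWeight
  split_ifs
  · exact le_rfl
  · exact mul_nonneg two_pos.le (mul_nonneg (invAbs_nonneg _) (invAbs_nonneg _))

theorem hillWeight_neg (n j : ℤ) : hillWeight n (-j) = hillWeight n j := by
  have : Even (-j - n) ↔ Even (j - n) := by simp [Int.even_sub]
  simp only [hillWeight, this]
  rw [sub_neg_eq_add, ← sub_eq_add_neg, mul_comm (invAbs (n + j))]

theorem hillWeight_self (n : ℤ) : hillWeight n n = 0 := by simp [hillWeight]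

theorem hillWeight_neg_self (n : ℤ) : hillWeight n (-n) = 0 := by
  rw [hillWeight_neg, hillWeight_self]

theorem le_abs_sub_mul_abs_add {n j : ℤ} (hn : 0 < n) (h1 : j ≠ n) (h2 : j ≠ -n) :
    (n : ℝ) ≤ |((n - j : ℤ) : ℝ)| * |((n + j : ℤ) : ℝ)| := by
  have hsub := one_le_abs_cast (sub_ne_zero.2 h1.symm)
  have hadd := one_le_abs_cast (s := n + j) (by omega)
  have hsum : (2 * n : ℝ) ≤ |((n - j : ℤ) : ℝ)| + |((n + j : ℤ) : ℝ)| := by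
    refine le_trans (le_of_eq ?_) ((le_abs_self _).trans (abs_add_le _ _))
    push_cast; ring
  have : (1 : ℝ) ≤ n := by exact_mod_cast hn
  nlinarith [mul_nonneg (sub_nonneg.2 hsub) (sub_nonneg.2 hadd)]

theorem half_le_norm_hillDenominator {n j : ℤ} (hn : 0 < n) (h1 : j ≠ n) (h2 : j ≠ -n) {z : ℂ}
    (hz : ‖z‖ < n / 4) :
    |((n - j : ℤ) : ℝ)| * |((n + j : ℤ) : ℝ)| / 2 ≤ ‖(n : ℂ) ^ 2 - (j : ℂ) ^ 2 + z‖ := by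
  have hge := le_abs_sub_mul_abs_add hn h1 h2
  have hfactor : ‖(n : ℂ) ^ 2 - (j : ℂ) ^ 2‖ = |((n - j : ℤ) : ℝ)| * |((n + j : ℤ) : ℝ)| := by
    rw [← abs_mul, ← Real.norm_eq_abs, ← Complex.norm_real]
    congr 1; push_cast; ring
  have htri : ‖(n : ℂ) ^ 2 - (j : ℂ) ^ 2‖ ≤ ‖(n : ℂ) ^ 2 - (j : ℂ) ^ 2 + z‖ + ‖z‖ := by
    have := norm_sub_le ((n : ℂ) ^ 2 - (j : ℂ) ^ 2 + z) z
    rwa [add_sub_cancel_right] at this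
  have : (1 : ℝ) ≤ n := by exact_mod_cast hn
  linarith

theorem half_abs_sub_mul_abs_add_pos {n j : ℤ} (hn : 0 < n) (h1 : j ≠ n) (h2 : j ≠ -n) :
    0 < |((n - j : ℤ) : ℝ)| * |((n + j : ℤ) : ℝ)| / 2 := by
  have := le_abs_sub_mul_abs_add hn h1 h2
  have : (1 : ℝ) ≤ n := by exact_mod_cast hn
  linarith

theorem norm_hillDiag_le {n : ℤ} (hn : 0 < n) {z : ℂ} (hz : ‖z‖ < n / 4) (j : ℤ) :
    ‖hillDiag n z j‖ ≤ hillWeight n j := by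
  unfold hillDiag
  split_ifs with h
  · rw [hillWeight, if_pos h.1, norm_inv]
    refine (inv_anti₀ (half_abs_sub_mul_abs_add_pos hn h.2.1 h.2.2)
      (half_le_norm_hillDenominator hn h.2.1 h.2.2 hz)).trans (le_of_eq ?_)
    rw [invAbs, invAbs, inv_div, ← mul_inv, div_eq_mul_inv]
  · simpa using hillWeight_nonneg n j

theorem hillDenominator_ne_zero {n j : ℤ} (hn : 0 < n) (h1 : j ≠ n) (h2 : j ≠ -n) {z : ℂ}
    (hz : ‖z‖ < n / 4) : (n : ℂ) ^ 2 - (j : ℂ) ^ 2 + z ≠ 0 :=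
  norm_pos_iff.1 ((half_abs_sub_mul_abs_add_pos hn h1 h2).trans_le
    (half_le_norm_hillDenominator hn h1 h2 hz))

theorem differentiableOn_hillDiag {n : ℤ} (hn : 0 < n) (j : ℤ) :
    DifferentiableOn ℂ (fun z => hillDiag n z j) (Metric.ball 0 ((n : ℝ) / 4)) := by
  unfold hillDiag
  split_ifs with h
  · refine DifferentiableOn.inv (by fun_prop) fun z hz => ?_
    exact hillDenominator_ne_zero hn h.2.1 h.2.2 (by simpa using hz)
  · exact differentiableOn_const _

/-- The squared coefficients of `Q` at the even frequencies, with `‖c‖²` at `0`: the summable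
sequence that controls the coefficients of `c + Q'`. -/
noncomputable def hillSq (c : ℂ) (Q : ℝ → ℂ) (m : ℤ) : ℝ :=
  if Even m then (if m = 0 then ‖c‖ ^ 2 else ‖fourierCoeffPi Q m‖ ^ 2) else 0

theorem hillSq_nonneg (c : ℂ) (Q : ℝ → ℂ) (m : ℤ) : 0 ≤ hillSq c Q m := by
  unfold hillSq
  split_ifs <;> positivity

theorem summable_hillSq (c : ℂ) {Q : ℝ → ℂ} (hQ : MemLp Q 2 intervalMeasure) :
    Summable (hillSq c Q) := by
  have h1 := summable_ite_even hQ
  have h2 : Summable fun m : ℤ => if m = 0 then ‖c‖ ^ 2 else 0 :=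
    (hasSum_ite_eq (0 : ℤ) (‖c‖ ^ 2)).summable
  refine Summable.of_nonneg_of_le (hillSq_nonneg c Q) (fun m => ?_) (h1.add h2)
  unfold hillSq
  split_ifs with h3 h4
  · have := sq_nonneg ‖fourierCoeffPi Q m‖
    linarith
  · simp
  · positivity
  · simp

theorem norm_hillCoeff_sq (c : ℂ) (Q : ℝ → ℂ) {m : ℤ} (hm : Even m) :
    ‖hillCoeff c Q m‖ ^ 2 = (if m = 0 then 1 else |(m : ℝ)| ^ 2) * hillSq c Q m := by
  unfold hillCoeff hillSq
  rw [if_pos hm]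
  split_ifs with h
  · simp
  · rw [norm_mul, norm_mul, Complex.norm_I, one_mul, mul_pow]
    simp

theorem even_sub_iff_of_even {n j k : ℤ} (hj : Even (j - n)) : Even (j - k) ↔ Even (k - n) := by
  grind

theorem invAbs_mul_invAbs_le_add (s t : ℤ) : invAbs s * invAbs t ≤ invAbs s + invAbs t := by
  have hs := invAbs_nonneg s
  have ht := invAbs_nonneg t
  nlinarith [invAbs_le_one t]

theorem mul_invAbs_mul_invAbs_le (n j k : ℤ) :
    (if j - k = 0 then 1 else |((j - k : ℤ) : ℝ)| ^ 2) *
        ((invAbs (n - j) * invAbs (n + j)) * (invAbs (n - k) * invAbs (n + k))) ≤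
      (invAbs (n - k) + invAbs (n - j)) * (invAbs (n + j) + invAbs (n + k)) := by
  have h₁ := invAbs_nonneg (n - k)
  have h₂ := invAbs_nonneg (n - j)
  have h₃ := invAbs_nonneg (n + k)
  have h₄ := invAbs_nonneg (n + j)
  split_ifs with h0
  · calc 1 * ((invAbs (n - j) * invAbs (n + j)) * (invAbs (n - k) * invAbs (n + k)))
        = (invAbs (n - k) * invAbs (n - j)) * (invAbs (n + j) * invAbs (n + k)) := by ring
      _ ≤ (invAbs (n - k) + invAbs (n - j)) * (invAbs (n + j) + invAbs (n + k)) := by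
        gcongr <;> exact invAbs_mul_invAbs_le_add _ _
  · have hsub := abs_sub_mul_invAbs_le (n - k) (n - j)
    have hadd := abs_sub_mul_invAbs_le (n + j) (n + k)
    rw [sub_sub_sub_cancel_left] at hsub
    rw [add_sub_add_left_eq_sub] at hadd
    calc |((j - k : ℤ) : ℝ)| ^ 2 *
          ((invAbs (n - j) * invAbs (n + j)) * (invAbs (n - k) * invAbs (n + k)))
        = (|((j - k : ℤ) : ℝ)| * (invAbs (n - k) * invAbs (n - j))) *
          (|((j - k : ℤ) : ℝ)| * (invAbs (n + j) * invAbs (n + k))) := by ring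
      _ ≤ (invAbs (n - k) + invAbs (n - j)) * (invAbs (n + j) + invAbs (n + k)) := by gcongr

theorem hillWeight_mul_hillMatrix_sq_le (c : ℂ) (Q : ℝ → ℂ) (n j k : ℤ) :
    hillWeight n j * (hillWeight n k * ‖hillMatrix c Q j k‖ ^ 2) ≤
      hillSq c Q (j - k) * (4 * ((invAbs (n - k) + invAbs (n - j)) *
        (invAbs (n + j) + invAbs (n + k)))) := by
  have hsq := hillSq_nonneg c Q (j - k)
  have hrhs : 0 ≤ hillSq c Q (j - k) * (4 * ((invAbs (n - k) + invAbs (n - j)) *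
      (invAbs (n + j) + invAbs (n + k)))) := by
    have := invAbs_nonneg
    exact mul_nonneg hsq (mul_nonneg four_pos.le (mul_nonneg (add_nonneg (this _) (this _))
      (add_nonneg (this _) (this _))))
  by_cases hj : Even (j - n)
  swap
  · rwa [hillWeight, if_neg hj, zero_mul]
  by_cases hk : Even (k - n)
  swap
  · rwa [hillWeight, hillWeight, if_neg hk, zero_mul, mul_zero]
  rw [hillWeight, hillWeight, if_pos hj, if_pos hk, hillMatrix,
    norm_hillCoeff_sq c Q ((even_sub_iff_of_even hj).2 hk)]
  linarith [mul_le_mul_of_nonneg_left (mul_invAbs_mul_invAbs_le n j k) hsq]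

/-- Indexes the entries of a matrix by the diagonal `m` and the row `j`. -/
def subEquiv : ℤ × ℤ ≃ ℤ × ℤ where
  toFun p := (p.2, p.2 - p.1)
  invFun p := (p.1 - p.2, p.1)
  left_inv p := by simp
  right_inv p := by simp

/-- The sum over `j` of the weight of `hillSq c Q m` in the Hilbert–Schmidt norm of the entries
`(j, j - m)` of the Hill matrix. -/
noncomputable def hillConv (n m : ℤ) : ℝ :=
  4 * (invConv (2 * n + m) + invConv (2 * n - m) + 2 * invConv (2 * n))

theorem hillConv_nonneg (n m : ℤ) : 0 ≤ hillConv n m := by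
  unfold hillConv
  linarith [invConv_nonneg (2 * n + m), invConv_nonneg (2 * n - m), invConv_nonneg (2 * n)]

theorem exists_hillConv_le : ∃ C : ℝ, ∀ n m : ℤ, hillConv n m ≤ C := by
  obtain ⟨C, hC⟩ := exists_invConv_bound
  refine ⟨4 * (C + C + 2 * C), fun n m => ?_⟩
  unfold hillConv
  linarith [hC (2 * n + m), hC (2 * n - m), hC (2 * n)]

theorem tendsto_hillConv (m : ℤ) : Tendsto (fun n => hillConv n m) cofinite (𝓝 0) := by
  have hadd := tendsto_invConv.comp (tendsto_two_mul_add m)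
  have hsub := tendsto_invConv.comp (tendsto_two_mul_sub m)
  have hzero := tendsto_invConv.comp (tendsto_two_mul_add 0)
  simpa [hillConv] using ((hadd.add hsub).add (hzero.const_mul 2)).const_mul 4

theorem hasSum_hillConv (n m : ℤ) :
    HasSum (fun j => 4 * ((invAbs (n - (j - m)) + invAbs (n - j)) *
      (invAbs (n + j) + invAbs (n + (j - m))))) (hillConv n m) := by
  have hconv (p q : ℤ) :
      HasSum (fun j : ℤ => invAbs (p - j) * invAbs (q + j)) (invConv (p + q)) := by
    rw [← tsum_invAbs_conv]
    exact (summable_invAbs_conv p q).hasSum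
  have hsum := (((hconv (n + m) n).add (hconv n (n - m))).add
    ((hconv (n + m) (n - m)).add (hconv n n))).mul_left 4
  rw [show n + m + n = 2 * n + m by ring, show n + (n - m) = 2 * n - m by ring,
    show n + m + (n - m) = 2 * n by ring, show n + n = 2 * n by ring,
    ← two_mul (invConv (2 * n))] at hsum
  refine hsum.congr_fun fun j => ?_
  rw [show n - (j - m) = n + m - j by ring, show n + (j - m) = n - m + j by ring]
  ring

theorem summable_hillSq_mul_hillConv (c : ℂ) {Q : ℝ → ℂ} (hQ : MemLp Q 2 intervalMeasure)
    (n : ℤ) : Summable fun m => hillSq c Q m * hillConv n m := by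
  obtain ⟨C, hC⟩ := exists_hillConv_le
  exact summable_weighted (summable_hillSq c hQ) (hillSq_nonneg c Q) (hillConv_nonneg n) (hC n)

theorem tendsto_tsum_hillSq_mul_hillConv (c : ℂ) {Q : ℝ → ℂ} (hQ : MemLp Q 2 intervalMeasure) :
    Tendsto (fun n : ℤ => ∑' m, hillSq c Q m * hillConv n m) cofinite (𝓝 0) := by
  obtain ⟨C, hC⟩ := exists_hillConv_le
  exact tendsto_weighted_tsum (summable_hillSq c hQ) (hillSq_nonneg c Q) hillConv_nonneg hC
    tendsto_hillConv

theorem eventually_isHSContraction_hill (c : ℂ) {Q : ℝ → ℂ} (hQ : MemLp Q 2 intervalMeasure) :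
    ∀ᶠ n : ℤ in cofinite, IsHSContraction (hillMatrix c Q) (hillWeight n) (1 / 2) := by
  filter_upwards [(tendsto_tsum_hillSq_mul_hillConv c hQ).eventually_le_const
    (show (0 : ℝ) < (1 / 2) ^ 2 by norm_num)] with n hn
  have hwg : Summable fun m => hillSq c Q m * ∑' j, 4 * ((invAbs (n - (j - m)) + invAbs (n - j)) *
      (invAbs (n + j) + invAbs (n + (j - m)))) := by
    simpa only [(hasSum_hillConv n _).tsum_eq] using summable_hillSq_mul_hillConv c hQ n
  obtain ⟨hsum, hle⟩ := summable_and_tsum_le_of_equiv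
    (F := fun p : ℤ × ℤ => hillWeight n p.1 * (hillWeight n p.2 * ‖hillMatrix c Q p.1 p.2‖ ^ 2))
    (fun p => mul_nonneg (hillWeight_nonneg _ _) (mul_nonneg (hillWeight_nonneg _ _)
      (sq_nonneg _))) subEquiv
    (fun m j => by simpa [subEquiv] using hillWeight_mul_hillMatrix_sq_le c Q n j (j - m))
    (fun m => (hasSum_hillConv n m).summable) hwg
  simp only [(hasSum_hillConv n _).tsum_eq] at hle
  exact .of_prod (hillWeight_nonneg n) (by norm_num) (by norm_num) hsum (hle.trans hn)

/-- The weight of `hillSq c Q m` in the energies, divided by `n`, of the rows and columns `n` and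
`-n` of the Hill matrix. -/
noncomputable def hillDecay (n m : ℤ) : ℝ :=
  4 * (invAbs (2 * n + m) + invAbs (2 * n - m) + invAbs n)

theorem hillDecay_nonneg (n m : ℤ) : 0 ≤ hillDecay n m := by
  unfold hillDecay
  linarith [invAbs_nonneg (2 * n + m), invAbs_nonneg (2 * n - m), invAbs_nonneg n]

theorem hillDecay_le (n m : ℤ) : hillDecay n m ≤ 12 := by
  unfold hillDecay
  linarith [invAbs_le_one (2 * n + m), invAbs_le_one (2 * n - m), invAbs_le_one n]

theorem tendsto_hillDecay (m : ℤ) : Tendsto (fun n => hillDecay n m) cofinite (𝓝 0) := by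
  have hadd := tendsto_invAbs.comp (tendsto_two_mul_add m)
  have hsub := tendsto_invAbs.comp (tendsto_two_mul_sub m)
  simpa [hillDecay] using ((hadd.add hsub).add tendsto_invAbs).const_mul 4

theorem tendsto_tsum_hillSq_mul_hillDecay (c : ℂ) {Q : ℝ → ℂ}
    (hQ : MemLp Q 2 intervalMeasure) :
    Tendsto (fun n : ℤ => ∑' m, hillSq c Q m * hillDecay n m) cofinite (𝓝 0) :=
  tendsto_weighted_tsum (summable_hillSq c hQ) (hillSq_nonneg c Q) hillDecay_nonneg hillDecay_le
    tendsto_hillDecay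

theorem invAbs_mul_self {n : ℤ} (hn : 0 < n) : invAbs n * n = 1 := by
  have : (0 : ℝ) < n := by exact_mod_cast hn
  rw [invAbs, abs_of_pos this, inv_mul_cancel₀ this.ne']

theorem abs_mul_invAbs_shift_le {n m s : ℤ} (hs : |m| ≤ 2 * n + |s|) :
    |(m : ℝ)| * invAbs s ≤ 2 * n * invAbs s + 1 := by
  have hs' : |(m : ℝ)| ≤ 2 * n + |(s : ℝ)| := by exact_mod_cast hs
  have hs0 := invAbs_nonneg s
  calc |(m : ℝ)| * invAbs s ≤ (2 * n + |(s : ℝ)|) * invAbs s := by gcongr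
    _ = 2 * n * invAbs s + |(s : ℝ)| * invAbs s := by ring
    _ ≤ 2 * n * invAbs s + 1 := by gcongr; exact abs_mul_invAbs_le s

/-- The indices `j` at distance `|m|` from `n` or from `-n`, that is the indices of the entries with
coefficient `hillCoeff c Q (±m)` in the rows and columns `n` and `-n` of the Hill matrix. -/
def IsHillShift (n m j : ℤ) : Prop := j = n + m ∨ j = n - m ∨ j = -n + m ∨ j = -n - m

theorem IsHillShift.hillWeight_le {n m j : ℤ} (h : IsHillShift n m j) :
    hillWeight n j ≤ 2 * (invAbs m * (invAbs (2 * n + m) + invAbs (2 * n - m))) := by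
  have hm := invAbs_nonneg m
  have hadd := mul_nonneg hm (invAbs_nonneg (2 * n + m))
  have hsub := mul_nonneg hm (invAbs_nonneg (2 * n - m))
  have key : invAbs (n - j) * invAbs (n + j) = invAbs m * invAbs (2 * n + m) ∨
      invAbs (n - j) * invAbs (n + j) = invAbs m * invAbs (2 * n - m) := by
    rcases h with rfl | rfl | rfl | rfl
    · left; rw [← invAbs_neg m]; congr 2 <;> ring
    · right; congr 2 <;> ring
    · right; rw [mul_comm]; congr 2 <;> ring
    · left; rw [← invAbs_neg m, mul_comm]; congr 2 <;> ring
  refine (SpectralGap.hillWeight_le n j).trans ?_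
  rcases key with h | h <;> rw [h] <;> linarith

theorem IsHillShift.hillWeight_mul_sq_le {n m j : ℤ} (h : IsHillShift n m j) (hn : 0 < n) (c : ℂ)
    (Q : ℝ → ℂ) :
    hillWeight n j * ‖hillCoeff c Q m‖ ^ 2 ≤ hillSq c Q m * hillDecay n m * n := by
  have hsq := hillSq_nonneg c Q m
  have hn' : (0 : ℝ) < n := by exact_mod_cast hn
  have hrhs : 0 ≤ hillSq c Q m * hillDecay n m * n :=
    mul_nonneg (mul_nonneg hsq (hillDecay_nonneg n m)) hn'.le
  by_cases hj : Even (j - n)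
  swap
  · rwa [hillWeight, if_neg hj, zero_mul]
  have hm : Even m := by rcases h with rfl | rfl | rfl | rfl <;> grind
  rw [norm_hillCoeff_sq c Q hm]
  have hw := h.hillWeight_le
  split_ifs with h0
  · rw [h0, invAbs_zero, zero_mul, mul_zero] at hw
    rw [hw.antisymm (hillWeight_nonneg n j), zero_mul]
    exact hrhs
  have hadd := abs_mul_invAbs_shift_le (n := n) (m := m) (s := 2 * n + m) (by grind)
  have hsub := abs_mul_invAbs_shift_le (n := n) (m := m) (s := 2 * n - m) (by grind)
  have hA := invAbs_nonneg (2 * n + m)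
  have hB := invAbs_nonneg (2 * n - m)
  calc hillWeight n j * (|(m : ℝ)| ^ 2 * hillSq c Q m)
      ≤ 2 * (invAbs m * (invAbs (2 * n + m) + invAbs (2 * n - m))) *
        (|(m : ℝ)| ^ 2 * hillSq c Q m) := by gcongr
    _ = 2 * (|(m : ℝ)| * invAbs m) * (|(m : ℝ)| * invAbs (2 * n + m) +
        |(m : ℝ)| * invAbs (2 * n - m)) * hillSq c Q m := by ring
    _ ≤ 2 * 1 * (2 * n * invAbs (2 * n + m) + 1 + (2 * n * invAbs (2 * n - m) + 1)) *
        hillSq c Q m := by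
      gcongr
      exact abs_mul_invAbs_le m
    _ = hillSq c Q m * (4 * (invAbs (2 * n + m) + invAbs (2 * n - m)) * n +
        4 * (invAbs n * n)) := by rw [invAbs_mul_self hn]; ring
    _ = hillSq c Q m * hillDecay n m * n := by rw [hillDecay]; ring

theorem hill_energy_le (c : ℂ) {Q : ℝ → ℂ} (hQ : MemLp Q 2 intervalMeasure) {n : ℤ} (hn : 0 < n)
    (e : ℤ ≃ ℤ) (he : ∀ m, IsHillShift n m (e m)) {f : ℤ → ℂ}
    (hf : ∀ m, f (e m) = hillCoeff c Q m) :
    WSummable (hillWeight n) f ∧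
      energy (hillWeight n) f ≤ (∑' m, hillSq c Q m * hillDecay n m) * n := by
  have hle (m : ℤ) :
      hillWeight n (e m) * ‖f (e m)‖ ^ 2 ≤ hillSq c Q m * hillDecay n m * n := by
    rw [hf]
    exact (he m).hillWeight_mul_sq_le hn c Q
  have hmajorant : Summable fun m => hillSq c Q m * hillDecay n m * n :=
    (summable_weighted (summable_hillSq c hQ) (hillSq_nonneg c Q) (hillDecay_nonneg n)
      (hillDecay_le n)).mul_right _
  have hsum : Summable fun m => hillWeight n (e m) * ‖f (e m)‖ ^ 2 :=
    hmajorant.of_nonneg_of_le (fun m => mul_nonneg (hillWeight_nonneg _ _) (sq_nonneg _)) hle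
  refine ⟨e.summable_iff.1 hsum, ?_⟩
  rw [energy, ← e.tsum_eq, ← tsum_mul_right]
  exact hsum.tsum_le_tsum hle hmajorant

theorem hill_row_energy_le (c : ℂ) {Q : ℝ → ℂ} (hQ : MemLp Q 2 intervalMeasure) {n x : ℤ}
    (hn : 0 < n) (hx : x = -n ∨ x = n) :
    WSummable (hillWeight n) (hillMatrix c Q x) ∧
      energy (hillWeight n) (hillMatrix c Q x) ≤ (∑' m, hillSq c Q m * hillDecay n m) * n :=
  hill_energy_le c hQ hn (Equiv.subLeft x)
    (fun m => by rcases hx with rfl | rfl <;> simp [IsHillShift]) fun m => by simp [hillMatrix]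

theorem hill_col_energy_le (c : ℂ) {Q : ℝ → ℂ} (hQ : MemLp Q 2 intervalMeasure) {n x : ℤ}
    (hn : 0 < n) (hx : x = -n ∨ x = n) :
    WSummable (hillWeight n) (fun j => hillMatrix c Q j x) ∧
      energy (hillWeight n) (fun j => hillMatrix c Q j x) ≤
        (∑' m, hillSq c Q m * hillDecay n m) * n :=
  hill_energy_le c hQ hn (Equiv.addLeft x)
    (fun m => by rcases hx with rfl | rfl <;> simp [IsHillShift]) fun m => by simp [hillMatrix]

theorem norm_hillCoeff_eq (c : ℂ) (Q : ℝ → ℂ) {m : ℤ} (hm : Even m) (hm0 : m ≠ 0) :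
    ‖hillCoeff c Q m‖ = |(m : ℝ)| * √(hillSq c Q m) := by
  rw [← Real.sqrt_sq (norm_nonneg (hillCoeff c Q m)), norm_hillCoeff_sq c Q hm, if_neg hm0,
    Real.sqrt_mul (sq_nonneg _), Real.sqrt_sq (abs_nonneg _)]

theorem eventually_norm_hillCoeff_le (c : ℂ) {Q : ℝ → ℂ} (hQ : MemLp Q 2 intervalMeasure)
    {ε : ℝ} (hε : 0 < ε) :
    ∀ᶠ n : ℤ in cofinite, 0 < n → ∀ m, m = 0 ∨ m = 2 * n ∨ m = -(2 * n) →
      ‖hillCoeff c Q m‖ ≤ ε * n := by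
  have hconst : Tendsto (fun n : ℤ => ‖c‖ * invAbs n) cofinite (𝓝 0) := by
    simpa using tendsto_invAbs.const_mul ‖c‖
  have hsqrt : ∀ᶠ m : ℤ in cofinite, √(hillSq c Q m) ≤ ε / 2 := by
    have := (summable_hillSq c hQ).tendsto_cofinite_zero.sqrt
    rw [Real.sqrt_zero] at this
    exact this.eventually_le_const (half_pos hε)
  have hinj : Function.Injective fun n : ℤ => 2 * n := fun a b h => by simpa using h
  filter_upwards [hconst.eventually_le_const hε, hinj.tendsto_cofinite.eventually hsqrt,
    (neg_injective.comp hinj).tendsto_cofinite.eventually hsqrt] with n hc hpos hneg hn m hm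
  have hn' : (0 : ℝ) < n := by exact_mod_cast hn
  have habs : |((2 * n : ℤ) : ℝ)| = 2 * n := by
    push_cast
    exact abs_of_pos (by positivity)
  rcases hm with rfl | rfl | rfl
  · calc ‖hillCoeff c Q 0‖ = ‖c‖ * invAbs n * n := by
          rw [hillCoeff, if_pos rfl, mul_assoc, invAbs_mul_self hn, mul_one]
      _ ≤ ε * n := by gcongr
  · rw [norm_hillCoeff_eq c Q (by simp) (by omega), habs]
    nlinarith
  · rw [norm_hillCoeff_eq c Q (by simp) (by omega), Int.cast_neg, abs_neg, habs]
    simp only [Function.comp_apply] at hneg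
    nlinarith

theorem eventually_isModelPair_hill (c : ℂ) {Q : ℝ → ℂ} (hQ : MemLp Q 2 intervalMeasure) {ε : ℝ}
    (hε : 0 < ε) :
    ∀ᶠ n : ℤ in cofinite, 0 < n →
      IsModelPair (hillMatrix c Q) (hillWeight n) (-n) n (ε * n) := by
  filter_upwards [eventually_isHSContraction_hill c hQ,
    (tendsto_tsum_hillSq_mul_hillDecay c hQ).eventually_le_const hε,
    eventually_norm_hillCoeff_le c hQ hε] with n hcontraction henergy hcoeff hn
  have : (0 : ℝ) < n := by exact_mod_cast hn
  exact {
    contraction := hcontraction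
    ne := by omega
    weight_left := hillWeight_neg_self n
    weight_right := hillWeight_self n
    row x hx := (hill_row_energy_le c hQ hn hx).imp_right (·.trans (by gcongr))
    col x hx := (hill_col_energy_le c hQ hn hx).imp_right (·.trans (by gcongr))
    entry x y hx hy := hcoeff hn (x - y) (by grind) }

/-! ### The Dirac matrix -/

/-- A majorant of the reduced resolvent of the free Dirac operator at `n + z`, `|z| < 1 / 2`. -/
noncomputable def diracWeight (n : ℤ) (a : Bool × ℤ) : ℝ :=
  if Even (a.2 - n) then 2 * invAbs (n - a.2) else 0

theorem diracWeight_nonneg (n : ℤ) (a : Bool × ℤ) : 0 ≤ diracWeight n a := by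
  unfold diracWeight
  split_ifs
  · exact mul_nonneg two_pos.le (invAbs_nonneg _)
  · exact le_rfl

theorem half_le_norm_diracDenominator {n j : ℤ} (h : j ≠ n) {z : ℂ} (hz : ‖z‖ < 1 / 2) :
    |((n - j : ℤ) : ℝ)| / 2 ≤ ‖(n : ℂ) - (j : ℂ) + z‖ := by
  have hone := one_le_abs_cast (sub_ne_zero.2 h.symm)
  have habs : ‖(n : ℂ) - (j : ℂ)‖ = |((n - j : ℤ) : ℝ)| := by
    rw [← Real.norm_eq_abs, ← Complex.norm_real]
    congr 1; push_cast; ring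
  have htri := norm_sub_le ((n : ℂ) - (j : ℂ) + z) z
  rw [add_sub_cancel_right] at htri
  linarith

theorem half_abs_sub_pos {n j : ℤ} (h : j ≠ n) : 0 < |((n - j : ℤ) : ℝ)| / 2 := by
  linarith [one_le_abs_cast (sub_ne_zero.2 h.symm)]

theorem diracDenominator_ne_zero {n j : ℤ} (h : j ≠ n) {z : ℂ} (hz : ‖z‖ < 1 / 2) :
    (n : ℂ) - (j : ℂ) + z ≠ 0 :=
  norm_pos_iff.1 ((half_abs_sub_pos h).trans_le (half_le_norm_diracDenominator h hz))

theorem norm_diracDiag_le (n : ℤ) {z : ℂ} (hz : ‖z‖ < 1 / 2) (a : Bool × ℤ) :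
    ‖diracDiag n z a‖ ≤ diracWeight n a := by
  unfold diracDiag
  split_ifs with h
  · rw [diracWeight, if_pos h.1, norm_inv]
    refine (inv_anti₀ (half_abs_sub_pos h.2) (half_le_norm_diracDenominator h.2 hz)).trans
      (le_of_eq ?_)
    rw [invAbs, inv_div, div_eq_mul_inv]
  · simpa using diracWeight_nonneg n a

theorem differentiableOn_diracDiag (n : ℤ) (a : Bool × ℤ) :
    DifferentiableOn ℂ (fun z => diracDiag n z a) (Metric.ball 0 (1 / 2)) := by
  unfold diracDiag
  split_ifs with h
  · refine DifferentiableOn.inv (by fun_prop) fun z hz => ?_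
    exact diracDenominator_ne_zero h.2 (by simpa using hz)
  · exact differentiableOn_const _

/-- The squared coefficients of `P` and `Q` at the even frequencies, arranged so that the block
`(s, t)` of the Dirac matrix depends on the sum `m` of the indices only. -/
noncomputable def diracSq (P Q : ℝ → ℂ) : Bool × Bool × ℤ → ℝ
  | (false, true, m) => if Even (-m) then ‖fourierCoeffPi P (-m)‖ ^ 2 else 0
  | (true, false, m) => if Even m then ‖fourierCoeffPi Q m‖ ^ 2 else 0
  | (false, false, _) => 0
  | (true, true, _) => 0

theorem diracSq_nonneg (P Q : ℝ → ℂ) (x : Bool × Bool × ℤ) : 0 ≤ diracSq P Q x := by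
  obtain ⟨_ | _, _ | _, m⟩ := x <;> simp only [diracSq, le_refl] <;> split_ifs <;> positivity

theorem norm_diracMatrix_sq (P Q : ℝ → ℂ) {s t : Bool} {k j : ℤ} (h : Even (k + j)) :
    ‖diracMatrix P Q (s, k) (t, j)‖ ^ 2 = diracSq P Q (s, t, k + j) := by
  cases s <;> cases t
  · simp [diracMatrix, diracSq]
  · rw [diracMatrix, diracSq, if_pos h.neg, neg_add']
  · rw [diracMatrix, diracSq, if_pos h]
  · simp [diracMatrix, diracSq]

theorem summable_bool_prod {κ : Type*} {f : Bool × κ → ℝ} (hf : ∀ p, 0 ≤ f p)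
    (h : ∀ s, Summable fun k => f (s, k)) : Summable f :=
  (summable_prod_of_nonneg hf).2 ⟨h, Summable.of_finite⟩

theorem even_add_of_even_sub {n k j : ℤ} (hk : Even (k - n)) (hj : Even (j - n)) :
    Even (k + j) := by
  grind

theorem diracWeight_mul_diracMatrix_sq_le (P Q : ℝ → ℂ) (n : ℤ) (s t : Bool) (k j : ℤ) :
    diracWeight n (s, k) * (diracWeight n (t, j) * ‖diracMatrix P Q (s, k) (t, j)‖ ^ 2) ≤
      diracSq P Q (s, t, k + j) * (4 * (invAbs (n - k) * invAbs (n - j))) := by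
  have hrhs : 0 ≤ diracSq P Q (s, t, k + j) * (4 * (invAbs (n - k) * invAbs (n - j))) :=
    mul_nonneg (diracSq_nonneg P Q _)
      (mul_nonneg four_pos.le (mul_nonneg (invAbs_nonneg _) (invAbs_nonneg _)))
  by_cases hk : Even (k - n)
  swap
  · rwa [diracWeight, if_neg hk, zero_mul]
  by_cases hj : Even (j - n)
  swap
  · rwa [diracWeight, diracWeight, if_neg hj, zero_mul, mul_zero]
  rw [norm_diracMatrix_sq P Q (even_add_of_even_sub hk hj), diracWeight, diracWeight, if_pos hk,
    if_pos hj]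
  exact le_of_eq (by ring)

/-- Indexes the entries of a block matrix by the block `(s, t)`, the antidiagonal `m` and the row
`k` within the block. -/
def addEquiv : (Bool × Bool × ℤ) × ℤ ≃ (Bool × ℤ) × (Bool × ℤ) where
  toFun p := ((p.1.1, p.2), (p.1.2.1, p.1.2.2 - p.2))
  invFun p := ((p.1.1, p.2.1, p.1.2 + p.2.2), p.1.2)
  left_inv p := by simp
  right_inv p := by simp

theorem hasSum_invAbs_sub_mul_invAbs_sub (n m : ℤ) :
    HasSum (fun k => invAbs (n - k) * invAbs (n - (m - k))) (invConv (2 * n - m)) := by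
  have h := (summable_invAbs_conv n (n - m)).hasSum
  rw [tsum_invAbs_conv, show n + (n - m) = 2 * n - m by ring] at h
  exact h.congr_fun fun k => by rw [show n - (m - k) = n - m + k by ring]

section Potentials

variable {P Q : ℝ → ℂ} (hP : MemLp P 2 intervalMeasure) (hQ : MemLp Q 2 intervalMeasure)
include hP hQ

theorem summable_diracSq_block (s t : Bool) : Summable fun m => diracSq P Q (s, t, m) := by
  cases s <;> cases t
  · exact summable_zero
  · exact (Equiv.neg ℤ).summable_iff (f := fun m : ℤ =>
      if Even m then ‖fourierCoeffPi P m‖ ^ 2 else 0) |>.2 (summable_ite_even hP)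
  · exact summable_ite_even hQ
  · exact summable_zero

theorem summable_diracSq : Summable (diracSq P Q) :=
  summable_bool_prod (diracSq_nonneg P Q) fun s =>
    summable_bool_prod (fun _ => diracSq_nonneg P Q _) fun t => summable_diracSq_block hP hQ s t

theorem summable_diracSq_mul_invConv (n : ℤ) :
    Summable fun x => diracSq P Q x * (4 * invConv (2 * n - x.2.2)) := by
  obtain ⟨C, hC⟩ := exists_invConv_bound
  exact summable_weighted (summable_diracSq hP hQ) (diracSq_nonneg P Q) (C := 4 * C)
    (fun x => by linarith [invConv_nonneg (2 * n - x.2.2)])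
    (fun x => by linarith [hC (2 * n - x.2.2)])

theorem tendsto_tsum_diracSq_mul_invConv :
    Tendsto (fun n : ℤ => ∑' x, diracSq P Q x * (4 * invConv (2 * n - x.2.2))) cofinite
      (𝓝 0) := by
  obtain ⟨C, hC⟩ := exists_invConv_bound
  refine tendsto_weighted_tsum (summable_diracSq hP hQ) (diracSq_nonneg P Q)
    (C := 4 * C) (fun n x => ?_) (fun n x => ?_) fun x => ?_
  · linarith [invConv_nonneg (2 * n - x.2.2)]
  · linarith [hC (2 * n - x.2.2)]
  · simpa using (tendsto_invConv.comp (tendsto_two_mul_sub x.2.2)).const_mul 4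

theorem eventually_isHSContraction_dirac :
    ∀ᶠ n : ℤ in cofinite, IsHSContraction (diracMatrix P Q) (diracWeight n) (1 / 2) := by
  filter_upwards [(tendsto_tsum_diracSq_mul_invConv hP hQ).eventually_le_const
    (show (0 : ℝ) < (1 / 2) ^ 2 by norm_num)] with n hn
  have hconv (x : Bool × Bool × ℤ) :
      HasSum (fun k => 4 * (invAbs (n - k) * invAbs (n - (x.2.2 - k))))
        (4 * invConv (2 * n - x.2.2)) :=
    (hasSum_invAbs_sub_mul_invAbs_sub n x.2.2).mul_left 4
  have hwg : Summable fun x => diracSq P Q x *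
      ∑' k, 4 * (invAbs (n - k) * invAbs (n - (x.2.2 - k))) := by
    simpa only [(hconv _).tsum_eq] using summable_diracSq_mul_invConv hP hQ n
  obtain ⟨hsum, hle⟩ := summable_and_tsum_le_of_equiv
    (F := fun p : (Bool × ℤ) × (Bool × ℤ) =>
      diracWeight n p.1 * (diracWeight n p.2 * ‖diracMatrix P Q p.1 p.2‖ ^ 2))
    (fun p => mul_nonneg (diracWeight_nonneg _ _) (mul_nonneg (diracWeight_nonneg _ _)
      (sq_nonneg _))) addEquiv
    (fun x k => by
      simpa [addEquiv] using
        diracWeight_mul_diracMatrix_sq_le P Q n x.1 x.2.1 k (x.2.2 - k))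
    (fun x => (hconv x).summable) hwg
  simp only [(hconv _).tsum_eq] at hle
  exact .of_prod (diracWeight_nonneg n) (by norm_num) (by norm_num) hsum (hle.trans hn)

theorem summable_diracSq_comp (σ : Bool → Bool × Bool) :
    Summable fun p : Bool × ℤ => diracSq P Q ((σ p.1).1, (σ p.1).2, p.2) :=
  summable_bool_prod (fun p => diracSq_nonneg P Q ((σ p.1).1, (σ p.1).2, p.2)) fun s =>
    summable_diracSq_block hP hQ (σ s).1 (σ s).2

theorem tendsto_tsum_diracSq_mul_invAbs (σ : Bool → Bool × Bool) :
    Tendsto (fun n : ℤ => ∑' p : Bool × ℤ,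
      diracSq P Q ((σ p.1).1, (σ p.1).2, p.2) * (2 * invAbs (2 * n - p.2))) cofinite (𝓝 0) := by
  refine tendsto_weighted_tsum (summable_diracSq_comp hP hQ σ)
    (fun p => diracSq_nonneg P Q ((σ p.1).1, (σ p.1).2, p.2)) (C := 2)
    (G := fun n p => 2 * invAbs (2 * n - p.2))
    (fun n p => by linarith [invAbs_nonneg (2 * n - p.2)])
    (fun n p => by linarith [invAbs_le_one (2 * n - p.2)]) fun p => ?_
  simpa using (tendsto_invAbs.comp (tendsto_two_mul_sub p.2)).const_mul 2

theorem dirac_energy_le (n : ℤ) (σ : Bool → Bool × Bool) {f : Bool × ℤ → ℂ}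
    (hf : ∀ s k, Even (k - n) → ‖f (s, k)‖ ^ 2 = diracSq P Q ((σ s).1, (σ s).2, k + n)) :
    WSummable (diracWeight n) f ∧ energy (diracWeight n) f ≤
      ∑' p : Bool × ℤ, diracSq P Q ((σ p.1).1, (σ p.1).2, p.2) * (2 * invAbs (2 * n - p.2)) := by
  set shift : Bool × ℤ ≃ Bool × ℤ := (Equiv.refl Bool).prodCongr (Equiv.subRight n)
  have hle (p : Bool × ℤ) : diracWeight n (shift p) * ‖f (shift p)‖ ^ 2 ≤
      diracSq P Q ((σ p.1).1, (σ p.1).2, p.2) * (2 * invAbs (2 * n - p.2)) := by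
    obtain ⟨s, m⟩ := p
    have hrhs := mul_nonneg (diracSq_nonneg P Q ((σ s).1, (σ s).2, m))
      (mul_nonneg two_pos.le (invAbs_nonneg (2 * n - m)))
    rw [show shift (s, m) = (s, m - n) from rfl]
    by_cases hm : Even (m - n - n)
    · rw [diracWeight, if_pos hm, hf s _ hm, sub_add_cancel,
        show n - (m - n) = 2 * n - m by ring, mul_comm]
    · rwa [diracWeight, if_neg hm, zero_mul]
  have hmajorant := summable_weighted (summable_diracSq_comp hP hQ σ)
    (fun p => diracSq_nonneg P Q ((σ p.1).1, (σ p.1).2, p.2)) (C := 2)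
    (G := fun p => 2 * invAbs (2 * n - p.2)) (fun p => by linarith [invAbs_nonneg (2 * n - p.2)])
    (fun p => by linarith [invAbs_le_one (2 * n - p.2)])
  have hsum : Summable fun p => diracWeight n (shift p) * ‖f (shift p)‖ ^ 2 :=
    hmajorant.of_nonneg_of_le (fun m => mul_nonneg (diracWeight_nonneg _ _) (sq_nonneg _)) hle
  refine ⟨shift.summable_iff.1 hsum, ?_⟩
  rw [energy, ← shift.tsum_eq]
  exact hsum.tsum_le_tsum hle hmajorant

theorem eventually_dirac_row_energy_le {ε : ℝ} (hε : 0 < ε) (t : Bool) :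
    ∀ᶠ n : ℤ in cofinite, WSummable (diracWeight n) (diracMatrix P Q (t, n)) ∧
      energy (diracWeight n) (diracMatrix P Q (t, n)) ≤ ε := by
  filter_upwards [(tendsto_tsum_diracSq_mul_invAbs hP hQ fun s => (t, s)).eventually_le_const hε]
    with n hn
  refine (dirac_energy_le hP hQ n (fun s => (t, s)) fun s k hk => ?_).imp_right (·.trans hn)
  rw [norm_diracMatrix_sq P Q (even_add_of_even_sub (by simp) hk), add_comm n k]

theorem eventually_dirac_col_energy_le {ε : ℝ} (hε : 0 < ε) (t : Bool) :
    ∀ᶠ n : ℤ in cofinite, WSummable (diracWeight n) (fun a => diracMatrix P Q a (t, n)) ∧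
      energy (diracWeight n) (fun a => diracMatrix P Q a (t, n)) ≤ ε := by
  filter_upwards [(tendsto_tsum_diracSq_mul_invAbs hP hQ fun s => (s, t)).eventually_le_const hε]
    with n hn
  exact (dirac_energy_le hP hQ n (fun s => (s, t)) fun s k hk =>
    norm_diracMatrix_sq P Q (even_add_of_even_sub hk (by simp))).imp_right (·.trans hn)

theorem eventually_norm_diracMatrix_le {ε : ℝ} (hε : 0 < ε) (s t : Bool) :
    ∀ᶠ n : ℤ in cofinite, ‖diracMatrix P Q (s, n) (t, n)‖ ≤ ε := by
  have hsqrt := ((summable_diracSq_block hP hQ s t).tendsto_cofinite_zero.comp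
    (tendsto_two_mul_add 0)).sqrt
  rw [Real.sqrt_zero] at hsqrt
  filter_upwards [hsqrt.eventually_le_const hε] with n hn
  rwa [Function.comp_apply, add_zero, two_mul, ← norm_diracMatrix_sq P Q (by simp),
    Real.sqrt_sq (norm_nonneg _)] at hn

theorem eventually_isModelPair_dirac {ε : ℝ} (hε : 0 < ε) :
    ∀ᶠ n : ℤ in cofinite,
      IsModelPair (diracMatrix P Q) (diracWeight n) (false, n) (true, n) ε := by
  filter_upwards [eventually_isHSContraction_dirac hP hQ,
    eventually_all.2 (eventually_dirac_row_energy_le hP hQ hε),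
    eventually_all.2 (eventually_dirac_col_energy_le hP hQ hε),
    eventually_all.2 fun s => eventually_all.2 (eventually_norm_diracMatrix_le hP hQ hε s)]
    with n hcontraction hrow hcol hentry
  exact {
    contraction := hcontraction
    ne := by simp
    weight_left := by simp [diracWeight]
    weight_right := by simp [diracWeight]
    row := by rintro x (rfl | rfl) <;> exact hrow _
    col := by rintro x (rfl | rfl) <;> exact hcol _
    entry := by rintro x y (rfl | rfl) (rfl | rfl) <;> exact hentry _ _ }

end Potentials

/-! ### Fourier coefficients along a parity class -/

theorem injective_add_two_mul (n : ℤ) : Function.Injective fun k : ℤ => n + 2 * k :=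
  fun a b h => by simpa using h

theorem exists_eq_add_two_mul {n j : ℤ} (h : Even (j - n)) : ∃ k, j = n + 2 * k := by
  obtain ⟨k, hk⟩ := h
  exact ⟨k, by omega⟩

theorem notMem_range_add_two_mul {n j : ℤ} (h : j ∉ Set.range fun k : ℤ => n + 2 * k) :
    ¬Even (j - n) := fun he => by
  obtain ⟨k, rfl⟩ := exists_eq_add_two_mul he
  exact h ⟨k, rfl⟩

theorem even_neg_sub {k n : ℤ} : Even (-k - n) ↔ Even (k - n) := by simp [Int.even_sub]

theorem hasSum_of_parity {F : ℤ → ℂ} {n : ℤ} {S : ℂ} (h : HasSum (fun k : ℤ => F (n + 2 * k)) S)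
    (h0 : ∀ i, ¬Even (i - n) → F i = 0) : HasSum F S :=
  ((injective_add_two_mul n).hasSum_iff fun i hi => h0 i (notMem_range_add_two_mul hi)).1 h

/-- The coefficients of `y` in the basis `e^{ijx}`, `j ∈ n + 2ℤ`, extended by zero to all `j`: the
coordinates in which the periodic (`n` even) or antiperiodic (`n` odd) problem becomes an infinite
matrix equation. -/
noncomputable def parityCoeff (n : ℤ) (y : ℝ → ℂ) (j : ℤ) : ℂ :=
  if Even (j - n) then fourierCoeffPi y j else 0

theorem parityCoeff_of_even {n j : ℤ} (hj : Even (j - n)) (y : ℝ → ℂ) :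
    parityCoeff n y j = fourierCoeffPi y j := if_pos hj

theorem parityCoeff_of_not_even {n j : ℤ} (hj : ¬Even (j - n)) (y : ℝ → ℂ) :
    parityCoeff n y j = 0 := if_neg hj

theorem summable_norm_sq_parityCoeff {y : ℝ → ℂ} (hy : MemLp y 2 intervalMeasure) (n : ℤ) :
    Summable fun j => ‖parityCoeff n y j‖ ^ 2 := by
  refine ((injective_add_two_mul n).summable_iff fun j hj => ?_).1
    ((hasSum_sq_fourierCoeffPi hy n).summable.congr fun k => by simp [parityCoeff])
  rw [parityCoeff_of_not_even (notMem_range_add_two_mul hj)]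
  simp

theorem exists_ne_zero_of_fourierCoeffPi {y : ℝ → ℂ} {j : ℤ} (h : fourierCoeffPi y j ≠ 0) :
    ∃ x ∈ Set.Icc 0 Real.pi, y x ≠ 0 := by
  by_contra! hzero
  have hae : ∀ᵐ x ∂intervalMeasure, y x = 0 :=
    (ae_restrict_mem measurableSet_Icc).mono fun x hx => hzero x hx
  refine h ?_
  rw [fourierCoeffPi_congr (g := fun _ => 0) hae]
  simp [fourierCoeffPi]

theorem exists_parityCoeff_ne_zero {y : ℝ → ℂ} (hy : ContinuousOn y (Set.Icc 0 Real.pi))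
    (h : ∃ x ∈ Set.Icc 0 Real.pi, y x ≠ 0) (n : ℤ) : ∃ j, parityCoeff n y j ≠ 0 := by
  by_contra! hzero
  obtain ⟨x, hx, hne⟩ := h
  refine hne (eqOn_zero_of_ae_eq_zero hy (ae_eq_zero_of_fourierCoeffPi
    (memLp_of_continuousOn hy) n fun k => ?_) x hx)
  rw [← parityCoeff_of_even (n := n) (by simp), hzero]

theorem exists_memLp_parityCoeff {Y : ℤ → ℂ} (hY : Summable fun j => ‖Y j‖ ^ 2) (n : ℤ) :
    ∃ y : ℝ → ℂ, MemLp y 2 intervalMeasure ∧ ∀ j, Even (j - n) → fourierCoeffPi y j = Y j := by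
  obtain ⟨y, hy, hcoef⟩ :=
    exists_memLp_fourierCoeffPi (hY.comp_injective (injective_add_two_mul n)) n
  refine ⟨y, hy, fun j hj => ?_⟩
  obtain ⟨k, rfl⟩ := exists_eq_add_two_mul hj
  exact hcoef k

theorem exists_hasL1Deriv_parityCoeff {Y : ℤ → ℂ} (hY : Summable fun j => ‖Y j‖ ^ 2)
    (hjY : Summable fun j : ℤ => (j : ℝ) ^ 2 * ‖Y j‖ ^ 2) (n : ℤ) :
    ∃ y y' : ℝ → ℂ, HasL1Deriv y y' ∧ MemLp y' 2 intervalMeasure ∧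
      y Real.pi = (-1 : ℂ) ^ n * y 0 ∧ ∀ j, Even (j - n) → fourierCoeffPi y j = Y j := by
  have hderiv : Summable fun j : ℤ => ‖Complex.I * j * Y j‖ ^ 2 :=
    hjY.congr fun j => by
      rw [norm_mul, norm_mul, Complex.norm_I, one_mul, Complex.norm_intCast, mul_pow, sq_abs]
  obtain ⟨y₀, hy₀, hcoef⟩ := exists_memLp_parityCoeff hY n
  obtain ⟨y', hy', hcoef'⟩ := exists_memLp_parityCoeff hderiv n
  obtain ⟨y, hyD, hyy₀, hbc⟩ := exists_hasL1Deriv hy₀ (hy'.integrable (by norm_num)) (n := n)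
    fun j hj => by rw [hcoef' j hj, hcoef j hj]
  exact ⟨y, y', hyD, hy', hbc, fun j hj => by rw [fourierCoeffPi_congr hyy₀, hcoef j hj]⟩

theorem IsSolution.summable_mul_norm_sq {ι : Type} {V : ι → ι → ℂ} {D : ι → ℝ} {d : ι → ℂ}
    {a b : ι} {z : ℂ} {Y G : ι → ℂ} (hs : IsSolution V D d a b z Y G) (hd : ∀ j, ‖d j‖ ≤ D j)
    {w : ι → ℝ} (hw : ∀ j, 0 ≤ w j) {C : ℝ} (hwD : ∀ j, w j * D j ≤ C) :
    Summable fun j => w j * ‖Y j‖ ^ 2 := by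
  classical
  have hbound : ∀ j, j ≠ a → j ≠ b → w j * ‖Y j‖ ^ 2 ≤ C * (D j * ‖G j‖ ^ 2) := by
    intro j hja hjb
    have hD : 0 ≤ D j := (norm_nonneg _).trans (hd j)
    have := hw j
    calc w j * ‖Y j‖ ^ 2
        = w j * (‖d j‖ ^ 2 * ‖G j‖ ^ 2) := by rw [hs.off j hja hjb, norm_mul, mul_pow]
      _ ≤ w j * (D j ^ 2 * ‖G j‖ ^ 2) := by gcongr; exact hd j
      _ = w j * D j * (D j * ‖G j‖ ^ 2) := by ring
      _ ≤ C * (D j * ‖G j‖ ^ 2) := by gcongr; exact hwD j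
  refine Summable.of_norm_bounded_eventually (hs.wsummable.mul_left C) ?_
  refine (Set.toFinite {a, b}).subset fun j hj => ?_
  by_contra hab
  rw [Set.mem_insert_iff, Set.mem_singleton_iff, not_or] at hab
  refine hj ?_
  rw [Set.mem_ofPred_eq, Real.norm_of_nonneg (mul_nonneg (hw j) (sq_nonneg _))]
  exact hbound j hab.1 hab.2

/-! ### The eigenvalue equation of the Hill operator -/

/-- The Fourier coefficients of the distribution `v y = (Q y)' - Q y' + c y`. -/
noncomputable def hillProductCoeff (c : ℂ) (Q y y' : ℝ → ℂ) (j : ℤ) : ℂ :=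
  Complex.I * j * fourierCoeffPi (fun x => Q x * y x) j - fourierCoeffPi (fun x => Q x * y' x) j +
    c * fourierCoeffPi y j

section Hill

variable {c : ℂ} {Q y y' : ℝ → ℂ} {n : ℤ} {z : ℂ}

theorem hasSum_hillMatrix_mul_parityCoeff (hQ : MemLp Q 2 intervalMeasure) (hyD : HasL1Deriv y y')
    (hy' : MemLp y' 2 intervalMeasure) (hbc : y Real.pi = (-1 : ℂ) ^ n * y 0) {j : ℤ}
    (hj : Even (j - n)) :
    HasSum (fun i => hillMatrix c Q j i * parityCoeff n y i) (hillProductCoeff c Q y y' j) := by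
  obtain ⟨l, rfl⟩ := exists_eq_add_two_mul hj
  refine hasSum_of_parity (n := n) ?_ fun i hi => by rw [parityCoeff_of_not_even hi, mul_zero]
  have hQy := (hasSum_mul_fourierCoeffPi hQ (memLp_of_continuousOn hyD.continuousOn) n
    (n + 2 * l)).mul_left (Complex.I * ((n + 2 * l : ℤ) : ℂ))
  have hQy' := hasSum_mul_fourierCoeffPi hQ hy' n (n + 2 * l)
  have hcy : HasSum (fun k : ℤ => if k = l then c * fourierCoeffPi y (n + 2 * l) else 0)
    (c * fourierCoeffPi y (n + 2 * l)) := hasSum_ite_eq l _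
  refine ((hQy.sub hQy').add hcy).congr_fun fun k => ?_
  rw [hyD.fourierCoeffPi_deriv (n := n) (by simp) hbc, parityCoeff_of_even (by simp), hillMatrix,
    hillCoeff]
  rcases eq_or_ne k l with rfl | hk
  · simp only [sub_self, if_true]
    ring
  · rw [if_neg hk, if_neg (by omega)]
    push_cast
    ring

theorem HillGraph.exists_coeff_eq {lam : ℂ} (hQ : MemLp Q 2 intervalMeasure)
    (h : HillGraph c Q ((-1 : ℂ) ^ n) y fun x => lam * y x) :
    ∃ y' : ℝ → ℂ, HasL1Deriv y y' ∧ MemLp y' 2 intervalMeasure ∧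
      y Real.pi = (-1 : ℂ) ^ n * y 0 ∧ ∀ j : ℤ, Even (j - n) →
        (lam - (j : ℂ) ^ 2) * fourierCoeffPi y j = hillProductCoeff c Q y y' j := by
  obtain ⟨y', u, u', hyD, hy', hu, huD, heq, -, hbc, hubc⟩ := h
  refine ⟨y', hyD, hy', hbc, fun j hj => ?_⟩
  have hyi := (memLp_of_continuousOn hyD.continuousOn).integrable (by norm_num)
  have hu'i := intervalIntegrable_iff_integrable.1 huD.1
  have hQy := (memLp_mul_of_continuousOn hyD.continuousOn hQ).integrable (by norm_num)
  have hQy' : Integrable (fun x => Q x * y' x) intervalMeasure := hQ.integrable_mul hy'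
  have hequation := fourierCoeffPi_congr heq j
  rw [fourierCoeffPi_const_mul, fourierCoeffPi_add (f := fun x => -u' x - Q x * y' x)
      (hu'i.neg.sub hQy') (hyi.const_mul c), fourierCoeffPi_const_mul,
    fourierCoeffPi_sub (f := fun x => -u' x) hu'i.neg hQy'] at hequation
  have hneg : fourierCoeffPi (fun x => -u' x) j = -fourierCoeffPi u' j := by
    simpa only [neg_one_mul] using fourierCoeffPi_const_mul (-1) u' j
  have hquasi := fourierCoeffPi_congr hu j
  rw [fourierCoeffPi_sub (hy'.integrable (by norm_num)) hQy, hyD.fourierCoeffPi_deriv hj hbc]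
    at hquasi
  rw [hneg, huD.fourierCoeffPi_deriv hj hubc, hquasi] at hequation
  rw [hillProductCoeff]
  linear_combination hequation - (j : ℂ) ^ 2 * fourierCoeffPi y j * Complex.I_sq

theorem hillGraph_of_coeff_eq {lam : ℂ} (hQ : MemLp Q 2 intervalMeasure) (hyD : HasL1Deriv y y')
    (hy' : MemLp y' 2 intervalMeasure) (hbc : y Real.pi = (-1 : ℂ) ^ n * y 0)
    (hcoef : ∀ j : ℤ, Even (j - n) →
      (lam - (j : ℂ) ^ 2) * fourierCoeffPi y j = hillProductCoeff c Q y y' j) :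
    HillGraph c Q ((-1 : ℂ) ^ n) y fun x => lam * y x := by
  have hy := memLp_of_continuousOn hyD.continuousOn
  have hyi := hy.integrable (by norm_num : (1 : ENNReal) ≤ 2)
  have hQyL := memLp_mul_of_continuousOn hyD.continuousOn hQ
  have hQy' : Integrable (fun x => Q x * y' x) intervalMeasure := hQ.integrable_mul hy'
  obtain ⟨u, huD, hu, hubc⟩ := exists_hasL1Deriv (f := fun x => y' x - Q x * y x)
    (h := fun x => (c - lam) * y x - Q x * y' x) (hy'.sub hQyL)
    ((hyi.const_mul _).sub hQy') (n := n) fun j hj => by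
      have hj' := hcoef j hj
      rw [hillProductCoeff] at hj'
      rw [fourierCoeffPi_sub (hyi.const_mul _) hQy', fourierCoeffPi_const_mul,
        fourierCoeffPi_sub (hy'.integrable (by norm_num)) (hQyL.integrable (by norm_num)),
        hyD.fourierCoeffPi_deriv hj hbc]
      linear_combination -hj' - (j : ℂ) ^ 2 * fourierCoeffPi y j * Complex.I_sq
  exact ⟨y', u, _, hyD, hy', hu, huD, ae_of_all _ fun x => by ring, hy.const_mul _, hbc, hubc⟩

theorem hillWeight_ne_zero_or_iff {j : ℤ} :
    (hillWeight n j ≠ 0 ∨ j = -n ∨ j = n) ↔ Even (j - n) := by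
  refine ⟨?_, fun hj => ?_⟩
  · rintro (h | rfl | rfl)
    · by_contra hj
      exact h (if_neg hj)
    · simp [even_neg_sub]
    · simp
  · by_contra! h
    have hsub : |((n - j : ℤ) : ℝ)| ≠ 0 := by
      have := one_le_abs_cast (sub_ne_zero.2 h.2.2.symm)
      positivity
    have hadd : |((n + j : ℤ) : ℝ)| ≠ 0 := by
      have := one_le_abs_cast (s := n + j) (by omega)
      positivity
    refine absurd h.1 ?_
    rw [hillWeight, if_pos hj, invAbs, invAbs]
    positivity

theorem hillDiag_of_not_even {j : ℤ} (hj : ¬Even (j - n)) : hillDiag n z j = 0 :=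
  if_neg fun h => hj h.1

theorem hillDiag_mul_cancel (hn : 0 < n) (hz : ‖z‖ < n / 4) {j : ℤ} (hj : Even (j - n))
    (h1 : j ≠ -n) (h2 : j ≠ n) : hillDiag n z j * ((n : ℂ) ^ 2 + z - (j : ℂ) ^ 2) = 1 := by
  rw [hillDiag, if_pos ⟨hj, h2, h1⟩, add_sub_right_comm]
  exact inv_mul_cancel₀ (hillDenominator_ne_zero hn h2 h1 hz)

theorem hillWeight_le_two (n j : ℤ) : hillWeight n j ≤ 2 := by
  refine (hillWeight_le n j).trans ?_
  have := mul_le_one₀ (invAbs_le_one (n - j)) (invAbs_nonneg _) (invAbs_le_one (n + j))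
  linarith

theorem hillWeight_mul_abs_le (n j : ℤ) :
    hillWeight n j * |(n : ℝ) ^ 2 - (j : ℝ) ^ 2| ≤ 2 := by
  have hfactor : |(n : ℝ) ^ 2 - (j : ℝ) ^ 2| = |((n - j : ℤ) : ℝ)| * |((n + j : ℤ) : ℝ)| := by
    rw [← abs_mul]
    congr 1
    push_cast
    ring
  calc hillWeight n j * |(n : ℝ) ^ 2 - (j : ℝ) ^ 2|
      ≤ 2 * (invAbs (n - j) * invAbs (n + j)) * |(n : ℝ) ^ 2 - (j : ℝ) ^ 2| := by
        gcongr; exact hillWeight_le n j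
    _ = 2 * ((|((n - j : ℤ) : ℝ)| * invAbs (n - j)) * (|((n + j : ℤ) : ℝ)| * invAbs (n + j))) := by
        rw [hfactor]; ring
    _ ≤ 2 * 1 := by
        gcongr
        exact mul_le_one₀ (abs_mul_invAbs_le _) (mul_nonneg (abs_nonneg _) (invAbs_nonneg _))
          (abs_mul_invAbs_le _)
    _ = 2 := mul_one 2

theorem sq_mul_hillWeight_le (n j : ℤ) : (j : ℝ) ^ 2 * hillWeight n j ≤ 2 + 2 * (n : ℝ) ^ 2 := by
  have hj : (j : ℝ) ^ 2 ≤ |(n : ℝ) ^ 2 - (j : ℝ) ^ 2| + (n : ℝ) ^ 2 := by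
    linarith [neg_abs_le ((n : ℝ) ^ 2 - (j : ℝ) ^ 2)]
  calc (j : ℝ) ^ 2 * hillWeight n j
      ≤ (|(n : ℝ) ^ 2 - (j : ℝ) ^ 2| + (n : ℝ) ^ 2) * hillWeight n j :=
        mul_le_mul_of_nonneg_right hj (hillWeight_nonneg n j)
    _ = hillWeight n j * |(n : ℝ) ^ 2 - (j : ℝ) ^ 2| + (n : ℝ) ^ 2 * hillWeight n j := by ring
    _ ≤ 2 + (n : ℝ) ^ 2 * 2 := by
        gcongr
        exacts [hillWeight_mul_abs_le n j, hillWeight_le_two n j]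
    _ = 2 + 2 * (n : ℝ) ^ 2 := by ring

theorem norm_hillDenominator_le (hz : ‖z‖ < n / 4) {j : ℤ} (h1 : j ≠ -n) (h2 : j ≠ n) :
    ‖(n : ℂ) ^ 2 + z - (j : ℂ) ^ 2‖ ≤ 2 * |(n : ℝ) ^ 2 - (j : ℝ) ^ 2| := by
  have hn : 0 < n := by
    have : (0 : ℝ) < n := by linarith [norm_nonneg z]
    exact_mod_cast this
  have hge : (n : ℝ) ≤ |(n : ℝ) ^ 2 - (j : ℝ) ^ 2| := by
    refine (le_abs_sub_mul_abs_add hn h2 h1).trans (le_of_eq ?_)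
    rw [← abs_mul]
    congr 1
    push_cast
    ring
  have hsplit : (n : ℂ) ^ 2 + z - (j : ℂ) ^ 2 = (((n : ℝ) ^ 2 - (j : ℝ) ^ 2 : ℝ) : ℂ) + z := by
    push_cast
    ring
  have hnorm := norm_add_le ((((n : ℝ) ^ 2 - (j : ℝ) ^ 2 : ℝ)) : ℂ) z
  rw [← hsplit, Complex.norm_real, Real.norm_eq_abs] at hnorm
  linarith [norm_nonneg z]

theorem hillWeight_mul_norm_sq_le (hz : ‖z‖ < n / 4) (j : ℤ) :
    hillWeight n j * ‖(n : ℂ) ^ 2 + z - (j : ℂ) ^ 2‖ ^ 2 ≤ 8 * ((n : ℝ) ^ 2 + (j : ℝ) ^ 2) := by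
  have hw := hillWeight_nonneg n j
  rcases eq_or_ne j n with rfl | h2
  · rw [hillWeight_self, zero_mul]
    positivity
  rcases eq_or_ne j (-n) with rfl | h1
  · rw [hillWeight_neg_self, zero_mul]
    positivity
  set A := |(n : ℝ) ^ 2 - (j : ℝ) ^ 2|
  have hA : A ≤ (n : ℝ) ^ 2 + (j : ℝ) ^ 2 :=
    abs_le.2 ⟨by linarith [sq_nonneg (n : ℝ)], by linarith [sq_nonneg (j : ℝ)]⟩
  calc hillWeight n j * ‖(n : ℂ) ^ 2 + z - (j : ℂ) ^ 2‖ ^ 2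
      ≤ hillWeight n j * (2 * A) ^ 2 := by gcongr; exact norm_hillDenominator_le hz h1 h2
    _ = 4 * (hillWeight n j * A) * A := by ring
    _ ≤ 4 * 2 * A := by gcongr; exact hillWeight_mul_abs_le n j
    _ ≤ 8 * ((n : ℝ) ^ 2 + (j : ℝ) ^ 2) := by linarith

theorem wsummable_hillDenominator_mul (hyD : HasL1Deriv y y') (hy' : MemLp y' 2 intervalMeasure)
    (hbc : y Real.pi = (-1 : ℂ) ^ n * y 0) (hz : ‖z‖ < n / 4) :
    WSummable (hillWeight n) fun j : ℤ =>
      ((n : ℂ) ^ 2 + z - (j : ℂ) ^ 2) * parityCoeff n y j := by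
  have hsum := ((summable_norm_sq_parityCoeff hy' n).mul_left 8).add
    ((summable_norm_sq_parityCoeff (memLp_of_continuousOn hyD.continuousOn) n).mul_left
      (8 * (n : ℝ) ^ 2))
  have hderiv : ∀ j : ℤ, ‖parityCoeff n y' j‖ ^ 2 = (j : ℝ) ^ 2 * ‖parityCoeff n y j‖ ^ 2 := by
    intro j
    by_cases hj : Even (j - n)
    · rw [parityCoeff_of_even hj, parityCoeff_of_even hj, hyD.fourierCoeffPi_deriv hj hbc, norm_mul,
        norm_mul, Complex.norm_I, one_mul, Complex.norm_intCast, mul_pow, sq_abs]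
    · simp [parityCoeff_of_not_even hj]
  refine hsum.of_nonneg_of_le (fun j => mul_nonneg (hillWeight_nonneg _ _) (sq_nonneg _))
    fun j => ?_
  rw [hderiv, norm_mul, mul_pow, ← mul_assoc]
  refine (mul_le_mul_of_nonneg_right (hillWeight_mul_norm_sq_le hz j) (sq_nonneg _)).trans
    (le_of_eq ?_)
  ring

theorem isSolution_parityCoeff_hill (hQ : MemLp Q 2 intervalMeasure) (hyD : HasL1Deriv y y')
    (hy' : MemLp y' 2 intervalMeasure) (hbc : y Real.pi = (-1 : ℂ) ^ n * y 0) (hn : 0 < n)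
    (hz : ‖z‖ < n / 4)
    (hcoef : ∀ j : ℤ, Even (j - n) →
      ((n : ℂ) ^ 2 + z - (j : ℂ) ^ 2) * fourierCoeffPi y j = hillProductCoeff c Q y y' j) :
    IsSolution (hillMatrix c Q) (hillWeight n) (hillDiag n z) (-n) n z (parityCoeff n y)
      fun j => ((n : ℂ) ^ 2 + z - (j : ℂ) ^ 2) * parityCoeff n y j where
  wsummable := wsummable_hillDenominator_mul hyD hy' hbc hz
  off j h1 h2 := by
    by_cases hj : Even (j - n)
    · rw [← mul_assoc, hillDiag_mul_cancel hn hz hj h1 h2, one_mul]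
    · rw [hillDiag_of_not_even hj, parityCoeff_of_not_even hj, zero_mul]
  hasSum j hj := by
    rw [hillWeight_ne_zero_or_iff] at hj
    rw [parityCoeff_of_even hj, hcoef j hj]
    exact hasSum_hillMatrix_mul_parityCoeff hQ hyD hy' hbc hj
  left := by push_cast; ring
  right := by ring

theorem IsSolution.apply_hill {Y G : ℤ → ℂ}
    (hs : IsSolution (hillMatrix c Q) (hillWeight n) (hillDiag n z) (-n) n z Y G) (hn : 0 < n)
    (hz : ‖z‖ < n / 4) {j : ℤ} (hj : Even (j - n)) :
    G j = ((n : ℂ) ^ 2 + z - (j : ℂ) ^ 2) * Y j := by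
  rcases eq_or_ne j (-n) with rfl | h1
  · rw [hs.left]
    push_cast
    ring
  rcases eq_or_ne j n with rfl | h2
  · rw [hs.right]
    ring
  · rw [hs.off j h1 h2, ← mul_assoc, mul_comm (_ - _), hillDiag_mul_cancel hn hz hj h1 h2, one_mul]

theorem IsSolution.eq_zero_hill {Y G : ℤ → ℂ}
    (hs : IsSolution (hillMatrix c Q) (hillWeight n) (hillDiag n z) (-n) n z Y G) {j : ℤ}
    (hj : ¬Even (j - n)) : Y j = 0 := by
  have hne := mt hillWeight_ne_zero_or_iff.1 hj
  push Not at hne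
  rw [hs.off j hne.2.1 hne.2.2, hillDiag_of_not_even hj, zero_mul]

theorem IsSolution.isHillEigenvalue {Y G : ℤ → ℂ}
    (hs : IsSolution (hillMatrix c Q) (hillWeight n) (hillDiag n z) (-n) n z Y G)
    (hQ : MemLp Q 2 intervalMeasure) (hn : 0 < n) (hz : ‖z‖ < n / 4)
    (hY : Y (-n) ≠ 0 ∨ Y n ≠ 0) : IsHillEigenvalue c Q ((-1 : ℂ) ^ n) ((n : ℂ) ^ 2 + z) := by
  have hd := norm_hillDiag_le hn hz
  have hsum : Summable fun j => ‖Y j‖ ^ 2 := by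
    simpa using hs.summable_mul_norm_sq hd (w := fun _ => 1) (fun _ => zero_le_one)
      fun j => (one_mul _).trans_le (hillWeight_le_two n j)
  have hsum' := hs.summable_mul_norm_sq hd (w := fun j : ℤ => (j : ℝ) ^ 2) (fun _ => sq_nonneg _)
    (sq_mul_hillWeight_le n)
  obtain ⟨y, y', hyD, hy', hbc, hcoef⟩ := exists_hasL1Deriv_parityCoeff hsum hsum' n
  have hYy : Y = parityCoeff n y := by
    ext j
    by_cases hj : Even (j - n)
    · rw [parityCoeff_of_even hj, hcoef j hj]
    · rw [parityCoeff_of_not_even hj, hs.eq_zero_hill hj]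
  refine ⟨y, ?_, hillGraph_of_coeff_eq hQ hyD hy' hbc fun j hj => ?_⟩
  · rcases hY with h0 | h0
    · exact exists_ne_zero_of_fourierCoeffPi (hcoef (-n) (by simp [even_neg_sub]) ▸ h0)
    · exact exists_ne_zero_of_fourierCoeffPi (hcoef n (by simp) ▸ h0)
  · rw [hcoef j hj, ← hs.apply_hill hn hz hj]
    refine (hs.hasSum j (hillWeight_ne_zero_or_iff.2 hj)).unique ?_
    rw [hYy]
    exact hasSum_hillMatrix_mul_parityCoeff hQ hyD hy' hbc hj

theorem isHillEigenvalue_iff (hQ : MemLp Q 2 intervalMeasure) (hn : 0 < n) {M : ℝ}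
    (h : IsModelPair (hillMatrix c Q) (hillWeight n) (-n) n M) (hz : ‖z‖ < n / 4) :
    IsHillEigenvalue c Q ((-1 : ℂ) ^ n) ((n : ℂ) ^ 2 + z) ↔
      (z - reducedEntry (hillMatrix c Q) (hillDiag n z) (-n) (-n)) *
          (z - reducedEntry (hillMatrix c Q) (hillDiag n z) n n) =
        reducedEntry (hillMatrix c Q) (hillDiag n z) (-n) n *
          reducedEntry (hillMatrix c Q) (hillDiag n z) n (-n) := by
  have hd := norm_hillDiag_le hn hz
  constructor
  · rintro ⟨y, hne, hgraph⟩
    obtain ⟨y', hyD, hy', hbc, hcoef⟩ := hgraph.exists_coeff_eq hQ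
    exact (isSolution_parityCoeff_hill hQ hyD hy' hbc hn hz hcoef).det_eq_zero h hd
      (exists_parityCoeff_ne_zero hyD.continuousOn hne n)
  · intro hdet
    obtain ⟨Y, G, hY, hs⟩ := h.exists_isSolution hd hdet
    exact hs.isHillEigenvalue hQ hn hz hY

end Hill

/-! ### The eigenvalue equation of the Dirac operator -/

/-- The coefficients of `(y₁, y₂)` in the basis `(e^{-ikx}, 0)`, `(0, e^{ikx})`, `k ∈ n + 2ℤ`,
extended by zero to all `k`. -/
noncomputable def diracVector (n : ℤ) (y₁ y₂ : ℝ → ℂ) : Bool × ℤ → ℂ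
  | (false, k) => parityCoeff n y₁ (-k)
  | (true, k) => parityCoeff n y₂ k

section Dirac

variable {P Q y₁ y₂ : ℝ → ℂ} {n : ℤ} {z : ℂ}

theorem diracVector_of_not_even {a : Bool × ℤ} (ha : ¬Even (a.2 - n)) (y₁ y₂ : ℝ → ℂ) :
    diracVector n y₁ y₂ a = 0 := by
  obtain ⟨_ | _, k⟩ := a
  · exact parityCoeff_of_not_even (mt even_neg_sub.1 ha) y₁
  · exact parityCoeff_of_not_even ha y₂

theorem diracVector_false_of_even {k : ℤ} (hk : Even (k - n)) (y₁ y₂ : ℝ → ℂ) :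
    diracVector n y₁ y₂ (false, k) = fourierCoeffPi y₁ (-k) :=
  parityCoeff_of_even (even_neg_sub.2 hk) y₁

theorem diracVector_true_of_even {k : ℤ} (hk : Even (k - n)) (y₁ y₂ : ℝ → ℂ) :
    diracVector n y₁ y₂ (true, k) = fourierCoeffPi y₂ k :=
  parityCoeff_of_even hk y₂

theorem summable_norm_sq_diracVector (hy₁ : MemLp y₁ 2 intervalMeasure)
    (hy₂ : MemLp y₂ 2 intervalMeasure) (n : ℤ) :
    Summable fun a => ‖diracVector n y₁ y₂ a‖ ^ 2 := by
  refine summable_bool_prod (fun _ => sq_nonneg _) ?_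
  rintro (_ | _)
  · exact (Equiv.neg ℤ).summable_iff.2 (summable_norm_sq_parityCoeff hy₁ n)
  · exact summable_norm_sq_parityCoeff hy₂ n

theorem exists_diracVector_ne_zero (hy₁ : ContinuousOn y₁ (Set.Icc 0 Real.pi))
    (hy₂ : ContinuousOn y₂ (Set.Icc 0 Real.pi))
    (h : ∃ x ∈ Set.Icc 0 Real.pi, y₁ x ≠ 0 ∨ y₂ x ≠ 0) (n : ℤ) :
    ∃ a, diracVector n y₁ y₂ a ≠ 0 := by
  obtain ⟨x, hx, h₁ | h₂⟩ := h
  · obtain ⟨j, hj⟩ := exists_parityCoeff_ne_zero hy₁ ⟨x, hx, h₁⟩ n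
    exact ⟨(false, -j), by rwa [diracVector, neg_neg]⟩
  · obtain ⟨j, hj⟩ := exists_parityCoeff_ne_zero hy₂ ⟨x, hx, h₂⟩ n
    exact ⟨(true, j), hj⟩

theorem exists_memLp_diracVector {Y : Bool × ℤ → ℂ} (hY : Summable fun a => ‖Y a‖ ^ 2)
    (h0 : ∀ a : Bool × ℤ, ¬Even (a.2 - n) → Y a = 0) :
    ∃ y₁ y₂ : ℝ → ℂ, MemLp y₁ 2 intervalMeasure ∧ MemLp y₂ 2 intervalMeasure ∧
      diracVector n y₁ y₂ = Y := by
  have hinj₁ : Function.Injective fun j : ℤ => (false, -j) := fun a b h => by simpa using h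
  have hinj₂ : Function.Injective fun j : ℤ => (true, j) := fun a b h => by simpa using h
  obtain ⟨y₁, hy₁, hcoef₁⟩ := exists_memLp_parityCoeff (hY.comp_injective hinj₁) n
  obtain ⟨y₂, hy₂, hcoef₂⟩ := exists_memLp_parityCoeff (hY.comp_injective hinj₂) n
  refine ⟨y₁, y₂, hy₁, hy₂, funext fun a => ?_⟩
  by_cases ha : Even (a.2 - n)
  · obtain ⟨_ | _, k⟩ := a
    · rw [diracVector_false_of_even ha, hcoef₁ _ (even_neg_sub.2 ha), neg_neg]
    · rw [diracVector_true_of_even ha, hcoef₂ _ ha]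
  · rw [diracVector_of_not_even ha, h0 a ha]

theorem hasSum_diracMatrix_mul_diracVector (hP : MemLp P 2 intervalMeasure)
    (hQ : MemLp Q 2 intervalMeasure) (hy₁ : MemLp y₁ 2 intervalMeasure)
    (hy₂ : MemLp y₂ 2 intervalMeasure) {a : Bool × ℤ} (ha : Even (a.2 - n)) :
    HasSum (fun i => diracMatrix P Q a i * diracVector n y₁ y₂ i)
      (diracVector n (fun x => P x * y₂ x) (fun x => Q x * y₁ x) a) := by
  obtain ⟨_ | _, k⟩ := a
  · have hinj : Function.Injective fun j : ℤ => (true, j) := fun a b h => by simpa using h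
    rw [diracVector_false_of_even ha]
    refine (hinj.hasSum_iff ?_).1 (hasSum_of_parity (n := n)
      ((hasSum_mul_fourierCoeffPi hP hy₂ n (-k)).congr_fun fun l => ?_) fun i hi => ?_)
    · rintro ⟨_ | _, j⟩ hj
      · simp [diracMatrix]
      · exact (hj ⟨j, rfl⟩).elim
    · simp [diracMatrix, diracVector, parityCoeff]
    · simp [diracVector, parityCoeff, hi]
  · have hinj : Function.Injective fun j : ℤ => (false, -j) := fun a b h => by simpa using h
    rw [diracVector_true_of_even ha]
    refine (hinj.hasSum_iff ?_).1 (hasSum_of_parity (n := n)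
      ((hasSum_mul_fourierCoeffPi hQ hy₁ n k).congr_fun fun l => ?_) fun i hi => ?_)
    · rintro ⟨_ | _, j⟩ hj
      · exact (hj ⟨-j, by simp⟩).elim
      · simp [diracMatrix]
    · simp [diracMatrix, diracVector, parityCoeff, sub_eq_add_neg]
    · simp [diracVector, parityCoeff, hi]

theorem DiracGraph.coeff_eq {lam : ℂ} (hP : MemLp P 2 intervalMeasure)
    (hQ : MemLp Q 2 intervalMeasure)
    (h : DiracGraph P Q ((-1 : ℂ) ^ n) y₁ y₂ (fun x => lam * y₁ x) fun x => lam * y₂ x)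
    (a : Bool × ℤ) :
    (lam - a.2) * diracVector n y₁ y₂ a =
      diracVector n (fun x => P x * y₂ x) (fun x => Q x * y₁ x) a := by
  obtain ⟨g₁, g₂, hD₁, hD₂, heq₁, heq₂, -, -, hbc₁, hbc₂⟩ := h
  by_cases ha : Even (a.2 - n)
  swap
  · rw [diracVector_of_not_even ha, diracVector_of_not_even ha, mul_zero]
  obtain ⟨_ | _, k⟩ := a
  · have hPy := (memLp_mul_of_continuousOn hD₂.continuousOn hP).integrable (by norm_num)
    have hequation := fourierCoeffPi_congr heq₁ (-k)
    rw [fourierCoeffPi_add ((intervalIntegrable_iff_integrable.1 hD₁.1).const_mul _) hPy,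
      fourierCoeffPi_const_mul, fourierCoeffPi_const_mul,
      hD₁.fourierCoeffPi_deriv (even_neg_sub.2 ha) hbc₁] at hequation
    rw [diracVector_false_of_even ha, diracVector_false_of_even ha]
    push_cast at hequation
    linear_combination hequation - k * fourierCoeffPi y₁ (-k) * Complex.I_sq
  · have hQy := (memLp_mul_of_continuousOn hD₁.continuousOn hQ).integrable (by norm_num)
    have hequation := fourierCoeffPi_congr heq₂ k
    rw [fourierCoeffPi_add ((intervalIntegrable_iff_integrable.1 hD₂.1).const_mul _) hQy,
      fourierCoeffPi_const_mul, fourierCoeffPi_const_mul,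
      hD₂.fourierCoeffPi_deriv ha hbc₂] at hequation
    rw [diracVector_true_of_even ha, diracVector_true_of_even ha]
    linear_combination hequation - k * fourierCoeffPi y₂ k * Complex.I_sq

theorem exists_diracGraph_of_coeff_eq {lam : ℂ} {w₁ w₂ : ℝ → ℂ} (hP : MemLp P 2 intervalMeasure)
    (hQ : MemLp Q 2 intervalMeasure) (hw₁ : MemLp w₁ 2 intervalMeasure)
    (hw₂ : MemLp w₂ 2 intervalMeasure)
    (hcoef : ∀ a : Bool × ℤ, Even (a.2 - n) → (lam - a.2) * diracVector n w₁ w₂ a =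
      diracVector n (fun x => P x * w₂ x) (fun x => Q x * w₁ x) a) :
    ∃ y₁ y₂ : ℝ → ℂ, (∀ᵐ x ∂intervalMeasure, y₁ x = w₁ x) ∧
      (∀ᵐ x ∂intervalMeasure, y₂ x = w₂ x) ∧
      DiracGraph P Q ((-1 : ℂ) ^ n) y₁ y₂ (fun x => lam * y₁ x) fun x => lam * y₂ x := by
  have hw₁i := hw₁.integrable (by norm_num : (1 : ENNReal) ≤ 2)
  have hw₂i := hw₂.integrable (by norm_num : (1 : ENNReal) ≤ 2)
  have hPw : Integrable (fun x => P x * w₂ x) intervalMeasure := hP.integrable_mul hw₂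
  have hQw : Integrable (fun x => Q x * w₁ x) intervalMeasure := hQ.integrable_mul hw₁
  obtain ⟨y₁, hD₁, hyw₁, hbc₁⟩ := exists_hasL1Deriv hw₁
    (h := fun x => -Complex.I * (lam * w₁ x - P x * w₂ x))
    (((hw₁i.const_mul _).sub hPw).const_mul _) (n := n) fun k hk => by
      have hk' := even_neg_sub.2 hk
      have hcoefk := hcoef (false, -k) hk'
      rw [diracVector_false_of_even hk', diracVector_false_of_even hk', neg_neg] at hcoefk
      rw [fourierCoeffPi_const_mul, fourierCoeffPi_sub (hw₁i.const_mul _) hPw,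
        fourierCoeffPi_const_mul, ← hcoefk]
      push_cast
      ring
  obtain ⟨y₂, hD₂, hyw₂, hbc₂⟩ := exists_hasL1Deriv hw₂
    (h := fun x => Complex.I * (lam * w₂ x - Q x * w₁ x))
    (((hw₂i.const_mul _).sub hQw).const_mul _) (n := n) fun k hk => by
      have hcoefk := hcoef (true, k) hk
      rw [diracVector_true_of_even hk, diracVector_true_of_even hk] at hcoefk
      rw [fourierCoeffPi_const_mul, fourierCoeffPi_sub (hw₂i.const_mul _) hQw,
        fourierCoeffPi_const_mul, ← hcoefk]
      ring
  refine ⟨y₁, y₂, hyw₁, hyw₂, _, _, hD₁, hD₂, ?_, ?_,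
    (memLp_of_continuousOn hD₁.continuousOn).const_mul _,
    (memLp_of_continuousOn hD₂.continuousOn).const_mul _, hbc₁, hbc₂⟩
  all_goals filter_upwards [hyw₁, hyw₂] with x hx₁ hx₂; rw [hx₁, hx₂]
  · linear_combination (lam * w₁ x - P x * w₂ x) * Complex.I_sq
  · linear_combination (lam * w₂ x - Q x * w₁ x) * Complex.I_sq

theorem diracWeight_le_two (n : ℤ) (a : Bool × ℤ) : diracWeight n a ≤ 2 := by
  unfold diracWeight
  split_ifs
  · linarith [invAbs_le_one (n - a.2)]
  · norm_num

theorem snd_ne_of_ne {a : Bool × ℤ} (h1 : a ≠ (false, n)) (h2 : a ≠ (true, n)) : a.2 ≠ n := by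
  obtain ⟨_ | _, k⟩ := a
  · simpa using h1
  · simpa using h2

theorem diracWeight_ne_zero_or_iff {a : Bool × ℤ} :
    (diracWeight n a ≠ 0 ∨ a = (false, n) ∨ a = (true, n)) ↔ Even (a.2 - n) := by
  refine ⟨?_, fun ha => ?_⟩
  · rintro (h | rfl | rfl)
    · by_contra ha
      exact h (if_neg ha)
    all_goals simp
  · by_contra! h
    have hpos := half_abs_sub_pos (snd_ne_of_ne h.2.1 h.2.2)
    refine absurd h.1 ?_
    rw [diracWeight, if_pos ha, invAbs]
    exact mul_ne_zero two_ne_zero (inv_ne_zero (by linarith))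

theorem diracDiag_of_not_even {a : Bool × ℤ} (ha : ¬Even (a.2 - n)) : diracDiag n z a = 0 :=
  if_neg fun h => ha h.1

theorem diracDiag_mul_cancel (hz : ‖z‖ < 1 / 2) {a : Bool × ℤ} (ha : Even (a.2 - n))
    (h1 : a ≠ (false, n)) (h2 : a ≠ (true, n)) : diracDiag n z a * (n + z - a.2) = 1 := by
  have hne := snd_ne_of_ne h1 h2
  rw [diracDiag, if_pos ⟨ha, hne⟩, add_sub_right_comm]
  exact inv_mul_cancel₀ (diracDenominator_ne_zero hne hz)

theorem isSolution_diracVector {y₁ y₂ : ℝ → ℂ} (hP : MemLp P 2 intervalMeasure)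
    (hQ : MemLp Q 2 intervalMeasure) (hz : ‖z‖ < 1 / 2)
    (h : DiracGraph P Q ((-1 : ℂ) ^ n) y₁ y₂ (fun x => (n + z) * y₁ x) fun x => (n + z) * y₂ x) :
    IsSolution (diracMatrix P Q) (diracWeight n) (diracDiag n z) (false, n) (true, n) z
      (diracVector n y₁ y₂) (diracVector n (fun x => P x * y₂ x) fun x => Q x * y₁ x) := by
  have hcoef := h.coeff_eq hP hQ
  obtain ⟨g₁, g₂, hD₁, hD₂, -⟩ := h
  have hy₁ := hD₁.continuousOn
  have hy₂ := hD₂.continuousOn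
  refine ⟨?_, fun a h1 h2 => ?_, fun a ha => ?_, ?_, ?_⟩
  · refine ((summable_norm_sq_diracVector (memLp_mul_of_continuousOn hy₂ hP)
      (memLp_mul_of_continuousOn hy₁ hQ) n).mul_left 2).of_nonneg_of_le
      (fun a => mul_nonneg (diracWeight_nonneg _ _) (sq_nonneg _)) fun a => ?_
    exact mul_le_mul_of_nonneg_right (diracWeight_le_two n a) (sq_nonneg _)
  · by_cases ha : Even (a.2 - n)
    · rw [← hcoef, ← mul_assoc, diracDiag_mul_cancel hz ha h1 h2, one_mul]
    · rw [diracVector_of_not_even ha, diracDiag_of_not_even ha, zero_mul]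
  · exact hasSum_diracMatrix_mul_diracVector hP hQ (memLp_of_continuousOn hy₁)
      (memLp_of_continuousOn hy₂) (diracWeight_ne_zero_or_iff.1 ha)
  all_goals rw [← hcoef, add_sub_cancel_left]

theorem IsSolution.apply_dirac {Y G : Bool × ℤ → ℂ}
    (hs : IsSolution (diracMatrix P Q) (diracWeight n) (diracDiag n z) (false, n) (true, n) z Y G)
    (hz : ‖z‖ < 1 / 2) {a : Bool × ℤ} (ha : Even (a.2 - n)) : G a = (n + z - a.2) * Y a := by
  rcases eq_or_ne a (false, n) with rfl | h1
  · rw [hs.left, add_sub_cancel_left]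
  rcases eq_or_ne a (true, n) with rfl | h2
  · rw [hs.right, add_sub_cancel_left]
  · rw [hs.off a h1 h2, ← mul_assoc, mul_comm (_ - _), diracDiag_mul_cancel hz ha h1 h2, one_mul]

theorem IsSolution.eq_zero_dirac {Y G : Bool × ℤ → ℂ}
    (hs : IsSolution (diracMatrix P Q) (diracWeight n) (diracDiag n z) (false, n) (true, n) z Y G)
    {a : Bool × ℤ} (ha : ¬Even (a.2 - n)) : Y a = 0 := by
  have hne := mt diracWeight_ne_zero_or_iff.1 ha
  push Not at hne
  rw [hs.off a hne.2.1 hne.2.2, diracDiag_of_not_even ha, zero_mul]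

theorem IsSolution.isDiracEigenvalue {Y G : Bool × ℤ → ℂ}
    (hs : IsSolution (diracMatrix P Q) (diracWeight n) (diracDiag n z) (false, n) (true, n) z Y G)
    (hP : MemLp P 2 intervalMeasure) (hQ : MemLp Q 2 intervalMeasure) (hz : ‖z‖ < 1 / 2)
    (hY : Y (false, n) ≠ 0 ∨ Y (true, n) ≠ 0) :
    IsDiracEigenvalue P Q ((-1 : ℂ) ^ n) (n + z) := by
  have hsum : Summable fun a => ‖Y a‖ ^ 2 := by
    simpa using hs.summable_mul_norm_sq (norm_diracDiag_le n hz) (w := fun _ => 1)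
      (fun _ => zero_le_one) fun a => (one_mul _).trans_le (diracWeight_le_two n a)
  obtain ⟨w₁, w₂, hw₁, hw₂, rfl⟩ := exists_memLp_diracVector hsum fun a => hs.eq_zero_dirac
  obtain ⟨y₁, y₂, hyw₁, hyw₂, hgraph⟩ := exists_diracGraph_of_coeff_eq (lam := n + z) hP hQ hw₁ hw₂
    fun a ha => by
      rw [← hs.apply_dirac hz ha]
      exact (hs.hasSum a (diracWeight_ne_zero_or_iff.2 ha)).unique
        (hasSum_diracMatrix_mul_diracVector hP hQ hw₁ hw₂ ha)
  refine ⟨y₁, y₂, ?_, hgraph⟩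
  rw [diracVector_false_of_even (by simp), diracVector_true_of_even (by simp),
    ← fourierCoeffPi_congr hyw₁, ← fourierCoeffPi_congr hyw₂] at hY
  rcases hY with h₁ | h₂
  · obtain ⟨x, hx, hne⟩ := exists_ne_zero_of_fourierCoeffPi h₁
    exact ⟨x, hx, .inl hne⟩
  · obtain ⟨x, hx, hne⟩ := exists_ne_zero_of_fourierCoeffPi h₂
    exact ⟨x, hx, .inr hne⟩

theorem isDiracEigenvalue_iff (hP : MemLp P 2 intervalMeasure) (hQ : MemLp Q 2 intervalMeasure)
    {M : ℝ} (h : IsModelPair (diracMatrix P Q) (diracWeight n) (false, n) (true, n) M)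
    (hz : ‖z‖ < 1 / 2) :
    IsDiracEigenvalue P Q ((-1 : ℂ) ^ n) (n + z) ↔
      (z - reducedEntry (diracMatrix P Q) (diracDiag n z) (false, n) (false, n)) *
          (z - reducedEntry (diracMatrix P Q) (diracDiag n z) (true, n) (true, n)) =
        reducedEntry (diracMatrix P Q) (diracDiag n z) (false, n) (true, n) *
          reducedEntry (diracMatrix P Q) (diracDiag n z) (true, n) (false, n) := by
  have hd := norm_diracDiag_le n hz
  constructor
  · rintro ⟨y₁, y₂, hne, hgraph⟩
    have hs := isSolution_diracVector hP hQ hz hgraph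
    obtain ⟨g₁, g₂, hD₁, hD₂, -⟩ := hgraph
    exact hs.det_eq_zero h hd (exists_diracVector_ne_zero hD₁.continuousOn hD₂.continuousOn hne n)
  · intro hdet
    obtain ⟨Y, G, hY, hs⟩ := h.exists_isSolution hd hdet
    exact hs.isDiracEigenvalue hP hQ hz hY

end Dirac

/-! ### The two eigenvalues close to `λ_n^0` -/

theorem LexLE.antisymm {a b : ℂ} (hab : LexLE a b) (hba : LexLE b a) : a = b := by
  rcases hab with hre | ⟨hre, him⟩ <;> rcases hba with hre' | ⟨hre', him'⟩
  · exact absurd hre hre'.not_gt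
  · linarith
  · linarith
  · exact Complex.ext hre (le_antisymm him him')

theorem LexLE.refl (a : ℂ) : LexLE a a := .inr ⟨rfl, le_rfl⟩

theorem LexLE.total (a b : ℂ) : LexLE a b ∨ LexLE b a := by
  rcases lt_trichotomy a.re b.re with hre | hre | hre
  · exact .inl (.inl hre)
  · exact (le_total a.im b.im).imp (fun him => .inr ⟨hre, him⟩) fun him => .inr ⟨hre.symm, him⟩
  · exact .inr (.inl hre)

theorem lexMax_eq {S : Set ℂ} {a : ℂ} (ha : a ∈ S) (h : ∀ b ∈ S, LexLE b a) : lexMax S = a := by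
  have hex : ∃ a ∈ S, ∀ b ∈ S, LexLE b a := ⟨a, ha, h⟩
  rw [lexMax, dif_pos hex]
  exact (h _ hex.choose_spec.1).antisymm (hex.choose_spec.2 a ha)

theorem lexMin_eq {S : Set ℂ} {a : ℂ} (ha : a ∈ S) (h : ∀ b ∈ S, LexLE a b) : lexMin S = a := by
  have hex : ∃ a ∈ S, ∀ b ∈ S, LexLE a b := ⟨a, ha, h⟩
  rw [lexMin, dif_pos hex]
  exact (hex.choose_spec.2 a ha).antisymm (h _ hex.choose_spec.1)

theorem pair_eq_lexMin_lexMax (a b : ℂ) : ({a, b} : Set ℂ) = {lexMin {a, b}, lexMax {a, b}} := by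
  wlog hab : LexLE a b generalizing a b
  · rw [Set.pair_comm a b]
    exact this b a ((LexLE.total a b).resolve_left hab)
  have hmin : lexMin {a, b} = a := lexMin_eq (by simp) (by simp [hab, LexLE.refl])
  have hmax : lexMax {a, b} = b := lexMax_eq (by simp) (by simp [hab, LexLE.refl])
  rw [hmin, hmax]

theorem eq_lexMin_lexMax {S : Set ℂ} (hne : S.Nonempty)
    (h : ∀ a ∈ S, ∀ b ∈ S, ∀ c ∈ S, b ≠ a → c ≠ a → b = c) : S = {lexMin S, lexMax S} := by
  obtain ⟨a, ha⟩ := hne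
  obtain ⟨b, rfl⟩ : ∃ b, S = {a, b} := by
    by_cases hb : ∃ b ∈ S, b ≠ a
    · obtain ⟨b, hb, hba⟩ := hb
      refine ⟨b, Set.Subset.antisymm (fun c hc => ?_) (Set.pair_subset ha hb)⟩
      exact or_iff_not_imp_left.2 fun hca => h a ha c hc b hb hca hba
    · push Not at hb
      exact ⟨a, Set.Subset.antisymm (fun c hc => .inl (hb c hc)) (Set.pair_subset ha ha)⟩
  exact pair_eq_lexMin_lexMax a b

namespace Potential

/-- The periodic or antiperiodic eigenvalues `λ_n^0 + z` of `L(v)` close to `λ_n^0` are described by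
the reduced matrix at `z`, and the entries of that matrix are small compared to the radius of the
disc. -/
structure IsReducible (v : Potential) (n : ℤ) (ε : ℝ) : Prop where
  smallEntries : SmallEntries (v.radius n) ε (v.alpha n) (v.betaMinus n) (v.betaPlus n)
  isEigenvalue_iff : ∀ z ∈ Metric.ball (0 : ℂ) (v.radius n),
    v.IsEigenvalue ((-1 : ℂ) ^ n) (v.lam0 n + z) ↔
      (z - v.alpha n z) ^ 2 = v.betaMinus n z * v.betaPlus n z

theorem isReducible_hill {c : ℂ} {Q : ℝ → ℂ} {n : ℤ} {M ε : ℝ} (hQ : MemLp Q 2 intervalMeasure)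
    (hn : 0 < n) (h : IsModelPair (hillMatrix c Q) (hillWeight n) (-n) n M)
    (hM : 3 * M ≤ ε * (n / 4)) : (hill c Q).IsReducible n ε where
  smallEntries := h.smallEntries (d := hillDiag n) (by positivity) hM
    (fun z hz => norm_hillDiag_le hn (mem_ball_zero_iff.1 hz)) (differentiableOn_hillDiag hn)
  isEigenvalue_iff z hz := by
    replace hz : ‖z‖ < n / 4 := mem_ball_zero_iff.1 hz
    have hdiag := h.reducedEntry_diag_eq (norm_hillDiag_le hn hz) (Equiv.neg ℤ)
      (fun i j => by simp only [hillMatrix, Equiv.neg_apply]; congr 1; ring)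
      (hillWeight_neg n)
      (fun j => by
        have hparity : Even (-j - n) ↔ Even (j - n) := by simp [Int.even_sub]
        have hne : -j ≠ n ∧ -j ≠ -n ↔ j ≠ n ∧ j ≠ -n := by omega
        simp only [hillDiag, Equiv.neg_apply, hparity, hne, Int.cast_neg, neg_sq])
      (neg_neg n)
    refine (isHillEigenvalue_iff hQ hn h hz).trans ?_
    rw [hdiag, ← sq]
    rfl

theorem isReducible_dirac {P Q : ℝ → ℂ} {n : ℤ} {M ε : ℝ} (hP : MemLp P 2 intervalMeasure)
    (hQ : MemLp Q 2 intervalMeasure)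
    (h : IsModelPair (diracMatrix P Q) (diracWeight n) (false, n) (true, n) M)
    (hM : 3 * M ≤ ε * (1 / 2)) : (dirac P Q).IsReducible n ε where
  smallEntries := h.smallEntries (d := diracDiag n) one_half_pos hM
    (fun z hz => norm_diracDiag_le n (mem_ball_zero_iff.1 hz)) (differentiableOn_diracDiag n)
  isEigenvalue_iff z hz := by
    replace hz : ‖z‖ < 1 / 2 := mem_ball_zero_iff.1 hz
    have hdiag := h.reducedEntry_diag_eq (norm_diracDiag_le n hz)
      (Equiv.boolNot.prodCongr (Equiv.refl ℤ))
      (fun i j => by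
        obtain ⟨_ | _, k⟩ := i <;> obtain ⟨_ | _, l⟩ := j <;>
          simp [diracMatrix, add_comm, sub_eq_add_neg])
      (fun _ => rfl) (fun _ => rfl) rfl
    refine (isDiracEigenvalue_iff hP hQ h hz).trans ?_
    rw [hdiag, ← sq]
    rfl

theorem eventually_isReducible (v : Potential) (hv : v.Admissible) {ε : ℝ} (hε : 0 < ε) :
    ∀ᶠ n in cofinite, n ∈ v.indices → v.IsReducible n ε := by
  cases v with
  | hill c Q =>
    filter_upwards [eventually_isModelPair_hill c hv (show 0 < ε / 12 by positivity)] with n h hn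
    exact isReducible_hill hv hn (h hn) (by linarith)
  | dirac P Q =>
    filter_upwards [eventually_isModelPair_dirac hv.1 hv.2 (show 0 < ε / 6 by positivity)]
      with n h _
    exact isReducible_dirac hv.1 hv.2 h (by linarith)

namespace IsReducible

variable {v : Potential} {n : ℤ} {ε : ℝ}

theorem mem_eigenvaluesNear_iff (h : v.IsReducible n ε) {z : ℂ} :
    v.lam0 n + z ∈ v.eigenvaluesNear n ↔
      z ∈ Metric.ball (0 : ℂ) (v.radius n) ∧
        (z - v.alpha n z) ^ 2 = v.betaMinus n z * v.betaPlus n z := by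
  rw [eigenvaluesNear, Set.mem_ofPred_eq, add_sub_cancel_left, and_comm, ← mem_ball_zero_iff]
  exact and_congr_right (h.isEigenvalue_iff z)

theorem eigenvaluesNear_eq (h : v.IsReducible n ε) (hε : ε ≤ 1 / 100) :
    v.eigenvaluesNear n = {v.lamMinus n, v.lamPlus n} := by
  refine eq_lexMin_lexMax ?_ fun a ha b hb c hc hba hca => ?_
  · obtain ⟨z, hz, hroot⟩ := h.smallEntries.exists_root hε
    exact ⟨v.lam0 n + z, h.mem_eigenvaluesNear_iff.2 ⟨hz, hroot⟩⟩
  · rw [← add_sub_cancel (v.lam0 n) a, h.mem_eigenvaluesNear_iff] at ha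
    rw [← add_sub_cancel (v.lam0 n) b, h.mem_eigenvaluesNear_iff] at hb
    rw [← add_sub_cancel (v.lam0 n) c, h.mem_eigenvaluesNear_iff] at hc
    exact sub_left_inj.1 (h.smallEntries.root_eq_of_three hε ha.1 hb.1 hc.1 ha.2 hb.2 hc.2
      (sub_left_inj.not.2 hba) (sub_left_inj.not.2 hca))

theorem root_iff (h : v.IsReducible n ε) (hε : ε ≤ 1 / 100) {z : ℂ} :
    z ∈ Metric.ball (0 : ℂ) (v.radius n) ∧
        (z - v.alpha n z) ^ 2 = v.betaMinus n z * v.betaPlus n z ↔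
      z = v.zMinus n ∨ z = v.zPlus n := by
  rw [← h.mem_eigenvaluesNear_iff, h.eigenvaluesNear_eq hε, Set.mem_insert_iff,
    Set.mem_singleton_iff, zMinus, zPlus, eq_sub_iff_add_eq', eq_sub_iff_add_eq']

theorem zMinus_mem_ball (h : v.IsReducible n ε) (hε : ε ≤ 1 / 100) :
    v.zMinus n ∈ Metric.ball (0 : ℂ) (v.radius n) :=
  ((h.root_iff hε).2 (.inl rfl)).1

theorem zPlus_mem_ball (h : v.IsReducible n ε) (hε : ε ≤ 1 / 100) :
    v.zPlus n ∈ Metric.ball (0 : ℂ) (v.radius n) :=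
  ((h.root_iff hε).2 (.inr rfl)).1

theorem norm_zMinus_lt (h : v.IsReducible n ε) (hε : ε ≤ 1 / 100) :
    ‖v.zMinus n‖ < v.radius n / 4 :=
  h.smallEntries.norm_root_lt hε (h.zMinus_mem_ball hε) ((h.root_iff hε).2 (.inl rfl)).2

theorem norm_zPlus_lt (h : v.IsReducible n ε) (hε : ε ≤ 1 / 100) :
    ‖v.zPlus n‖ < v.radius n / 4 :=
  h.smallEntries.norm_root_lt hε (h.zPlus_mem_ball hε) ((h.root_iff hε).2 (.inr rfl)).2

end IsReducible

/-- Square roots `sM`, `sP` of `β_n^-`, `β_n^+` that separate `z_n^+` from `z_n^-` on `D_n` and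
whose product varies on `D_n` by at most the fraction `3 κ` of its value at `z_n^*`. -/
structure HasBranches (v : Potential) (n : ℤ) (κ : ℝ) (sM sP : ℂ → ℂ) : Prop where
  separated : IsSeparatedBy (v.alpha n) (v.betaMinus n) (v.betaPlus n) (v.disc n) (v.zPlus n)
    (v.zMinus n) sM sP
  norm_sub_le : ∀ z ∈ v.disc n, ‖sM z * sP z - sM (v.zStar n) * sP (v.zStar n)‖ ≤
    3 * κ * ‖sM (v.zStar n) * sP (v.zStar n)‖

variable {v : Potential} {n : ℤ} {ε κ : ℝ}

theorem zStar_mem_disc (v : Potential) (n : ℤ) : v.zStar n ∈ v.disc n :=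
  Metric.mem_closedBall_self (by positivity)

theorem IsReducible.exists_hasBranches (h : v.IsReducible n ε) (hε : ε ≤ 1 / 100)
    (hκ : κ ≤ 1 / 100)
    (hne : v.betaMinus n (v.zStar n) ≠ 0 ∧ v.betaPlus n (v.zStar n) ≠ 0)
    (hconst : ∀ z ∈ v.disc n,
      ‖v.betaMinus n z - v.betaMinus n (v.zStar n)‖ ≤ κ * ‖v.betaMinus n (v.zStar n)‖ ∧
      ‖v.betaPlus n z - v.betaPlus n (v.zStar n)‖ ≤ κ * ‖v.betaPlus n (v.zStar n)‖) :
    ∃ sM sP : ℂ → ℂ, v.HasBranches n κ sM sP := by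
  obtain ⟨sM, sP, hsep, hvar⟩ := h.smallEntries.exists_isSeparatedBy hε hκ rfl
    (h.zPlus_mem_ball hε) (h.zMinus_mem_ball hε)
    (fun z hz => (and_iff_right hz).symm.trans (h.root_iff hε)) hne.1 hne.2 rfl
    (fun z hz => (hconst z hz).1) fun z hz => (hconst z hz).2
  exact ⟨sM, sP, hsep, hvar⟩

theorem HasBranches.mul_zStar_ne_zero {sM sP : ℂ → ℂ} (hs : v.HasBranches n κ sM sP)
    (hne : v.betaMinus n (v.zStar n) ≠ 0 ∧ v.betaPlus n (v.zStar n) ≠ 0) :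
    sM (v.zStar n) * sP (v.zStar n) ≠ 0 := by
  obtain ⟨U, -, hU, -, -, hM, hP⟩ := hs.separated.exists_analytic
  have hmem := hU (v.zStar_mem_disc n)
  rw [← hM _ hmem, ← hP _ hmem] at hne
  exact mul_ne_zero (ne_zero_pow two_ne_zero hne.1) (ne_zero_pow two_ne_zero hne.2)

theorem IsReducible.norm_gap_ratio_sub_one_le (h : v.IsReducible n ε) (hε : ε ≤ 1 / 100)
    (hκ : κ ≤ 1 / 100)
    (hne : v.betaMinus n (v.zStar n) ≠ 0 ∧ v.betaPlus n (v.zStar n) ≠ 0) {sM sP : ℂ → ℂ}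
    (hs : v.HasBranches n κ sM sP) :
    ‖v.gap n / (2 * sM (v.zStar n) * sP (v.zStar n)) - 1‖ ≤ 3 * (ε + κ) := by
  obtain ⟨hp, hrp⟩ := (hs.separated.root_plus _).2 rfl
  obtain ⟨hm, hrm⟩ := (hs.separated.root_minus _).2 rfl
  have hr := h.smallEntries.pos
  have hratio := h.smallEntries.norm_gap_div_sub_one_le hε (s := fun z => sM z * sP z) hκ
    ((h.norm_zPlus_lt hε).trans (by linarith)) ((h.norm_zMinus_lt hε).trans (by linarith))
    (hs.mul_zStar_ne_zero hne) hrp hrm (hs.norm_sub_le _ hp) (hs.norm_sub_le _ hm)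
  rwa [zPlus, zMinus, sub_sub_sub_cancel_right, ← mul_assoc] at hratio

end Potential

theorem eventually_cofinite_int_iff {p : ℤ → Prop} :
    (∀ᶠ n in cofinite, p n) ↔ ∃ N : ℤ, ∀ n, N ≤ |n| → p n := by
  rw [Int.cofinite_eq, ← comap_abs_atTop, (atTop_basis.comap _).eventually_iff]
  simp

theorem eventually_le_abs_and_mem (Δ : Set ℤ) (N : ℤ) :
    ∀ᶠ n in cofinite ⊓ 𝓟 Δ, N ≤ |n| ∧ n ∈ Δ :=
  ((eventually_cofinite_int_iff.2 ⟨N, fun _ h => h⟩).filter_mono inf_le_left).and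
    (mem_inf_of_right (mem_principal_self Δ))

end SpectralGap

theorem theorem3_general (v : SpectralGap.Potential) (hv : v.Admissible) (Δ : Set ℤ)
    (hΔv : Δ ⊆ v.indices) (η : ℤ → ℝ) (hη : Tendsto η (cofinite ⊓ 𝓟 Δ) (𝓝 0)) (K : ℝ) (N₀ : ℤ)
    (hne : ∀ n ∈ Δ, N₀ ≤ |n| →
      v.betaMinus n (v.zStar n) ≠ 0 ∧ v.betaPlus n (v.zStar n) ≠ 0)
    (hconst : ∀ n ∈ Δ, N₀ ≤ |n| → ∀ z ∈ v.disc n,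
      ‖v.betaMinus n z - v.betaMinus n (v.zStar n)‖ ≤ K * η n * ‖v.betaMinus n (v.zStar n)‖ ∧
      ‖v.betaPlus n z - v.betaPlus n (v.zStar n)‖ ≤ K * η n * ‖v.betaPlus n (v.zStar n)‖) :
    ∃ (N : ℤ) (sM sP : ℤ → ℂ → ℂ),
      (∀ n ∈ Δ, N ≤ |n| →
        v.eigenvaluesNear n = {v.lamMinus n, v.lamPlus n} ∧
        SpectralGap.IsSeparatedBy (v.alpha n) (v.betaMinus n) (v.betaPlus n) (v.disc n)
          (v.zPlus n) (v.zMinus n) (sM n) (sP n)) ∧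
      Tendsto (fun n => v.gap n / (2 * sM n (v.zStar n) * sP n (v.zStar n)))
        (cofinite ⊓ 𝓟 Δ) (𝓝 1) := by
  have hκ : Tendsto (fun n => K * η n) (cofinite ⊓ 𝓟 Δ) (𝓝 0) := by simpa using hη.const_mul K
  have hred : ∀ ε : ℝ, 0 < ε → ∀ᶠ n in cofinite ⊓ 𝓟 Δ, v.IsReducible n ε := fun ε hε =>
    eventually_inf_principal.2 ((v.eventually_isReducible hv hε).mono fun n h hn => h (hΔv hn))
  have hbranches : ∀ᶠ n in cofinite ⊓ 𝓟 Δ, ∃ sM sP,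
      v.eigenvaluesNear n = {v.lamMinus n, v.lamPlus n} ∧ v.HasBranches n (K * η n) sM sP := by
    have hpos : (0 : ℝ) < 1 / 100 := by norm_num
    filter_upwards [hred _ hpos, hκ.eventually_le_const hpos,
      SpectralGap.eventually_le_abs_and_mem Δ N₀] with n h hκn ⟨hn, hnΔ⟩
    obtain ⟨sM, sP, hs⟩ := h.exists_hasBranches le_rfl hκn (hne n hnΔ hn) (hconst n hnΔ hn)
    exact ⟨sM, sP, h.eigenvaluesNear_eq le_rfl, hs⟩
  rw [eventually_inf_principal, SpectralGap.eventually_cofinite_int_iff] at hbranches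
  obtain ⟨N, hN⟩ := hbranches
  choose! sM sP hspec hs using hN
  refine ⟨N, sM, sP, fun n hn hNn => ⟨hspec n hNn hn, (hs n hNn hn).separated⟩,
    Metric.tendsto_nhds.2 fun ε hε => ?_⟩
  have hδ : 0 < min (1 / 100) (ε / 12) := by positivity
  filter_upwards [hred _ hδ, hκ.eventually_lt_const hδ, SpectralGap.eventually_le_abs_and_mem Δ N₀,
    SpectralGap.eventually_le_abs_and_mem Δ N] with n h hκn ⟨hn, hnΔ⟩ ⟨hNn, _⟩
  rw [dist_eq_norm]
  refine (h.norm_gap_ratio_sub_one_le (min_le_left _ _) (hκn.le.trans (min_le_left _ _))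
    (hne n hnΔ hn) (hs n hNn hnΔ)).trans_lt ?_
  linarith [min_le_right (1 / 100 : ℝ) (ε / 12)]

theorem theorem3 (v : SpectralGap.Potential) (hv : v.Admissible) (Δ : Set ℤ) (hΔ : Δ.Infinite)
    (hΔv : Δ ⊆ v.indices) (hpar : (∀ n ∈ Δ, Even n) ∨ (∀ n ∈ Δ, Odd n))
    (η : ℤ → ℝ) (hη_pos : ∀ n ∈ Δ, 0 < η n)
    (hη : Filter.Tendsto η (Filter.cofinite ⊓ Filter.principal Δ) (nhds 0))
    (K : ℝ) (N₀ : ℤ)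
    (hne : ∀ n ∈ Δ, N₀ ≤ |n| →
      v.betaMinus n (v.zStar n) ≠ 0 ∧ v.betaPlus n (v.zStar n) ≠ 0)
    (hconst : ∀ n ∈ Δ, N₀ ≤ |n| → ∀ z ∈ v.disc n,
      ‖v.betaMinus n z - v.betaMinus n (v.zStar n)‖ ≤ K * η n * ‖v.betaMinus n (v.zStar n)‖ ∧
      ‖v.betaPlus n z - v.betaPlus n (v.zStar n)‖ ≤ K * η n * ‖v.betaPlus n (v.zStar n)‖) :
    ∃ (N : ℤ) (sM sP : ℤ → ℂ → ℂ),
      (∀ n ∈ Δ, N ≤ |n| →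
        v.eigenvaluesNear n = {v.lamMinus n, v.lamPlus n} ∧
        (∃ U : Set ℂ, IsOpen U ∧ v.disc n ⊆ U ∧
          AnalyticOnNhd ℂ (sM n) U ∧ AnalyticOnNhd ℂ (sP n) U ∧
          (∀ z ∈ U, sM n z ^ 2 = v.betaMinus n z) ∧ (∀ z ∈ U, sP n z ^ 2 = v.betaPlus n z)) ∧
        (∀ z : ℂ, (z ∈ v.disc n ∧ z - v.alpha n z = sM n z * sP n z) ↔ z = v.zPlus n) ∧
        (∀ z : ℂ, (z ∈ v.disc n ∧ z - v.alpha n z = -(sM n z * sP n z)) ↔ z = v.zMinus n)) ∧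
      Filter.Tendsto (fun n => v.gap n / (2 * sM n (v.zStar n) * sP n (v.zStar n)))
        (Filter.cofinite ⊓ Filter.principal Δ) (nhds 1) := by
  obtain ⟨N, sM, sP, hN, hgap⟩ := theorem3_general v hv Δ hΔv η hη K N₀ hne hconst
  exact ⟨N, sM, sP, fun n hn hNn => (hN n hn hNn).imp_right fun h => ⟨h.1, h.2, h.3⟩, hgap⟩
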